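/- **Setting.** Let $\mathcal T=\{(\theta_1,\theta_2)\in\mathbf R^2:\ \theta_1>0,\ \theta_2>0,\ \theta_1+\theta_2<\pi\}$ be the space of triangles, parametrized by two of their angles. For a nondegenerate triangle $T\subset\mathbf R^2$ with these angles, let $G\subset O(2)$ be the group generated by the linear parts $r_1,r_2,r_3$ of the reflections in the sides of $T$. The Katok–Zemljakov surface $S_T$ is obtained from the copies $\{g\}\times(T\setminus\{\text{vertices}\})$, $g\in G$, by gluing the $i$-th side of the copy $g$ to the $i$-th side of the copy $gr_i$ by the identity; the maps $(g,x)\mapsto gx$ give, up to translation, the charts of a translation surface. For a translation surface $S$ let $\overline S$ be its metric completion for the flat length metric, and let $\Sigma$ be the set of cone type singularities: points of $\overline S\setminus S$ having a neighbourhood which is a cyclic cover, of finite or infinite degree, of a flat disc ramified at the centre. A saddle connection is a geodesic of finite length in $S$ whose two extremities are in $\Sigma$, and its holonomy vector is its developed vector in $\mathbf R^2$. Define the following subfields of $\mathbf R$. * $K_{sc}(S)$: with $\Lambda\subset\mathbf R^2$ the image of $H_1(\overline S,\Sigma;\mathbf Z)$ under the holonomy map and $n$ the dimension of the real span of $\Lambda$,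 the smallest subfield $k\subset\mathbf R$ such that the $k$-span of $\Lambda$ is isomorphic to $k^n$. * $K_{cr}(S)$: the field generated by the cross ratios of (the slopes of) quadruples of pairwise nonparallel holonomy vectors of saddle connections. * $K_{tr}(S)$: the field generated by the traces of the elements of the Veech group of $S$, i.e. of the differentials $A\in GL_+(2,\mathbf R)$ of orientation preserving affine automorphisms of $S$. **Proposition.** For Lebesgue-almost every $(\theta_1,\theta_2)\in\mathcal T$, for every triangle $T$ with angles $\theta_1,\theta_2$ at its first two vertices, none of the three fields $K_{sc}(S_T)$, $K_{cr}(S_T)$, $K_{tr}(S_T)$ is a number field (a finite extension of $\mathbf Q$). That is, the complement in $\mathcal T$ of the set of such $(\theta_1,\theta_2)$ has Lebesgue measure zero. -/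

import Mathlib

open Set Filter Topology
open scoped ENNReal

noncomputable section

/-! ## Translation surfaces and their flat metric -/

/-- `S` is a translation surface: a manifold modelled on the plane `ℂ = ℝ²` whose changes of
charts are locally translations. -/
class IsTranslationSurface (S : Type) [TopologicalSpace S] [ChartedSpace ℂ S] : Prop where
  transition : ∀ e ∈ atlas ℂ S, ∀ e' ∈ atlas ℂ S, ∀ x ∈ e.source ∩ e'.source,
    ∀ᶠ y in 𝓝 x, e' y - e y = e' x - e x

/-- `γ` restricted to the time interval `I` is a straight (geodesic) arc with constant velocity
vector `v` for the flat structure of `S`. -/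
def IsGeodesicOn (S : Type) [TopologicalSpace S] [ChartedSpace ℂ S]
    (γ : ℝ → S) (v : ℂ) (I : Set ℝ) : Prop :=
  ContinuousOn γ I ∧ ∀ s ∈ I, ∃ e ∈ atlas ℂ S, γ s ∈ e.source ∧
    ∀ᶠ t in 𝓝[I] s, e (γ t) = e (γ s) + ((t - s : ℝ) : ℂ) * v

/-- `PolygonalPath S p q L`: there is a piecewise straight path of length `L` from `p` to `q`. -/
inductive PolygonalPath (S : Type) [TopologicalSpace S] [ChartedSpace ℂ S] : S → S → ℝ → Prop
  | nil (p : S) : PolygonalPath S p p 0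
  | cons {p q s : S} {L : ℝ} (γ : ℝ → S) (v : ℂ) (hγ : IsGeodesicOn S γ v (Icc 0 1))
      (h0 : γ 0 = p) (h1 : γ 1 = q) (h : PolygonalPath S q s L) : PolygonalPath S p s (‖v‖ + L)

section metric

variable {S : Type} [TopologicalSpace S] [ChartedSpace ℂ S]

theorem PolygonalPath.append {p q s : S} {L M : ℝ} (h : PolygonalPath S p q L)
    (h' : PolygonalPath S q s M) : PolygonalPath S p s (L + M) := by
  induction h with
  | nil p => simpa using h'
  | cons γ v hγ h0 h1 _ ih =>
    rw [add_assoc]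
    exact .cons γ v hγ h0 h1 (ih h')

theorem IsGeodesicOn.reverse {γ : ℝ → S} {v : ℂ} (h : IsGeodesicOn S γ v (Icc 0 1)) :
    IsGeodesicOn S (fun t => γ (1 - t)) (-v) (Icc 0 1) := by
  have hm : MapsTo (fun t : ℝ => 1 - t) (Icc 0 1) (Icc 0 1) := by
    intro t ht
    exact ⟨by linarith [ht.2], by linarith [ht.1]⟩
  have hc : Continuous fun t : ℝ => 1 - t := by fun_prop
  refine ⟨h.1.comp hc.continuousOn hm, fun s hs => ?_⟩
  obtain ⟨e, he, hse, hev⟩ := h.2 (1 - s) (hm hs)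
  refine ⟨e, he, hse, ?_⟩
  have ht : Tendsto (fun t : ℝ => 1 - t) (𝓝[Icc 0 1] s) (𝓝[Icc 0 1] (1 - s)) :=
    (hc.continuousWithinAt).tendsto_nhdsWithin hm
  filter_upwards [ht.eventually hev] with t h2
  rw [h2]
  push_cast
  ring

theorem PolygonalPath.reverse {p q : S} {L : ℝ} (h : PolygonalPath S p q L) :
    PolygonalPath S q p L := by
  induction h with
  | nil p => exact .nil p
  | @cons p q s L γ v hγ h0 h1 _ ih =>
    have := PolygonalPath.cons (fun t => γ (1 - t)) (-v) hγ.reverse (by simpa using h1)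
      (by simpa using h0) (.nil p)
    have := ih.append this
    rwa [norm_neg, add_zero, add_comm] at this

end metric

/-- The space `S` viewed as a (pseudo-e)metric space through its flat length metric. -/
def FlatMetric (S : Type) : Type := S

/-- The natural flat metric: the infimum of the lengths of piecewise straight paths. -/
instance (S : Type) [TopologicalSpace S] [ChartedSpace ℂ S] : PseudoEMetricSpace (FlatMetric S) where
  edist p q := ⨅ (L : ℝ) (_ : PolygonalPath S p q L), ENNReal.ofReal L
  edist_self p := le_antisymm
    (iInf₂_le_of_le 0 (PolygonalPath.nil (S := S) p) (by simp)) zero_le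
  edist_comm p q := le_antisymm
    (le_iInf₂ fun L h => iInf₂_le L h.reverse) (le_iInf₂ fun L h => iInf₂_le L h.reverse)
  edist_triangle p q s := by
    simp only [ENNReal.iInf_add, ENNReal.add_iInf]
    exact le_iInf₂ fun M h' => le_iInf₂ fun L h =>
      iInf₂_le_of_le _ (PolygonalPath.append (S := S) h h') ENNReal.ofReal_add_le

/-- The metric completion `S̄` of `S` for the flat metric. -/
abbrev FlatCompletion (S : Type) [TopologicalSpace S] [ChartedSpace ℂ S] : Type :=
  UniformSpace.Completion (FlatMetric S)

/-- The canonical map from `S` to its metric completion. -/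
def toCompletion {S : Type} [TopologicalSpace S] [ChartedSpace ℂ S] (x : S) : FlatCompletion S :=
  UniformSpace.Completion.coe' (α := FlatMetric S) x

/-! ## Cone type singularities and saddle connections -/

/-- `Φ` is a parametrization, in polar coordinates `(ρ, φ)`, of a punctured neighbourhood of the
point `p` of the completion by a punctured Euclidean cone of radius `r`, of total angle `2πk` if
`k ≥ 1`, and of infinite angle if `k = 0` (i.e. by the cyclic covering of degree `k`, respectively
the universal covering, of the punctured disc of radius `r`): in the charts of `S`, the map `Φ` is
`(ρ, φ) ↦ ρ e^{iφ}` up to translation, and `Φ` induces an injection on the cone. -/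
structure IsConeParam (S : Type) [TopologicalSpace S] [ChartedSpace ℂ S]
    (p : FlatCompletion S) (k : ℕ) (r : ℝ) (Φ : ℝ × ℝ → S) : Prop where
  radius_pos : 0 < r
  continuousOn : ContinuousOn Φ (Ioo 0 r ×ˢ univ)
  flat : ∀ a ∈ Ioo 0 r ×ˢ (univ : Set ℝ), ∃ e ∈ atlas ℂ S, Φ a ∈ e.source ∧
    ∀ᶠ b in 𝓝 a, e (Φ b) - b.1 * Complex.exp (b.2 * Complex.I) =
      e (Φ a) - a.1 * Complex.exp (a.2 * Complex.I)
  eq_iff : ∀ a ∈ Ioo 0 r ×ˢ (univ : Set ℝ), ∀ b ∈ Ioo 0 r ×ˢ (univ : Set ℝ),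
    Φ a = Φ b ↔ a.1 = b.1 ∧ ∃ n : ℤ, a.2 - b.2 = n * (2 * Real.pi * k)
  tendsto : ∀ φ : ℝ, Tendsto (fun ρ => toCompletion (Φ (ρ, φ))) (𝓝[>] 0) (𝓝 p)
  mem_nhds : insert p ((fun a => toCompletion (Φ a)) '' (Ioo 0 r ×ˢ univ)) ∈ 𝓝 p

/-- The set `Σ` of cone type singularities (of finite or infinite angle) of the completion. -/
def coneSingularities (S : Type) [TopologicalSpace S] [ChartedSpace ℂ S] :
    Set (FlatCompletion S) :=
  {p | p ∉ range (toCompletion (S := S)) ∧ ∃ k r Φ, IsConeParam S p k r Φ}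

/-- The holonomy vectors of saddle connections: vectors `v` developed by a geodesic of finite
length in `S` whose two extremities are cone type singularities. -/
def saddleVectors (S : Type) [TopologicalSpace S] [ChartedSpace ℂ S] : Set ℂ :=
  {v | v ≠ 0 ∧ ∃ γ : ℝ → S, IsGeodesicOn S γ v (Ioo 0 1) ∧
    ∃ p ∈ coneSingularities S, ∃ q ∈ coneSingularities S,
      Tendsto (fun t => toCompletion (γ t)) (𝓝[>] 0) (𝓝 p) ∧
      Tendsto (fun t => toCompletion (γ t)) (𝓝[<] 1) (𝓝 q)}

/-! ## Holonomy on relative homology -/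

/-- `z` is a local developing map on the open set `U` of the completion: it is continuous, and on
the points of `S` it agrees locally with the charts up to translation. -/
def IsLocalDev (S : Type) [TopologicalSpace S] [ChartedSpace ℂ S]
    (U : Set (FlatCompletion S)) (z : FlatCompletion S → ℂ) : Prop :=
  IsOpen U ∧ ContinuousOn z U ∧ ∀ x : S, toCompletion x ∈ U →
    ∃ e ∈ atlas ℂ S, x ∈ e.source ∧
      ∀ᶠ y in 𝓝 x, e y - z (toCompletion y) = e x - z (toCompletion x)

/-- The singular simplex (path) `σ` in the completion has holonomy `v`: continuing local developing
maps along `σ` gives a curve `δ` in the plane from `δ 0` to `δ 1 = δ 0 + v`. -/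
def HasHolonomy (S : Type) [TopologicalSpace S] [ChartedSpace ℂ S]
    (σ : C(unitInterval, FlatCompletion S)) (v : ℂ) : Prop :=
  ∃ δ : unitInterval → ℂ, v = δ 1 - δ 0 ∧ ∀ t, ∃ U z, IsLocalDev S U z ∧ σ t ∈ U ∧
    ∀ᶠ s in 𝓝 t, δ s - z (σ s) = δ t - z (σ t)

/-- The boundary of a singular `1`-chain with integer coefficients. -/
def chainBoundary {X : Type} [TopologicalSpace X] (c : C(unitInterval, X) →₀ ℤ) : X →₀ ℤ :=
  c.sum fun σ n => Finsupp.single (σ 1) n - Finsupp.single (σ 0) n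

/-- The image of `H₁(S̄, Σ; ℤ)` in the plane under the holonomy map: the holonomies of singular
`1`-chains of `S̄` whose boundary is supported on `Σ` (relative cycles). -/
def relativeHolonomy (S : Type) [TopologicalSpace S] [ChartedSpace ℂ S] : Set ℂ :=
  {v | ∃ (c : C(unitInterval, FlatCompletion S) →₀ ℤ) (w : C(unitInterval, FlatCompletion S) → ℂ),
    (∀ x ∈ (chainBoundary c).support, x ∈ coneSingularities S) ∧
    (∀ σ ∈ c.support, HasHolonomy S σ (w σ)) ∧ v = c.sum fun σ n => n • w σ}

/-! ## The three fields -/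

/-- The field of saddle connections (segment field): with `Λ` the image of `H₁(S̄, Σ; ℤ)` under
holonomy and `n` the dimension of the real span of `Λ`, the smallest subfield `k` of `ℝ` such that
the `k`-span of `Λ` is isomorphic to `kⁿ`. -/
def Ksc (S : Type) [TopologicalSpace S] [ChartedSpace ℂ S] : Subfield ℝ :=
  sInf {k | Module.rank k (Submodule.span k (relativeHolonomy S)) =
    Module.rank ℝ (Submodule.span ℝ (relativeHolonomy S))}

/-- The determinant of two plane vectors. -/
def planeDet (v w : ℂ) : ℝ := v.re * w.im - v.im * w.re

/-- The cross ratio `(r₁ - r₃)(r₂ - r₄) / ((r₂ - r₃)(r₁ - r₄))` of the slopes `rᵢ` of four pairwise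
nonparallel plane vectors; the form with determinants also covers the slope `∞`. -/
def vectorCrossRatio (v₁ v₂ v₃ v₄ : ℂ) : ℝ :=
  (planeDet v₁ v₃ * planeDet v₂ v₄) / (planeDet v₂ v₃ * planeDet v₁ v₄)

/-- The formula for `vectorCrossRatio` when all slopes are finite. -/
theorem vectorCrossRatio_eq_slopes (v : Fin 4 → ℂ) (h : ∀ i, (v i).re ≠ 0) :
    vectorCrossRatio (v 0) (v 1) (v 2) (v 3) =
      (((v 0).im / (v 0).re - (v 2).im / (v 2).re) * ((v 1).im / (v 1).re - (v 3).im / (v 3).re)) /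
      (((v 1).im / (v 1).re - (v 2).im / (v 2).re) *
        ((v 0).im / (v 0).re - (v 3).im / (v 3).re)) := by
  have key : ∀ i j, (v i).im / (v i).re - (v j).im / (v j).re =
      -planeDet (v i) (v j) / ((v i).re * (v j).re) := by
    intro i j
    have := h i
    have := h j
    unfold planeDet
    field_simp
    ring
  have h0 := h 0
  have h1 := h 1
  have h2 := h 2
  have h3 := h 3
  rw [key, key, key, key]
  unfold vectorCrossRatio
  rw [div_mul_div_comm, div_mul_div_comm,
    show (v 1).re * (v 2).re * ((v 0).re * (v 3).re) =
      (v 0).re * (v 2).re * ((v 1).re * (v 3).re) by ring,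
    div_div_div_cancel_right₀ (by positivity)]
  ring

/-- The field of cross ratios of saddle connections. -/
def Kcr (S : Type) [TopologicalSpace S] [ChartedSpace ℂ S] : Subfield ℝ :=
  Subfield.closure {x | ∃ v : Fin 4 → ℂ, (∀ i, v i ∈ saddleVectors S) ∧
    (∀ i j, i ≠ j → planeDet (v i) (v j) ≠ 0) ∧ x = vectorCrossRatio (v 0) (v 1) (v 2) (v 3)}

/-- The homeomorphism `f` of `S` is affine with differential `A`. -/
def IsAffineWith (S : Type) [TopologicalSpace S] [ChartedSpace ℂ S] (f : S ≃ₜ S)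
    (A : Matrix (Fin 2) (Fin 2) ℝ) : Prop :=
  ∀ x : S, ∃ e ∈ atlas ℂ S, ∃ e' ∈ atlas ℂ S, x ∈ e.source ∧ f x ∈ e'.source ∧
    ∀ᶠ y in 𝓝 x, Complex.basisOneI.repr (e' (f y) - e' (f x)) =
      A.mulVec (Complex.basisOneI.repr (e y - e x))

/-- The Veech group: the differentials of orientation preserving affine automorphisms. -/
def veechGroup (S : Type) [TopologicalSpace S] [ChartedSpace ℂ S] :
    Set (Matrix (Fin 2) (Fin 2) ℝ) :=
  {A | 0 < A.det ∧ ∃ f : S ≃ₜ S, IsAffineWith S f A}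

/-- The trace field. -/
def Ktr (S : Type) [TopologicalSpace S] [ChartedSpace ℂ S] : Subfield ℝ :=
  Subfield.closure (Matrix.trace '' veechGroup S)

/-! ## The Katok-Zemljakov surface of a triangle -/

namespace KZ

/-- The vertices of a triangle as an affine basis of the plane. -/
def basis (T : Affine.Triangle ℝ ℂ) : AffineBasis (Fin 3) ℝ ℂ :=
  ⟨T.points, T.independent,
    T.independent.affineSpan_eq_top_iff_card_eq_finrank_add_one.2 (by simp)⟩

/-- The `i`-th barycentric coordinate with respect to the triangle. -/
def bary (T : Affine.Triangle ℝ ℂ) (i : Fin 3) (x : ℂ) : ℝ := (basis T).coord i x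

/-- The interior of the triangle. -/
def inner (T : Affine.Triangle ℝ ℂ) : Set ℂ := {x | ∀ j, 0 < bary T j x}

/-- The open side opposite to the `i`-th vertex. -/
def side (T : Affine.Triangle ℝ ℂ) (i : Fin 3) : Set ℂ :=
  {x | bary T i x = 0 ∧ ∀ j, j ≠ i → 0 < bary T j x}

/-- The closed triangle without its vertices. -/
def punctured (T : Affine.Triangle ℝ ℂ) : Set ℂ := inner T ∪ ⋃ i, side T i

/-- The linear part of the reflection in the side opposite to the `i`-th vertex. -/
def linRefl (T : Affine.Triangle ℝ ℂ) (i : Fin 3) : ℂ ≃ₗᵢ[ℝ] ℂ :=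
  (Submodule.span ℝ {T.points (i + 2) - T.points (i + 1)}).reflection

/-- The reflection in the line containing the side opposite to the `i`-th vertex. -/
def sideRefl (T : Affine.Triangle ℝ ℂ) (i : Fin 3) (x : ℂ) : ℂ :=
  T.points (i + 1) + linRefl T i (x - T.points (i + 1))

/-- The group generated by the linear parts of the reflections in the sides. -/
def reflGroup (T : Affine.Triangle ℝ ℂ) : Subgroup (ℂ ≃ₗᵢ[ℝ] ℂ) :=
  Subgroup.closure (range (linRefl T))

/-- The linear parts of the reflections as elements of the group they generate. -/
def gen (T : Affine.Triangle ℝ ℂ) (i : Fin 3) : reflGroup T :=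
  ⟨linRefl T i, Subgroup.subset_closure ⟨i, rfl⟩⟩

/-- The gluing relation on the disjoint union of copies of the triangle without its vertices,
indexed by the group `G` generated by the linear parts of the reflections in the sides: a point of
the `i`-th side of the copy `g` is identified with the same point of the copy `g * gen i`. -/
def glue (T : Affine.Triangle ℝ ℂ) (a b : reflGroup T × punctured T) : Prop :=
  a.2 = b.2 ∧ (a.1 = b.1 ∨ ∃ i, (a.2 : ℂ) ∈ side T i ∧ b.1 = a.1 * gen T i)

section lemmas

variable (T : Affine.Triangle ℝ ℂ)

theorem gen_mul_gen (i : Fin 3) : gen T i * gen T i = 1 :=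
  Subtype.ext (Submodule.reflection_mul_reflection _)

theorem side_unique {i j : Fin 3} {x : ℂ} (h : x ∈ side T i)
    (h'' : ¬ 0 < bary T j x) : i = j := by
  by_contra hij
  exact h'' (h.2 j (Ne.symm hij))

theorem side_inj {i j : Fin 3} {x : ℂ} (h : x ∈ side T i) (h' : x ∈ side T j) : i = j :=
  side_unique T h (by rw [h'.1]; exact lt_irrefl 0)

theorem glue_equivalence : Equivalence (glue T) where
  refl a := ⟨rfl, .inl rfl⟩
  symm := by
    rintro ⟨g, x⟩ ⟨h, y⟩ ⟨hxy, H⟩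
    dsimp only at hxy H
    subst hxy
    refine ⟨rfl, ?_⟩
    rcases H with H | ⟨i, hi, H⟩
    · exact .inl H.symm
    · exact .inr ⟨i, hi, by rw [H]; simp [mul_assoc, gen_mul_gen]⟩
  trans := by
    rintro ⟨g, x⟩ ⟨h, y⟩ ⟨k, z⟩ ⟨hxy, H⟩ ⟨hyz, K⟩
    dsimp only at hxy H hyz K
    subst hxy
    subst hyz
    refine ⟨rfl, ?_⟩
    rcases H with rfl | ⟨i, hi, rfl⟩
    · exact K
    · rcases K with rfl | ⟨j, hj, rfl⟩
      · exact .inr ⟨i, hi, rfl⟩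
      · obtain rfl := side_inj T hi hj
        exact .inl (by simp [mul_assoc, gen_mul_gen])

end lemmas

/-- The gluing relation as a setoid. -/
def glueSetoid (T : Affine.Triangle ℝ ℂ) : Setoid (reflGroup T × punctured T) :=
  ⟨glue T, glue_equivalence T⟩

/-- The Katok-Zemljakov surface of the triangle `T`. -/
def Surface (T : Affine.Triangle ℝ ℂ) : Type := Quotient (glueSetoid T)

/-- The point `x` of the copy `g` of the triangle. -/
def Surface.mk (T : Affine.Triangle ℝ ℂ) (g : reflGroup T) (x : punctured T) : Surface T :=
  Quotient.mk (glueSetoid T) (g, x)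

/-- The open kite formed by the triangle, its mirror image in the `i`-th side, and that side. -/
def kite (T : Affine.Triangle ℝ ℂ) (i : Fin 3) : Set ℂ :=
  {z | z ∈ inner T ∨ z ∈ side T i ∨ sideRefl T i z ∈ inner T}

/-- Folding of the plane along the `i`-th side. -/
def fold (T : Affine.Triangle ℝ ℂ) (i : Fin 3) (z : ℂ) : ℂ :=
  open Classical in if 0 ≤ bary T i z then z else sideRefl T i z

/-- The copy of the triangle reached on the two sides of the `i`-th side of the copy `g`. -/
def sheet (T : Affine.Triangle ℝ ℂ) (g : reflGroup T) (i : Fin 3) (z : ℂ) : reflGroup T :=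
  open Classical in if 0 ≤ bary T i z then g else g * gen T i

section lemmas

variable (T : Affine.Triangle ℝ ℂ)

theorem exists_inner : ∃ x, x ∈ inner T := by
  refine ⟨Finset.univ.centroid ℝ (basis T), fun j => ?_⟩
  unfold bary
  rw [AffineBasis.coord_apply_centroid _ (Finset.mem_univ j)]
  simp

end lemmas

instance (T : Affine.Triangle ℝ ℂ) : Nonempty (punctured T) :=
  ⟨⟨(exists_inner T).choose, .inl (exists_inner T).choose_spec⟩⟩

/-- The tautological map from the `i`-th kite to the union of the copies `g` and `g * gen i` in the
surface (with an irrelevant value outside the kite). -/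
def param (T : Affine.Triangle ℝ ℂ) (g : reflGroup T) (i : Fin 3) (z : ℂ) : Surface T :=
  open Classical in
  if h : fold T i z ∈ punctured T then Surface.mk T (sheet T g i z) ⟨fold T i z, h⟩
  else Surface.mk T 1 (Classical.arbitrary _)

section lemmas

variable (T : Affine.Triangle ℝ ℂ)

theorem bary_continuous (i : Fin 3) : Continuous (bary T i) :=
  continuous_barycentric_coord (basis T) i

theorem bary_points (i j : Fin 3) : bary T i (T.points j) = if i = j then 1 else 0 :=
  (basis T).coord_apply i j

theorem bary_vadd (i : Fin 3) (p u : ℂ) : bary T i (p + u) = bary T i p + ((basis T).coord i).linear u := by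
  have := ((basis T).coord i).map_vadd p u
  simp only [vadd_eq_add] at this
  unfold bary
  rw [add_comm p u, this, add_comm]

theorem sideRefl_sideRefl (i : Fin 3) (x : ℂ) : sideRefl T i (sideRefl T i x) = x := by
  simp [sideRefl, linRefl]

theorem sideRefl_sub (i : Fin 3) (x y : ℂ) :
    sideRefl T i x - sideRefl T i y = linRefl T i (x - y) := by
  simp only [sideRefl, map_sub]
  ring

theorem bary_sideRefl (i : Fin 3) (x : ℂ) : bary T i (sideRefl T i x) = - bary T i x := by
  set p := T.points (i + 1) with hp
  set q := T.points (i + 2) with hq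
  have hbp : bary T i p = 0 := by
    rw [hp, bary_points, if_neg (by fin_cases i <;> decide)]
  have hbq : bary T i q = 0 := by
    rw [hq, bary_points, if_neg (by fin_cases i <;> decide)]
  have hL : ((basis T).coord i).linear (q - p) = 0 := by
    have := bary_vadd T i p (q - p)
    rw [add_sub_cancel, hbp, hbq] at this
    linarith
  have h1 := bary_vadd T i p (linRefl T i (x - p))
  have h2 := bary_vadd T i p (x - p)
  rw [add_sub_cancel] at h2
  have h3 : ((basis T).coord i).linear (linRefl T i (x - p)) =
      - ((basis T).coord i).linear (x - p) := by
    have hmem := (Submodule.span ℝ {q - p}).starProjection_apply_mem (x - p)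
    obtain ⟨c, hc⟩ := Submodule.mem_span_singleton.1 hmem
    have : linRefl T i (x - p) = 2 • (c • (q - p)) - (x - p) := by
      rw [hc]
      exact Submodule.reflection_apply _
    rw [this, map_sub, map_nsmul, map_smul, hL]
    simp
  change bary T i (p + linRefl T i (x - p)) = _
  rw [h1, h2, h3, hbp]
  ring

theorem sideRefl_eq_self (i : Fin 3) {x : ℂ} (h : bary T i x = 0) : sideRefl T i x = x := by
  -- a point with vanishing coordinate is an affine combination of the end points of the side
  set p := T.points (i + 1) with hp
  set q := T.points (i + 2) with hq
  have hx : x - p ∈ Submodule.span ℝ {q - p} := by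
    have hs := (basis T).linear_combination_coord_eq_self x
    have h1 := (basis T).sum_coord_apply_eq_one x
    rw [Submodule.mem_span_singleton]
    refine ⟨bary T (i + 2) x, ?_⟩
    have hpp : ∀ j, (basis T) j = T.points j := fun _ => rfl
    have e1 : bary T i x + bary T (i + 1) x + bary T (i + 2) x = 1 := by
      rw [← h1, Fin.sum_univ_three]
      unfold bary
      fin_cases i <;> simp <;> ring
    have e2 : bary T i x • T.points i + bary T (i + 1) x • p + bary T (i + 2) x • q = x := by
      nth_rewrite 4 [← hs]
      rw [Fin.sum_univ_three, hp, hq]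
      simp only [hpp]
      unfold bary
      fin_cases i <;> simp <;> ring
    rw [h] at e1 e2
    have e3 : bary T (i + 1) x = 1 - bary T (i + 2) x := by linarith
    rw [e3] at e2
    have : x = (1 - bary T (i + 2) x) • p + bary T (i + 2) x • q := by
      rw [zero_smul, zero_add] at e2
      exact e2.symm
    generalize bary T (i + 2) x = c at this
    rw [this]
    module
  have : linRefl T i (x - p) = x - p := Submodule.reflection_mem_subspace_eq_self hx
  change p + linRefl T i (x - p) = x
  rw [this]
  ring

theorem sideRefl_continuous (i : Fin 3) : Continuous (sideRefl T i) := by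
  unfold sideRefl
  fun_prop

theorem inner_isOpen : IsOpen (inner T) := by
  have : inner T = ⋂ j, {x | 0 < bary T j x} := by ext; simp [inner]
  rw [this]
  exact isOpen_iInter_of_finite fun j => isOpen_lt continuous_const (bary_continuous T j)

theorem kite_iff (i : Fin 3) (z : ℂ) :
    z ∈ kite T i ↔ (fold T i z ∈ inner T ∧ bary T i z ≠ 0) ∨ z ∈ side T i := by
  unfold fold
  constructor
  · rintro (h | h | h)
    · left
      rw [if_pos (h i).le]
      exact ⟨h, (h i).ne'⟩
    · exact .inr h
    · left
      have := h i
      rw [bary_sideRefl] at this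
      rw [if_neg (by linarith)]
      exact ⟨h, by linarith⟩
  · rintro (⟨h, h0⟩ | h)
    · split_ifs at h with h1
      · exact .inl h
      · exact .inr (.inr h)
    · exact .inr (.inl h)

theorem fold_of_side {i : Fin 3} {z : ℂ} (h : z ∈ side T i) : fold T i z = z :=
  if_pos h.1.ge

theorem fold_mem {i : Fin 3} {z : ℂ} (h : z ∈ kite T i) : fold T i z ∈ punctured T := by
  rcases (kite_iff T i z).1 h with h | h
  · exact .inl h.1
  · rw [fold_of_side T h]
    exact .inr (mem_iUnion.2 ⟨i, h⟩)

theorem param_eq {i : Fin 3} {z : ℂ} (g : reflGroup T) (h : z ∈ kite T i) :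
    param T g i z = Surface.mk T (sheet T g i z) ⟨fold T i z, fold_mem T h⟩ :=
  dif_pos (fold_mem T h)

theorem mk_eq_mk {g h : reflGroup T} {x y : punctured T} :
    Surface.mk T g x = Surface.mk T h y ↔ glue T (g, x) (h, y) :=
  Quotient.eq (r := glueSetoid T)

theorem inner_not_side {x : ℂ} (h : x ∈ inner T) (i : Fin 3) : x ∉ side T i :=
  fun h' => (h i).ne' h'.1

theorem kite_isOpen (i : Fin 3) : IsOpen (kite T i) := by
  have h1 : IsOpen (inner T ∪ sideRefl T i ⁻¹' inner T) :=
    (inner_isOpen T).union ((inner_isOpen T).preimage (sideRefl_continuous T i))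
  rw [isOpen_iff_mem_nhds]
  intro z hz
  by_cases hs : z ∈ side T i
  · -- near the side, both the point and its mirror image have positive other coordinates
    have ev : ∀ᶠ y in 𝓝 z, ∀ j, j ≠ i → 0 < bary T j y ∧ 0 < bary T j (sideRefl T i y) := by
      rw [eventually_all]
      intro j
      by_cases hj : j = i
      · simp [hj]
      · have a := (bary_continuous T j).tendsto z |>.eventually_const_lt (hs.2 j hj)
        have hz' : 0 < bary T j (sideRefl T i z) := by
          rw [sideRefl_eq_self T i hs.1]; exact hs.2 j hj
        have b := ((bary_continuous T j).comp (sideRefl_continuous T i)).tendsto z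
          |>.eventually_const_lt hz'
        filter_upwards [a, b] with y ha hb _ using ⟨ha, hb⟩
    filter_upwards [ev] with y hy
    rcases lt_trichotomy (bary T i y) 0 with h | h | h
    · refine .inr (.inr fun j => ?_)
      by_cases hj : j = i
      · subst hj; rw [bary_sideRefl]; linarith
      · exact (hy j hj).2
    · exact .inr (.inl ⟨h, fun j hj => (hy j hj).1⟩)
    · refine .inl fun j => ?_
      by_cases hj : j = i
      · subst hj; exact h
      · exact (hy j hj).1
  · have hz' : z ∈ inner T ∪ sideRefl T i ⁻¹' inner T := by
      rcases hz with h | h | h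
      · exact .inl h
      · exact absurd h hs
      · exact .inr h
    filter_upwards [h1.mem_nhds hz'] with y hy
    rcases hy with h | h
    · exact .inl h
    · exact .inr (.inr h)

/-- Locally away from the side, folding is an isometry with linear part recorded by `sheet`. -/
theorem fold_local (g : reflGroup T) (i : Fin 3) {z : ℂ} (h : bary T i z ≠ 0) :
    ∀ᶠ y in 𝓝 z, sheet T g i y = sheet T g i z ∧
      (sheet T g i z : ℂ ≃ₗᵢ[ℝ] ℂ) (fold T i y - fold T i z) = (g : ℂ ≃ₗᵢ[ℝ] ℂ) (y - z) := by
  rcases lt_or_gt_of_ne h with h | h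
  · filter_upwards [(bary_continuous T i).tendsto z |>.eventually_lt_const h] with y hy
    simp only [sheet, fold, if_neg (not_le.2 h), if_neg (not_le.2 hy), sideRefl_sub, true_and]
    simp [gen, linRefl]
  · filter_upwards [(bary_continuous T i).tendsto z |>.eventually_const_lt h] with y hy
    simp [sheet, fold, h.le, hy.le]

theorem fold_inj (g : reflGroup T) (i : Fin 3) {y z : ℂ} (h : sheet T g i y = sheet T g i z)
    (h' : fold T i y = fold T i z) : y = z := by
  have hne : g ≠ g * gen T i := by
    intro hg
    have h1 : gen T i = 1 := by simpa using hg
    have h2 : ∀ u, linRefl T i u = u := fun u => by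
      have := congrArg (fun k : reflGroup T => (k : ℂ ≃ₗᵢ[ℝ] ℂ) u) h1
      exact this
    have h3 := bary_sideRefl T i (T.points i)
    rw [sideRefl, h2, add_sub_cancel, bary_points, if_pos rfl] at h3
    linarith
  unfold sheet at h
  unfold fold at h'
  split_ifs at h h' with h1 h2 h2
  · exact h'
  · exact absurd h hne
  · exact absurd h.symm hne
  · rw [← sideRefl_sideRefl T i y, h', sideRefl_sideRefl]

/-- The local form of the changes of charts. -/
theorem param_transition {g h : reflGroup T} {i j : Fin 3} {z z' : ℂ} (hz : z ∈ kite T i)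
    (hz' : z' ∈ kite T j) (H : param T g i z = param T h j z') :
    ∀ᶠ y in 𝓝 z, (h : ℂ ≃ₗᵢ[ℝ] ℂ).symm ((g : ℂ ≃ₗᵢ[ℝ] ℂ) (y - z)) + z' ∈ kite T j ∧
      param T h j ((h : ℂ ≃ₗᵢ[ℝ] ℂ).symm ((g : ℂ ≃ₗᵢ[ℝ] ℂ) (y - z)) + z') = param T g i y := by
  have hfold := H
  rw [param_eq T g hz, param_eq T h hz', mk_eq_mk] at hfold
  obtain ⟨hf, hs⟩ := hfold
  replace hf : fold T i z = fold T j z' := congrArg Subtype.val hf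
  dsimp only at hs
  set m : ℂ → ℂ := fun y => (h : ℂ ≃ₗᵢ[ℝ] ℂ).symm ((g : ℂ ≃ₗᵢ[ℝ] ℂ) (y - z)) + z' with hm
  have hmc : Continuous m := by rw [hm]; fun_prop
  have hmz : m z = z' := by simp [hm]
  have hkite : ∀ᶠ y in 𝓝 z, m y ∈ kite T j :=
    hmc.continuousAt.eventually ((kite_isOpen T j).mem_nhds (by rw [hmz]; exact hz'))
  have hkite' : ∀ᶠ y in 𝓝 z, y ∈ kite T i := (kite_isOpen T i).mem_nhds hz
  suffices hsuff : ∀ᶠ y in 𝓝 z, m y ∈ kite T j → y ∈ kite T i →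
      param T h j (m y) = param T g i y by
    filter_upwards [hsuff, hkite, hkite'] with y a b c using ⟨b, a b c⟩
  rcases (kite_iff T i z).1 hz with ⟨hin, h0⟩ | hside
  · -- interior case
    have h0' : bary T j z' ≠ 0 := by
      intro h0'
      rcases (kite_iff T j z').1 hz' with ⟨_, h⟩ | h
      · exact h h0'
      · rw [hf, fold_of_side T h] at hin
        exact inner_not_side T hin j h
    have hsh : sheet T g i z = sheet T h j z' := by
      rcases hs with hs | ⟨k, hk, _⟩
      · exact hs
      · exact absurd hk (inner_not_side T hin k)
    have ev2 := (hmz ▸ hmc.continuousAt.tendsto :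
      Tendsto m (𝓝 z) (𝓝 z')).eventually (fold_local T h j h0')
    filter_upwards [fold_local T g i h0, ev2] with y hy hy' k1 k2
    rw [param_eq T h k1, param_eq T g k2, mk_eq_mk]
    refine ⟨Subtype.ext ?_, .inl ?_⟩
    · have e1 := hy.2
      have e2 := hy'.2
      have e3 : (h : ℂ ≃ₗᵢ[ℝ] ℂ) (m y - z') = (g : ℂ ≃ₗᵢ[ℝ] ℂ) (y - z) := by simp [hm]
      rw [e3, ← e1, ← hsh, ← hf] at e2
      have e4 := (sheet T g i z : ℂ ≃ₗᵢ[ℝ] ℂ).injective e2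
      exact sub_left_injective e4
    · exact hy'.1.trans (hsh.symm.trans hy.1.symm)
  · -- side case
    rw [fold_of_side T hside] at hf
    have hzz : z' ∈ side T j := by
      rcases (kite_iff T j z').1 hz' with ⟨h, _⟩ | h
      · rw [← hf] at h
        exact absurd hside (inner_not_side T h i)
      · exact h
    rw [fold_of_side T hzz] at hf
    subst hf
    obtain rfl := side_inj T hside hzz
    have hsheet : ∀ k : reflGroup T, sheet T k i z = k := fun k => if_pos hside.1.ge
    rw [hsheet, hsheet] at hs
    rcases hs with rfl | ⟨k, hk, rfl⟩
    · have : ∀ y, m y = y := fun y => by simp [hm]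
      exact .of_forall fun y _ _ => by rw [this]
    · rw [fold_of_side T hside] at hk
      obtain rfl := side_inj T hside hk
      have hmy : ∀ y, m y = sideRefl T i y := by
        intro y
        have e := sideRefl_sub T i y z
        rw [sideRefl_eq_self T i hside.1] at e
        have : ((g * gen T i : reflGroup T) : ℂ ≃ₗᵢ[ℝ] ℂ).symm ((g : ℂ ≃ₗᵢ[ℝ] ℂ) (y - z)) =
            linRefl T i (y - z) := by
          rw [LinearIsometryEquiv.symm_apply_eq]
          simp [gen, linRefl]
        simp only [hm]
        rw [this, ← e]
        ring
      refine .of_forall fun y k1 k2 => ?_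
      rw [hmy] at k1 ⊢
      rw [param_eq T _ k1, param_eq T _ k2, mk_eq_mk]
      have hb := bary_sideRefl T i y
      rcases lt_trichotomy (bary T i y) 0 with hy | hy | hy
      · have hy' : 0 ≤ bary T i (sideRefl T i y) := by linarith
        refine ⟨Subtype.ext ?_, .inl ?_⟩
        · simp [fold, hy', not_le.2 hy]
        · simp [sheet, hy', not_le.2 hy]
      · have hys : y ∈ side T i := by
          rcases (kite_iff T i y).1 k2 with ⟨_, h⟩ | h
          · exact absurd hy h
          · exact h
        have hre := sideRefl_eq_self T i hy
        refine ⟨Subtype.ext ?_, .inr ⟨i, ?_, ?_⟩⟩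
        · simp [hre]
        · simpa [hre, fold_of_side T hys] using hys
        · simp [hre, sheet, hy, mul_assoc, gen_mul_gen]
      · have hy' : ¬ 0 ≤ bary T i (sideRefl T i y) := by rw [hb]; linarith
        refine ⟨Subtype.ext ?_, .inl ?_⟩
        · simp [fold, hy', hy.le, sideRefl_sideRefl]
        · simp [sheet, hy', hy.le, mul_assoc, gen_mul_gen]

theorem param_inj {g : reflGroup T} {i : Fin 3} {y z : ℂ} (hy : y ∈ kite T i) (hz : z ∈ kite T i)
    (H : param T g i y = param T g i z) : y = z := by
  have hfold := H
  rw [param_eq T g hy, param_eq T g hz, mk_eq_mk] at hfold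
  obtain ⟨hf, hs⟩ := hfold
  replace hf : fold T i y = fold T i z := congrArg Subtype.val hf
  dsimp only at hs
  rcases (kite_iff T i y).1 hy with ⟨hin, _⟩ | hside
  · rcases hs with hs | ⟨k, hk, _⟩
    · exact fold_inj T g i hs hf
    · exact absurd hk (inner_not_side T hin k)
  · rw [fold_of_side T hside] at hf
    rcases (kite_iff T i z).1 hz with ⟨hin, _⟩ | hside'
    · rw [← hf] at hin
      exact absurd hside (inner_not_side T hin i)
    · rwa [fold_of_side T hside'] at hf

theorem param_surj (s : Surface T) : ∃ (g : reflGroup T) (i : Fin 3), ∃ z ∈ kite T i,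
    param T g i z = s := by
  induction s using Quotient.inductionOn with
  | h a =>
    obtain ⟨g, x, hx⟩ := a
    have key : ∀ i, 0 ≤ bary T i x → ∀ hk : x ∈ kite T i,
        param T g i x = Surface.mk T g ⟨x, hx⟩ := by
      intro i h0 hk
      rw [param_eq T g hk, mk_eq_mk]
      refine ⟨Subtype.ext ?_, .inl ?_⟩
      · simp [fold, h0]
      · simp [sheet, h0]
    rcases hx with h | h
    · exact ⟨g, 0, x, .inl h, key 0 (h 0).le (.inl h)⟩
    · obtain ⟨i, hi⟩ := mem_iUnion.1 h
      exact ⟨g, i, x, .inr (.inl hi), key i hi.1.ge (.inr (.inl hi))⟩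

theorem param_injOn (g : reflGroup T) (i : Fin 3) :
    InjOn (fun w => param T g i ((g : ℂ ≃ₗᵢ[ℝ] ℂ).symm w))
      {w | (g : ℂ ≃ₗᵢ[ℝ] ℂ).symm w ∈ kite T i} :=
  fun _ hw _ hw' H => (g : ℂ ≃ₗᵢ[ℝ] ℂ).symm.injective (param_inj T hw hw' H)

end lemmas

/-- The chart of the surface on the union of the copies `g` and `g * gen i`, without the sides other
than the common one: on the copy `g` it is `x ↦ g x`, and on the copy `g * gen i` it is
`x ↦ g (sideRefl i x)`. -/
def chart (T : Affine.Triangle ℝ ℂ) (g : reflGroup T) (i : Fin 3) :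
    PartialEquiv (Surface T) ℂ :=
  (InjOn.toPartialEquiv _ _ (param_injOn T g i)).symm

section lemmas

variable (T : Affine.Triangle ℝ ℂ)

theorem chart_symm_apply (g : reflGroup T) (i : Fin 3) (w : ℂ) :
    (chart T g i).symm w = param T g i ((g : ℂ ≃ₗᵢ[ℝ] ℂ).symm w) := rfl

theorem chart_target (g : reflGroup T) (i : Fin 3) :
    (chart T g i).target = {w | (g : ℂ ≃ₗᵢ[ℝ] ℂ).symm w ∈ kite T i} := rfl

theorem chart_source (g : reflGroup T) (i : Fin 3) :
    (chart T g i).source = (fun w => param T g i ((g : ℂ ≃ₗᵢ[ℝ] ℂ).symm w)) ''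
      {w | (g : ℂ ≃ₗᵢ[ℝ] ℂ).symm w ∈ kite T i} := rfl

theorem chart_transition (g h : reflGroup T) (i j : Fin 3) {w : ℂ}
    (hw : w ∈ ((chart T g i).symm.trans (chart T h j)).source) :
    ∀ᶠ y in 𝓝 w, y ∈ ((chart T g i).symm.trans (chart T h j)).source ∧
      chart T h j ((chart T g i).symm y) = y + (chart T h j ((chart T g i).symm w) - w) := by
  obtain ⟨hw1, hw2⟩ := hw
  change w ∈ (chart T g i).target at hw1
  change (chart T g i).symm w ∈ (chart T h j).source at hw2
  set w' := chart T h j ((chart T g i).symm w) with hw'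
  have ht : w' ∈ (chart T h j).target := (chart T h j).map_source hw2
  have hinv : (chart T h j).symm w' = (chart T g i).symm w := (chart T h j).left_inv hw2
  have H : param T g i ((g : ℂ ≃ₗᵢ[ℝ] ℂ).symm w) = param T h j ((h : ℂ ≃ₗᵢ[ℝ] ℂ).symm w') :=
    hinv.symm
  have ev := (((g : ℂ ≃ₗᵢ[ℝ] ℂ).symm.continuous.tendsto w).eventually
    (param_transition T (g := g) (h := h) hw1 ht H))
  have ev0 : ∀ᶠ y in 𝓝 w, y ∈ (chart T g i).target :=
    ((kite_isOpen T i).preimage (g : ℂ ≃ₗᵢ[ℝ] ℂ).symm.continuous).mem_nhds hw1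
  filter_upwards [ev, ev0] with y hy hy0
  have e : (h : ℂ ≃ₗᵢ[ℝ] ℂ).symm (y + (w' - w)) =
      (h : ℂ ≃ₗᵢ[ℝ] ℂ).symm ((g : ℂ ≃ₗᵢ[ℝ] ℂ)
        ((g : ℂ ≃ₗᵢ[ℝ] ℂ).symm y - (g : ℂ ≃ₗᵢ[ℝ] ℂ).symm w)) +
        (h : ℂ ≃ₗᵢ[ℝ] ℂ).symm w' := by
    rw [← map_sub, LinearIsometryEquiv.apply_symm_apply, ← map_add]
    congr 1
    ring
  rw [← e] at hy
  have hyt : y + (w' - w) ∈ (chart T h j).target := hy.1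
  have hys : (chart T h j).symm (y + (w' - w)) = (chart T g i).symm y := hy.2
  refine ⟨⟨hy0, ?_⟩, ?_⟩
  · change (chart T g i).symm y ∈ (chart T h j).source
    rw [← hys]
    exact (chart T h j).map_target hyt
  · rw [← hys]
    exact (chart T h j).right_inv hyt

theorem exists_chart (s : Surface T) : ∃ a : reflGroup T × Fin 3, s ∈ (chart T a.1 a.2).source := by
  obtain ⟨g, i, z, hz, rfl⟩ := param_surj T s
  exact ⟨(g, i), (g : ℂ ≃ₗᵢ[ℝ] ℂ) z, by simpa using hz, by simp⟩

end lemmas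

/-- The atlas of the charts `chart T g i`. -/
def core (T : Affine.Triangle ℝ ℂ) : ChartedSpaceCore ℂ (Surface T) where
  atlas := range fun a : reflGroup T × Fin 3 => chart T a.1 a.2
  chartAt s := chart T (exists_chart T s).choose.1 (exists_chart T s).choose.2
  mem_chart_source s := (exists_chart T s).choose_spec
  chart_mem_atlas s := ⟨_, rfl⟩
  open_source := by
    rintro _ _ ⟨⟨g, i⟩, rfl⟩ ⟨⟨h, j⟩, rfl⟩
    rw [isOpen_iff_mem_nhds]
    intro w hw
    exact (chart_transition T g h i j hw).mono fun y hy => hy.1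
  continuousOn_toFun := by
    rintro _ _ ⟨⟨g, i⟩, rfl⟩ ⟨⟨h, j⟩, rfl⟩ w hw
    refine ContinuousAt.continuousWithinAt ?_
    have : (fun y => y + (chart T h j ((chart T g i).symm w) - w)) =ᶠ[𝓝 w]
        ((chart T g i).symm.trans (chart T h j)) :=
      (chart_transition T g h i j hw).mono fun y hy => hy.2.symm
    exact ContinuousAt.congr (by fun_prop) this

instance (T : Affine.Triangle ℝ ℂ) : TopologicalSpace (Surface T) := (core T).toTopologicalSpace

instance (T : Affine.Triangle ℝ ℂ) : ChartedSpace ℂ (Surface T) := (core T).toChartedSpace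

/-- The Katok-Zemljakov surface is a translation surface. -/
instance (T : Affine.Triangle ℝ ℂ) : IsTranslationSurface (Surface T) where
  transition := by
    intro e he e' he' x hx
    have key : ∀ e ∈ atlas ℂ (Surface T), ∃ a : reflGroup T × Fin 3,
        e.toPartialEquiv = chart T a.1 a.2 := by
      intro e he
      have he' : e ∈ ⋃ (c : PartialEquiv (Surface T) ℂ) (hc : c ∈ (core T).atlas),
        {(core T).openPartialHomeomorph c hc} := he
      simp only [mem_iUnion, mem_singleton_iff] at he'
      obtain ⟨c, ⟨a, rfl⟩, rfl⟩ := he'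
      exact ⟨a, rfl⟩
    obtain ⟨⟨g, i⟩, ha⟩ := key e he
    obtain ⟨⟨h, j⟩, hb⟩ := key e' he'
    have hf : ∀ y, e y = chart T g i y := fun y => congrArg (fun c => c y) ha
    have hf' : ∀ y, e' y = chart T h j y := fun y => congrArg (fun c => c y) hb
    have hs : e.source = (chart T g i).source := congrArg (fun c => c.source) ha
    have hs' : e'.source = (chart T h j).source := congrArg (fun c => c.source) hb
    have hinv : ∀ y ∈ e.source, (chart T g i).symm (e y) = y := by
      intro y hy
      rw [hf]
      exact (chart T g i).left_inv (hs ▸ hy)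
    have hw : e x ∈ ((chart T g i).symm.trans (chart T h j)).source := by
      refine ⟨?_, ?_⟩
      · rw [hf]
        exact (chart T g i).map_source (hs ▸ hx.1)
      · change (chart T g i).symm (e x) ∈ (chart T h j).source
        rw [hinv x hx.1]
        exact hs' ▸ hx.2
    have ev := (e.continuousAt hx.1).eventually (chart_transition T g h i j hw)
    filter_upwards [ev, e.open_source.mem_nhds hx.1] with y hy hye
    have h2 := hy.2
    rw [hinv y hye, hinv x hx.1, ← hf', ← hf'] at h2
    rw [h2]
    ring

end KZ

/-- The space of triangles, parametrized by two angles. -/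
def triangleSpace : Set (ℝ × ℝ) := {θ | 0 < θ.1 ∧ 0 < θ.2 ∧ θ.1 + θ.2 < Real.pi}

/-- The triangle `T` has angle `θ.1` at its first vertex and `θ.2` at its second vertex. -/
def HasAngles (T : Affine.Triangle ℝ ℂ) (θ : ℝ × ℝ) : Prop :=
  EuclideanGeometry.angle (T.points 1) (T.points 0) (T.points 2) = θ.1 ∧
    EuclideanGeometry.angle (T.points 0) (T.points 1) (T.points 2) = θ.2

end

noncomputable section

/-! ## Locally Lipschitz maps along polygonal paths -/

/-! Let α be twice the first angle and v the side vector between the first two vertices. The product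
of the reflections in the two sides through the first vertex is the rotation R by α, an element of
the group G (`IsSector.exists_rotation`). Each of the three fields contains a number built from α
that is transcendental as soon as cos α is, whereas a number field has only algebraic elements.

For the trace field, left multiplication by R permutes the copies of the triangle and is affine with
differential R, so 2 cos α is a trace (`two_mul_cos_mem_Ktr`). For the cross ratios, the sides v of
the copies Rⁿ are saddle connections with vectors e^{inα}v, and those with n = 0, 1, 2, 3 have cross
ratio sin²(2α)/(sin α sin 3α) = 4cos²α/(4cos²α − 1) (`crossRatio_mem_Kcr`,
`transcendental_crossRatio`). For the segment field, the same vectors are relative holonomies; over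
an admissible field k their span has dimension at most two, so v, e^{iα}v, e^{2iα}v are dependent
over k, and e^{2iα} = 2 cos α e^{iα} − 1 forces 2 cos α into k (`two_mul_cos_mem_Ksc`).

The geometric burden is that the ends of the sides are cone singularities. When an angle is
incommensurable with π, the copies met while turning about its vertex never repeat and form a cone
of infinite angle (`IsCone.isConeParam`). As the metric is an infimum over polygonal paths, this
needs control of lengths. Two facts provide it: forgetting the copy folds the surface onto the
triangle without increasing lengths (`norm_foldMap_sub_le`), and a path too short to reach the sides
outside a set J stays in copies linked by crossing sides in J (`PolygonalPath.mem_patch`). Hence the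
surface is open in its completion, and all new points lie over vertices. The copies around a vertex
close up at a single new point (`IsCone.edist_coneMap_le`), which has the cone as a punctured
neighbourhood (`IsCone.mem_nhds_vertex`).

The conditions used fail for countably many values of each angle (`countable_exceptionalAngles`), so
the bad pairs lie in a null union of lines. -/

theorem norm_sub_le_of_locally_lipschitz {E : Type} [NormedAddCommGroup E] {f : ℝ → E} {C : ℝ}
    (h : ∀ s ∈ Icc (0 : ℝ) 1, ∀ᶠ t in 𝓝[Icc 0 1] s, ‖f t - f s‖ ≤ C * |t - s|) :
    ‖f 1 - f 0‖ ≤ C := by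
  have hc : ContinuousOn f (Icc 0 1) := by
    intro s hs
    have h1 : Tendsto (fun t => f t - f s) (𝓝[Icc 0 1] s) (𝓝 0) := by
      refine squeeze_zero_norm' (h s hs) ?_
      have : Continuous fun t : ℝ => C * |t - s| := by fun_prop
      have := (this.tendsto s).mono_left (nhdsWithin_le_nhds (s := Icc 0 1))
      simpa using this
    have h2 := h1.add_const (f s)
    simpa [ContinuousWithinAt] using h2
  have key := image_le_of_liminf_slope_right_le_deriv_boundary (f := fun t => ‖f t - f 0‖)
    (a := 0) (b := 1) (B := fun t => C * t) (B' := fun _ => C)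
    ((hc.sub continuousOn_const).norm) (by simp) (by fun_prop)
    (fun x _ => by simpa using ((hasDerivAt_id x).const_mul C).hasDerivWithinAt) ?_
    (x := 1) (by simp)
  · simpa using key
  · intro x hx r hr
    have h1 : ∀ᶠ z in 𝓝[>] x, ‖f z - f x‖ ≤ C * |z - x| := by
      have h2 := h x ⟨hx.1, hx.2.le⟩
      have h3 : 𝓝[>] x ≤ 𝓝[Icc 0 1] x := by
        rw [← nhdsWithin_Ioo_eq_nhdsGT hx.2]
        exact nhdsWithin_mono _ fun z hz => ⟨hx.1.trans hz.1.le, hz.2.le⟩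
      exact h3 h2
    refine Eventually.frequently ?_
    filter_upwards [h1, self_mem_nhdsWithin] with z hz hxz
    have hpos : 0 < z - x := sub_pos.2 hxz
    rw [slope_def_field]
    refine lt_of_le_of_lt ?_ hr
    rw [div_le_iff₀ hpos]
    rw [abs_of_pos hpos] at hz
    have h4 := norm_sub_norm_le (f z - f 0) (f x - f 0)
    rw [sub_sub_sub_cancel_right] at h4
    linarith

/-! ### Lengths and the completion of a translation surface. -/

section translation

variable {S : Type} [TopologicalSpace S] [ChartedSpace ℂ S]

/-- Near `x`, the map `f` expands distances from `x` at most as a chart does. -/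
def LocallyContractingAt {E : Type} [NormedAddCommGroup E] (f : S → E) (x : S) : Prop :=
  ∃ e ∈ atlas ℂ S, x ∈ e.source ∧ ∀ᶠ y in 𝓝 x, ‖f y - f x‖ ≤ ‖e y - e x‖

theorem IsGeodesicOn.subpath {γ : ℝ → S} {v : ℂ} (h : IsGeodesicOn S γ v (Icc 0 1)) {t : ℝ}
    (ht : t ∈ Icc (0 : ℝ) 1) : IsGeodesicOn S (fun s => γ (t * s)) (t * v) (Icc 0 1) := by
  have hm : MapsTo (fun s : ℝ => t * s) (Icc 0 1) (Icc 0 1) := by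
    intro s hs
    exact ⟨mul_nonneg ht.1 hs.1, mul_le_one₀ ht.2 hs.1 hs.2⟩
  have hc : Continuous fun s : ℝ => t * s := by fun_prop
  refine ⟨h.1.comp hc.continuousOn hm, fun s hs => ?_⟩
  obtain ⟨e, he, hse, hev⟩ := h.2 _ (hm hs)
  refine ⟨e, he, hse, ?_⟩
  have ht : Tendsto (fun s : ℝ => t * s) (𝓝[Icc 0 1] s) (𝓝[Icc 0 1] (t * s)) :=
    (hc.continuousWithinAt).tendsto_nhdsWithin hm
  filter_upwards [ht.eventually hev] with t h2
  rw [h2]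
  push_cast
  ring

theorem IsGeodesicOn.polygonalPath {γ : ℝ → S} {v : ℂ} (h : IsGeodesicOn S γ v (Icc 0 1)) {t : ℝ}
    (ht : t ∈ Icc (0 : ℝ) 1) : PolygonalPath S (γ 0) (γ t) (t * ‖v‖) := by
  have := PolygonalPath.cons (p := γ 0) (q := γ t) _ _ (h.subpath ht) (by simp) (by simp) (.nil _)
  rwa [add_zero, norm_mul, Complex.norm_real, Real.norm_eq_abs, abs_of_nonneg ht.1] at this

theorem PolygonalPath.nonneg {p q : S} {L : ℝ} (h : PolygonalPath S p q L) : 0 ≤ L := by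
  induction h with
  | nil => exact le_rfl
  | cons γ v _ _ _ _ ih => positivity

/-- The chart in which the geodesic is straight and the chart in which `f` contracts may differ; as
they differ locally by a translation, the displacement (t − s)v is the same in both. -/
theorem IsGeodesicOn.norm_sub_le [IsTranslationSurface S] {E : Type} [NormedAddCommGroup E]
    {f : S → E} {γ : ℝ → S} {v : ℂ} (h : IsGeodesicOn S γ v (Icc 0 1))
    (hf : ∀ t ∈ Icc (0 : ℝ) 1, LocallyContractingAt f (γ t)) : ‖f (γ 1) - f (γ 0)‖ ≤ ‖v‖ := by
  refine norm_sub_le_of_locally_lipschitz (f := fun t => f (γ t)) fun s hs => ?_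
  obtain ⟨e, he, hse, hev⟩ := h.2 s hs
  obtain ⟨e', he', hse', hev'⟩ := hf s hs
  have htr := IsTranslationSurface.transition e he e' he' (γ s) ⟨hse, hse'⟩
  have hγ : Tendsto γ (𝓝[Icc 0 1] s) (𝓝 (γ s)) := h.1 s hs
  filter_upwards [hev, hγ.eventually hev', hγ.eventually htr] with t h1 h2 h3
  refine h2.trans (le_of_eq ?_)
  have : e' (γ t) - e' (γ s) = ((t - s : ℝ) : ℂ) * v := by
    linear_combination h1 + h3
  rw [this, norm_mul, Complex.norm_real, Real.norm_eq_abs, mul_comm]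

/-- A map which is locally contracting along a polygonal path is contracting. -/
theorem PolygonalPath.norm_sub_le [IsTranslationSurface S] {E : Type} [NormedAddCommGroup E]
    {f : S → E} {p q : S} {L : ℝ} (h : PolygonalPath S p q L)
    (hf : ∀ y M, M ≤ L → PolygonalPath S p y M → LocallyContractingAt f y) :
    ‖f q - f p‖ ≤ L := by
  induction h with
  | nil p => simp
  | @cons p q s L γ v hγ h0 h1 h ih =>
    have hL := h.nonneg
    have A := hγ.norm_sub_le (f := f) fun t ht => by
      have := hγ.polygonalPath ht
      rw [h0] at this
      refine hf _ _ ?_ this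
      have := mul_le_of_le_one_left (norm_nonneg v) ht.2
      linarith
    -- Prefixing the first segment turns a path from `q` of length `M` into one from `p` of length
    -- `‖v‖ + M`, so the hypothesis is only needed within reach `L` of `p`.
    have B := ih fun y M hM hy => hf y (‖v‖ + M) (by linarith) (.cons γ v hγ h0 h1 hy)
    rw [h0, h1] at A
    calc ‖f s - f p‖ = ‖(f q - f p) + (f s - f q)‖ := by congr 1; abel
      _ ≤ _ := (norm_add_le _ _).trans (add_le_add A B)

/-- A segment in the target of a chart lifts to a geodesic. -/
theorem isGeodesicOn_symm {e : OpenPartialHomeomorph S ℂ} (he : e ∈ atlas ℂ S) {w u : ℂ}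
    {I : Set ℝ} (h : ∀ t ∈ I, w + (t : ℂ) * u ∈ e.target) :
    IsGeodesicOn S (fun t => e.symm (w + (t : ℂ) * u)) u I := by
  have hc : Continuous fun t : ℝ => w + (t : ℂ) * u := by fun_prop
  refine ⟨e.continuousOn_symm.comp hc.continuousOn h, fun s hs => ⟨e, he, e.map_target (h s hs), ?_⟩⟩
  filter_upwards [self_mem_nhdsWithin] with t ht
  rw [e.right_inv (h t ht), e.right_inv (h s hs)]
  push_cast
  ring

theorem edist_le_of_polygonalPath {p q : S} {L : ℝ} (h : PolygonalPath S p q L) :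
    edist (α := FlatMetric S) p q ≤ ENNReal.ofReal L :=
  iInf₂_le (f := fun (L : ℝ) (_ : PolygonalPath S p q L) => ENNReal.ofReal L) L h

theorem exists_polygonalPath_of_edist_lt {p q : S} {r : ℝ}
    (h : edist (α := FlatMetric S) p q < ENNReal.ofReal r) : ∃ L < r, PolygonalPath S p q L := by
  obtain ⟨L, hL⟩ := iInf_lt_iff.1 h
  obtain ⟨hp, hL⟩ := iInf_lt_iff.1 hL
  exact ⟨L, (ENNReal.ofReal_lt_ofReal_iff_of_nonneg hp.nonneg).1 hL, hp⟩

theorem edist_le_of_isGeodesicOn {γ : ℝ → S} {v : ℂ} (h : IsGeodesicOn S γ v (Icc 0 1)) :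
    edist (α := FlatMetric S) (γ 0) (γ 1) ≤ ENNReal.ofReal ‖v‖ := by
  simpa using edist_le_of_polygonalPath (h.polygonalPath (t := 1) (by simp))

theorem edist_symm_le {e : OpenPartialHomeomorph S ℂ} (he : e ∈ atlas ℂ S) {w : ℂ}
    (hw : w ∈ e.target) : ∀ᶠ w' in 𝓝 w,
      edist (α := FlatMetric S) (e.symm w) (e.symm w') ≤ ENNReal.ofReal ‖w' - w‖ := by
  obtain ⟨ε, hε, hb⟩ := Metric.isOpen_iff.1 e.open_target w hw
  filter_upwards [Metric.ball_mem_nhds w hε] with w' hw'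
  have := edist_le_of_isGeodesicOn (isGeodesicOn_symm he (w := w) (u := w' - w) (I := Icc 0 1)
    fun t ht => hb ?_)
  · simpa using this
  · rw [mem_ball_iff_norm] at hw' ⊢
    rw [add_sub_cancel_left, norm_mul, Complex.norm_real, Real.norm_eq_abs, abs_of_nonneg ht.1]
    exact (mul_le_of_le_one_left (norm_nonneg _) ht.2).trans_lt hw'

theorem tendsto_toCompletion {ι : Type*} {l : Filter ι} {f : ι → S} {x : S}
    (h : Tendsto (fun i => edist (α := FlatMetric S) x (f i)) l (𝓝 0)) :
    Tendsto (fun i => toCompletion (f i)) l (𝓝 (toCompletion x)) := by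
  refine ((UniformSpace.Completion.continuous_coe (FlatMetric S)).tendsto x).comp ?_
  refine (EMetric.tendsto_nhds (α := FlatMetric S)).2 fun ε hε => ?_
  filter_upwards [h.eventually (gt_mem_nhds hε)] with i hi
  exact (edist_comm (α := FlatMetric S) _ _).trans_lt hi

/-- `S` carries its manifold topology, while the completion comes from the length metric. Short
segments in a chart lift to geodesics, so length distance is locally bounded by chart distance. -/
theorem continuous_toCompletion : Continuous (toCompletion (S := S)) := by
  rw [continuous_iff_continuousAt]
  intro x
  refine tendsto_toCompletion ?_
  set e := chartAt ℂ x
  have hx : x ∈ e.source := mem_chart_source ℂ x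
  have h1 := (e.continuousAt hx).eventually
    (edist_symm_le (chart_mem_atlas ℂ x) (e.map_source hx))
  have h2 : Tendsto (fun y => ENNReal.ofReal ‖e y - e x‖) (𝓝 x) (𝓝 0) := by
    have : ContinuousAt (fun y => ‖e y - e x‖) x := ((e.continuousAt hx).sub_const _).norm
    have := ENNReal.tendsto_ofReal this.tendsto
    simpa using this
  refine tendsto_of_tendsto_of_tendsto_of_le_of_le' tendsto_const_nhds h2
    (.of_forall fun _ => zero_le) ?_
  filter_upwards [h1, e.open_source.mem_nhds hx] with y hy hys
  rwa [e.left_inv hx, e.left_inv hys] at hy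

/-- A map which contracts the lengths of polygonal paths is uniformly continuous. -/
theorem uniformContinuous_of_polygonalPath {E : Type} [NormedAddCommGroup E] {f : S → E}
    (h : ∀ p q L, PolygonalPath S p q L → ‖f q - f p‖ ≤ L) :
    UniformContinuous (α := FlatMetric S) f := by
  refine ((uniformity_basis_edist (α := FlatMetric S)).uniformContinuous_iff
    Metric.uniformity_basis_dist).2 fun ε hε => ?_
  refine ⟨ENNReal.ofReal ε, by simpa using hε, fun p q hpq => ?_⟩
  obtain ⟨L, hL, hp⟩ := exists_polygonalPath_of_edist_lt (S := S) hpq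
  rw [mem_ofPred_eq, dist_comm, dist_eq_norm]
  exact (h p q L hp).trans_lt hL

theorem extension_toCompletion {E : Type} [NormedAddCommGroup E] [CompleteSpace E] {f : S → E}
    (h : UniformContinuous (α := FlatMetric S) f) (x : S) :
    UniformSpace.Completion.extension (α := FlatMetric S) f (toCompletion x) = f x :=
  UniformSpace.Completion.extension_coe h _

theorem denseRange_toCompletion : DenseRange (toCompletion (S := S)) :=
  UniformSpace.Completion.denseRange_coe (α := FlatMetric S)

end translation

namespace KZ

variable (T : Affine.Triangle ℝ ℂ)

/-! ## Charts of the Katok-Zemljakov surface -/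

/-- The chart `chart T g i` as a partial homeomorphism. -/
def echart (g : reflGroup T) (i : Fin 3) : OpenPartialHomeomorph (Surface T) ℂ :=
  (core T).openPartialHomeomorph (chart T g i) ⟨(g, i), rfl⟩

theorem echart_mem_atlas (g : reflGroup T) (i : Fin 3) : echart T g i ∈ atlas ℂ (Surface T) := by
  change _ ∈ ⋃ (c : PartialEquiv (Surface T) ℂ) (hc : c ∈ (core T).atlas),
        {(core T).openPartialHomeomorph c hc}
  simp only [mem_iUnion, mem_singleton_iff]
  exact ⟨chart T g i, ⟨(g, i), rfl⟩, rfl⟩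

theorem echart_symm_apply (g : reflGroup T) (i : Fin 3) (w : ℂ) :
    (echart T g i).symm w = param T g i ((g : ℂ ≃ₗᵢ[ℝ] ℂ).symm w) := rfl

theorem mem_echart_target {g : reflGroup T} {i : Fin 3} {w : ℂ} :
    w ∈ (echart T g i).target ↔ (g : ℂ ≃ₗᵢ[ℝ] ℂ).symm w ∈ kite T i := Iff.rfl

variable {T} {g h : reflGroup T} {i j : Fin 3} {x z : ℂ}

theorem apply_mem_echart_target (hz : z ∈ kite T i) :
    (g : ℂ ≃ₗᵢ[ℝ] ℂ) z ∈ (echart T g i).target := by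
  rwa [mem_echart_target, LinearIsometryEquiv.symm_apply_apply]

theorem echart_symm_apply' (g : reflGroup T) (i : Fin 3) (z : ℂ) :
    (echart T g i).symm ((g : ℂ ≃ₗᵢ[ℝ] ℂ) z) = param T g i z := by
  rw [echart_symm_apply, LinearIsometryEquiv.symm_apply_apply]

theorem param_mem_source (hz : z ∈ kite T i) : param T g i z ∈ (echart T g i).source := by
  rw [← echart_symm_apply']
  exact (echart T g i).map_target (apply_mem_echart_target hz)

theorem echart_param (hz : z ∈ kite T i) :
    echart T g i (param T g i z) = (g : ℂ ≃ₗᵢ[ℝ] ℂ) z := by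
  rw [← echart_symm_apply']
  exact (echart T g i).right_inv (apply_mem_echart_target hz)

theorem exists_param_of_mem_source {s : Surface T} (hs : s ∈ (echart T g i).source) :
    ∃ z ∈ kite T i, param T g i z = s :=
  ⟨_, (echart T g i).map_source hs, (echart T g i).left_inv hs⟩

/-- Up to the isometry `g`, `param` inverts a chart; local statements on the surface can thus be
checked in kite coordinates. -/
theorem eventually_param {P : Surface T → Prop} (hz : z ∈ kite T i)
    (h : ∀ᶠ w in 𝓝 z, P (param T g i w)) : ∀ᶠ s in 𝓝 (param T g i z), P s := by
  rw [← (echart T g i).eventually_nhds' P (param_mem_source hz), echart_param hz]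
  have := ((g : ℂ ≃ₗᵢ[ℝ] ℂ).symm.continuous.tendsto ((g : ℂ ≃ₗᵢ[ℝ] ℂ) z))
  rw [LinearIsometryEquiv.symm_apply_apply] at this
  exact this.eventually h

theorem bary_nonneg_of_mem_punctured (hx : x ∈ punctured T) (j : Fin 3) : 0 ≤ bary T j x := by
  rcases hx with hx | hx
  · exact (hx j).le
  · obtain ⟨i, hi⟩ := mem_iUnion.1 hx
    by_cases hj : j = i
    · rw [hj, hi.1]
    · exact (hi.2 j hj).le

theorem mem_kite_of_mem (hx : x ∈ inner T ∪ side T i) : x ∈ kite T i :=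
  hx.elim .inl fun h => .inr (.inl h)

theorem mem_punctured_of_mem (hx : x ∈ inner T ∪ side T i) : x ∈ punctured T :=
  hx.elim .inl fun h => .inr (mem_iUnion.2 ⟨i, h⟩)

theorem exists_mem_inner_union_side (hx : x ∈ punctured T) : ∃ i, x ∈ inner T ∪ side T i := by
  rcases hx with hx | hx
  · exact ⟨0, .inl hx⟩
  · obtain ⟨i, hi⟩ := mem_iUnion.1 hx
    exact ⟨i, .inr hi⟩

/-- The mirrored half of the kite has negative `i`-th coordinate, hence misses the triangle. -/
theorem mem_of_mem_punctured_kite (hx : x ∈ punctured T) (hk : x ∈ kite T i) :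
    x ∈ inner T ∪ side T i := by
  rcases hk with h | h | h
  · exact .inl h
  · exact .inr h
  · have h1 := h i
    have h2 := bary_nonneg_of_mem_punctured hx i
    rw [bary_sideRefl] at h1
    linarith

theorem fold_mem_inner_union_side (hz : z ∈ kite T i) : fold T i z ∈ inner T ∪ side T i := by
  rcases (kite_iff T i z).1 hz with h | h
  · exact .inl h.1
  · rw [fold_of_side T h]
    exact .inr h

variable (T) in
/-- The point `x` of the copy `g` of the triangle (with an irrelevant value if `x` is not a point of
the triangle without its vertices). -/
def pt (g : reflGroup T) (x : ℂ) : Surface T :=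
  open Classical in
  if h : x ∈ punctured T then Surface.mk T g ⟨x, h⟩ else Surface.mk T 1 (Classical.arbitrary _)

theorem pt_eq (g : reflGroup T) (hx : x ∈ punctured T) : pt T g x = Surface.mk T g ⟨x, hx⟩ :=
  dif_pos hx

theorem exists_pt (s : Surface T) : ∃ g, ∃ x ∈ punctured T, pt T g x = s := by
  induction s using Quotient.inductionOn with
  | h a => exact ⟨a.1, a.2, a.2.2, pt_eq _ _⟩

theorem param_eq_pt (g : reflGroup T) (hz : z ∈ kite T i) :
    param T g i z = pt T (sheet T g i z) (fold T i z) := by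
  rw [param_eq T g hz, pt_eq]

theorem param_eq_pt_of_mem (g : reflGroup T) (hx : x ∈ inner T ∪ side T i) :
    param T g i x = pt T g x := by
  have h0 := bary_nonneg_of_mem_punctured (mem_punctured_of_mem hx) i
  rw [param_eq_pt g (mem_kite_of_mem hx), sheet, fold, if_pos h0, if_pos h0]

theorem pt_eq_pt_iff {x y : ℂ} (hx : x ∈ punctured T) (hy : y ∈ punctured T) :
    pt T g x = pt T h y ↔ x = y ∧ (g = h ∨ ∃ i, x ∈ side T i ∧ h = g * gen T i) := by
  rw [pt_eq g hx, pt_eq h hy, mk_eq_mk, glue]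
  simp

theorem pt_mul_gen (g : reflGroup T) (hx : x ∈ side T i) : pt T (g * gen T i) x = pt T g x := by
  have : x ∈ punctured T := mem_punctured_of_mem (.inr hx)
  rw [eq_comm, pt_eq_pt_iff this this]
  exact ⟨rfl, .inr ⟨i, hx, rfl⟩⟩

/-! ## The folding map -/

variable (T) in
/-- The map from the surface to the triangle which forgets the copy. -/
def foldMap : Surface T → ℂ :=
  Quotient.lift (fun a : reflGroup T × punctured T => (a.2 : ℂ)) fun _ _ h => congrArg _ h.1

theorem foldMap_pt (g : reflGroup T) (hx : x ∈ punctured T) : foldMap T (pt T g x) = x := by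
  rw [pt_eq g hx]
  rfl

theorem foldMap_mem (s : Surface T) : foldMap T s ∈ punctured T := by
  obtain ⟨g, x, hx, rfl⟩ := exists_pt s
  rwa [foldMap_pt g hx]

theorem foldMap_param (g : reflGroup T) (hz : z ∈ kite T i) :
    foldMap T (param T g i z) = fold T i z := by
  rw [param_eq_pt g hz, foldMap_pt _ (fold_mem T hz)]

/-- Off the mirror line folding is a local isometry. Across the line it is not, but a point `z` on
the line is fixed by the reflection, so distances to `z` itself are preserved. -/
theorem eventually_norm_fold_sub (i : Fin 3) (z : ℂ) :
    ∀ᶠ y in 𝓝 z, ‖fold T i y - fold T i z‖ = ‖y - z‖ := by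
  by_cases h0 : bary T i z = 0
  · refine .of_forall fun y => ?_
    have hz : fold T i z = z := if_pos h0.ge
    have hz' := sideRefl_eq_self T i h0
    rw [hz, fold]
    split_ifs with h
    · rfl
    · nth_rewrite 1 [← hz']
      rw [sideRefl_sub, LinearIsometryEquiv.norm_map]
  · filter_upwards [fold_local T 1 i h0] with y hy
    have := congrArg norm hy.2
    rwa [LinearIsometryEquiv.norm_map, LinearIsometryEquiv.norm_map] at this

theorem fold_continuous (i : Fin 3) : Continuous (fold T i) := by
  rw [continuous_iff_continuousAt]
  intro z
  rw [ContinuousAt, tendsto_iff_norm_sub_tendsto_zero]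
  have h1 : Tendsto (fun y => ‖y - z‖) (𝓝 z) (𝓝 0) := by
    have : Continuous fun y => ‖y - z‖ := by fun_prop
    simpa using this.tendsto z
  exact h1.congr' ((eventually_norm_fold_sub i z).mono fun y hy => hy.symm)

theorem locallyContractingAt_foldMap (s : Surface T) : LocallyContractingAt (foldMap T) s := by
  obtain ⟨g, i, z, hz, rfl⟩ := param_surj T s
  refine ⟨echart T g i, echart_mem_atlas T g i, param_mem_source hz, eventually_param hz ?_⟩
  filter_upwards [eventually_norm_fold_sub i z, (kite_isOpen T i).mem_nhds hz] with y hy hk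
  rw [foldMap_param g hz, foldMap_param g hk, echart_param hz, echart_param hk, hy, ← map_sub,
    LinearIsometryEquiv.norm_map]

/-- This is the source of all lower bounds on lengths in the surface: they are read off in the
triangle. -/
theorem norm_foldMap_sub_le {p q : Surface T} {L : ℝ} (h : PolygonalPath (Surface T) p q L) :
    ‖foldMap T q - foldMap T p‖ ≤ L :=
  h.norm_sub_le fun y _ _ _ => locallyContractingAt_foldMap y

/-! ## Unions of copies of the triangle glued along some of the sides -/

variable (T) in
/-- The points of the triangle which are not on the sides outside `J`. -/
def region (J : Set (Fin 3)) : Set ℂ := {x | x ∈ inner T ∨ ∃ j ∈ J, x ∈ side T j}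

/-- The union of the copies indexed by `H` of the triangle without the sides outside `J`. -/
def patch (J : Set (Fin 3)) (H : Set (reflGroup T)) : Set (Surface T) :=
  {s | ∃ g ∈ H, ∃ x ∈ region T J, s = pt T g x}

/-- The set `H` of copies is stable under crossing the sides in `J`. -/
def Stable (J : Set (Fin 3)) (H : Set (reflGroup T)) : Prop :=
  ∀ g ∈ H, ∀ j ∈ J, g * gen T j ∈ H

variable {J : Set (Fin 3)} {H : Set (reflGroup T)}

/-- The generators are involutions, so a crossing into `H` could be undone by the same crossing. -/
theorem Stable.compl (hH : Stable J H) : Stable J Hᶜ := fun g hg j hj h => hg <| by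
  have := hH _ h j hj
  rwa [mul_assoc, gen_mul_gen, mul_one] at this

theorem region_subset_punctured : region T J ⊆ punctured T := by
  rintro x (hx | ⟨j, _, hx⟩)
  · exact .inl hx
  · exact .inr (mem_iUnion.2 ⟨j, hx⟩)

/-- A point of the region lies in at most one other copy, across a side in `J`; stability makes
membership independent of the copy chosen. -/
theorem pt_mem_patch_iff (hH : Stable J H) (hx : x ∈ region T J) :
    pt T g x ∈ patch J H ↔ g ∈ H := by
  refine ⟨?_, fun hg => ⟨g, hg, x, hx, rfl⟩⟩
  rintro ⟨h, hh, y, hy, e⟩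
  obtain ⟨rfl, rfl | ⟨i, hi, rfl⟩⟩ :=
    (pt_eq_pt_iff (region_subset_punctured hx) (region_subset_punctured hy)).1 e
  · exact hh
  · rcases hx with hx | ⟨j, hj, hx⟩
    · exact absurd hi (inner_not_side T hx i)
    · obtain rfl := side_inj T hi hx
      have := hH _ hh i hj
      rwa [mul_assoc, gen_mul_gen, mul_one] at this

theorem isOpen_patch (hH : Stable J H) : IsOpen (patch J H) := by
  rw [isOpen_iff_mem_nhds]
  rintro _ ⟨g, hg, x, hx | ⟨j, hj, hx⟩, rfl⟩
  · rw [← param_eq_pt_of_mem (i := 0) g (.inl hx)]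
    refine eventually_param (.inl hx) ?_
    filter_upwards [(inner_isOpen T).mem_nhds hx] with y hy
    rw [param_eq_pt_of_mem g (.inl hy)]
    exact ⟨g, hg, y, .inl hy, rfl⟩
  · rw [← param_eq_pt_of_mem (i := j) g (.inr hx)]
    refine eventually_param (.inr (.inl hx)) ?_
    filter_upwards [(kite_isOpen T j).mem_nhds (.inr (.inl hx))] with y hy
    refine ⟨_, ?_, _, ?_, param_eq_pt g hy⟩
    · unfold sheet
      split_ifs
      exacts [hg, hH g hg j hj]
    · exact (fold_mem_inner_union_side hy).imp id fun h => ⟨j, hj, h⟩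

/-- A polygonal path which only crosses the sides in `J` stays in a patch. -/
theorem PolygonalPath.mem_patch (hH : Stable J H) {p q : Surface T} {L : ℝ}
    (h : PolygonalPath (Surface T) p q L)
    (hJ : ∀ y ∈ punctured T, ‖y - foldMap T p‖ ≤ L → y ∈ region T J) (hp : p ∈ patch J H) :
    q ∈ patch J H := by
  induction h with
  | nil p => exact hp
  | @cons p q s L γ v hγ h0 h1 h ih =>
    have hL := h.nonneg
    -- Folding does not increase lengths, so the segment stays over the region. Its connected image
    -- is covered by two disjoint open patches and cannot pass from one to the other.
    have hcover : γ '' Icc 0 1 ⊆ patch J H ∪ patch J Hᶜ := by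
      rintro _ ⟨t, ht, rfl⟩
      have hlen := hγ.polygonalPath ht
      rw [h0] at hlen
      have hreg : foldMap T (γ t) ∈ region T J := by
        refine hJ _ (foldMap_mem _) ((norm_foldMap_sub_le hlen).trans ?_)
        have := mul_le_of_le_one_left (norm_nonneg v) ht.2
        linarith
      obtain ⟨g, x, hx, e⟩ := exists_pt (γ t)
      rw [← e, foldMap_pt g hx] at hreg
      rw [← e]
      by_cases hg : g ∈ H
      · exact .inl ⟨g, hg, x, hreg, rfl⟩
      · exact .inr ⟨g, hg, x, hreg, rfl⟩
    have hdisj : Disjoint (patch J H) (patch J Hᶜ) := by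
      rw [Set.disjoint_left]
      rintro _ ⟨g, hg, x, hx, rfl⟩ h'
      exact (pt_mem_patch_iff hH.compl hx).1 h' hg
    have hsub := (isPreconnected_Icc.image γ hγ.1).subset_left_of_subset_union (isOpen_patch hH)
      (isOpen_patch hH.compl) hdisj hcover ⟨p, ⟨0, by simp, h0⟩, hp⟩
    have hq : q ∈ patch J H := hsub ⟨1, by simp, h1⟩
    refine ih (fun y hy hyL => hJ y hy ?_) hq
    have h2 := norm_foldMap_sub_le (hγ.polygonalPath (t := 1) (by simp))
    rw [h0, h1, one_mul] at h2
    calc _ = ‖(foldMap T q - foldMap T p) + (y - foldMap T q)‖ := by congr 1; abel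
      _ ≤ _ := (norm_add_le _ _).trans (add_le_add h2 hyL)

theorem stable_pair (g : reflGroup T) (i : Fin 3) : Stable {i} {g, g * gen T i} := by
  rintro h (rfl | rfl) j rfl
  · exact .inr rfl
  · left
    rw [mul_assoc, gen_mul_gen, mul_one]

theorem mem_region_singleton : x ∈ region T {i} ↔ x ∈ inner T ∪ side T i := by
  simp [region]

/-- Exhibits a chart domain as a patch with `J = {i}`, so that `PolygonalPath.mem_patch` shows that
short paths do not leave it. -/
theorem echart_source_eq_patch (g : reflGroup T) (i : Fin 3) :
    (echart T g i).source = patch {i} {g, g * gen T i} := by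
  ext s
  constructor
  · intro hs
    obtain ⟨z, hz, rfl⟩ := exists_param_of_mem_source hs
    refine ⟨_, ?_, _, mem_region_singleton.2 (fold_mem_inner_union_side hz), param_eq_pt g hz⟩
    unfold sheet
    split_ifs
    exacts [.inl rfl, .inr rfl]
  · rintro ⟨h, hh, x, hx, rfl⟩
    rw [mem_region_singleton] at hx
    rcases hh with rfl | rfl
    · rw [← param_eq_pt_of_mem _ hx]
      exact param_mem_source (mem_kite_of_mem hx)
    · rcases hx with hx | hx
      · have hk : sideRefl T i x ∈ kite T i := .inr (.inr (by rwa [sideRefl_sideRefl]))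
        have hb : ¬ 0 ≤ bary T i (sideRefl T i x) := by
          rw [bary_sideRefl]
          linarith [hx i]
        have : param T g i (sideRefl T i x) = pt T (g * gen T i) x := by
          rw [param_eq_pt g hk, sheet, fold, if_neg hb, if_neg hb, sideRefl_sideRefl]
        rw [← this]
        exact param_mem_source hk
      · rw [pt_mul_gen g hx, ← param_eq_pt_of_mem _ (.inr hx)]
        exact param_mem_source (.inr (.inl hx))

/-- A polygonal path starting in the source of a chart and which is too short to leave it is
contracted by the chart. -/
theorem PolygonalPath.norm_echart_sub_le {p q : Surface T} {L : ℝ}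
    (h : PolygonalPath (Surface T) p q L) (hp : p ∈ (echart T g i).source)
    (hJ : ∀ y ∈ punctured T, ‖y - foldMap T p‖ ≤ L → y ∈ inner T ∪ side T i) :
    q ∈ (echart T g i).source ∧ ‖echart T g i q - echart T g i p‖ ≤ L := by
  have key : ∀ y M, M ≤ L → PolygonalPath (Surface T) p y M → y ∈ (echart T g i).source := by
    intro y M hM hy
    rw [echart_source_eq_patch] at hp ⊢
    exact PolygonalPath.mem_patch (stable_pair g i) hy
      (fun y hy h => mem_region_singleton.2 (hJ y hy (h.trans hM))) hp
  refine ⟨key q L le_rfl h, h.norm_sub_le fun y M hM hy => ?_⟩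
  exact ⟨echart T g i, echart_mem_atlas T g i, key y M hM hy, .of_forall fun _ => le_rfl⟩

/-! ## Straight segments in a copy of the triangle -/

/-- Near each time a single kite contains the segment, and there the chart acts on copy `g` as the
linear map `g`, which turns the velocity `u` into `g u`. -/
theorem isGeodesicOn_pt (g : reflGroup T) {u : ℂ} {I : Set ℝ}
    (h : ∀ t ∈ I, x + (t : ℂ) * u ∈ punctured T) :
    IsGeodesicOn (Surface T) (fun t => pt T g (x + (t : ℂ) * u)) ((g : ℂ ≃ₗᵢ[ℝ] ℂ) u) I := by
  have hc : Continuous fun t : ℝ => x + (t : ℂ) * u := by fun_prop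
  have key : ∀ s ∈ I, ∃ i, x + (s : ℂ) * u ∈ kite T i ∧
      pt T g (x + (s : ℂ) * u) = param T g i (x + (s : ℂ) * u) ∧
      ∀ᶠ t : ℝ in 𝓝[I] s, x + (t : ℂ) * u ∈ kite T i ∧
        pt T g (x + (t : ℂ) * u) = param T g i (x + (t : ℂ) * u) := by
    intro s hs
    obtain ⟨i, hi⟩ := exists_mem_inner_union_side (h s hs)
    refine ⟨i, mem_kite_of_mem hi, (param_eq_pt_of_mem g hi).symm, ?_⟩
    have h1 : ∀ᶠ t : ℝ in 𝓝[I] s, x + (t : ℂ) * u ∈ kite T i :=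
      hc.continuousWithinAt ((kite_isOpen T i).mem_nhds (mem_kite_of_mem hi))
    filter_upwards [h1, self_mem_nhdsWithin] with t ht htI
    exact ⟨ht, (param_eq_pt_of_mem g (mem_of_mem_punctured_kite (h t htI) ht)).symm⟩
  constructor
  · intro s hs
    obtain ⟨i, hk, he, hev⟩ := key s hs
    refine ContinuousWithinAt.congr_of_eventuallyEq (f := fun t : ℝ =>
      (echart T g i).symm ((g : ℂ ≃ₗᵢ[ℝ] ℂ) (x + (t : ℂ) * u))) ?_ ?_ ?_
    · have h1 := ((echart T g i).continuousAt_symm (apply_mem_echart_target (g := g) hk))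
      refine ContinuousAt.continuousWithinAt ?_
      exact ContinuousAt.comp (f := fun t : ℝ => (g : ℂ ≃ₗᵢ[ℝ] ℂ) (x + (t : ℂ) * u)) h1
        ((g : ℂ ≃ₗᵢ[ℝ] ℂ).continuous.comp hc).continuousAt
    · filter_upwards [hev] with t ht
      rw [echart_symm_apply', ht.2]
    · rw [echart_symm_apply', he]
  · intro s hs
    obtain ⟨i, hk, he, hev⟩ := key s hs
    refine ⟨echart T g i, echart_mem_atlas T g i, ?_, ?_⟩
    · dsimp only
      rw [he]
      exact param_mem_source hk
    · filter_upwards [hev] with t ht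
      rw [ht.2, he, echart_param hk, echart_param ht.1, ← sub_eq_iff_eq_add', ← map_sub]
      have : x + (t : ℂ) * u - (x + (s : ℂ) * u) = (t - s : ℝ) • u := by
        rw [Complex.real_smul]
        push_cast
        ring
      rw [this, map_smul, Complex.real_smul]

end KZ

namespace KZ

variable {T : Affine.Triangle ℝ ℂ} {g h : reflGroup T} {i j : Fin 3} {x y z : ℂ}

/-! ### Barycentric description and convexity of the triangle without its vertices. -/

theorem bary_sum (x : ℂ) : bary T 0 x + bary T 1 x + bary T 2 x = 1 := by
  rw [← (basis T).sum_coord_apply_eq_one x, Fin.sum_univ_three]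
  rfl

/-- In the closed triangle a coordinate equals 1 only at a vertex, so the strict bounds remove
exactly the vertices. -/
theorem mem_punctured_iff : x ∈ punctured T ↔ ∀ j, 0 ≤ bary T j x ∧ bary T j x < 1 := by
  have hs := bary_sum (T := T) x
  constructor
  · intro hx j
    refine ⟨bary_nonneg_of_mem_punctured hx j, ?_⟩
    rcases hx with hx | hx
    · have h0 := hx 0
      have h1 := hx 1
      have h2 := hx 2
      fin_cases j <;> simp <;> linarith
    · obtain ⟨i, hi⟩ := mem_iUnion.1 hx
      have h0 := hi.1
      have h1 := hi.2
      simp only [Fin.forall_fin_succ, Fin.forall_fin_zero] at h1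
      fin_cases i <;> simp at h0 h1 <;> fin_cases j <;> simp <;> linarith
  · intro h
    by_cases hpos : ∀ j, 0 < bary T j x
    · exact .inl hpos
    · push Not at hpos
      obtain ⟨i, hi⟩ := hpos
      have hi' := le_antisymm hi (h i).1
      refine .inr (mem_iUnion.2 ⟨i, hi', fun j hj => ?_⟩)
      have h0 := h 0
      have h1 := h 1
      have h2 := h 2
      fin_cases i <;> fin_cases j <;> simp at hj hi' ⊢ <;> linarith

theorem bary_segment (i : Fin 3) (x y : ℂ) (t : ℝ) :
    bary T i (x + (t : ℂ) * (y - x)) = (1 - t) * bary T i x + t * bary T i y := by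
  have h := bary_vadd T i x (y - x)
  rw [add_sub_cancel] at h
  rw [bary_vadd, ← Complex.real_smul, map_smul, h, smul_eq_mul]
  ring

/-- Vertices are extreme points, so removing them keeps the triangle convex. -/
theorem segment_mem_punctured (hx : x ∈ punctured T) (hy : y ∈ punctured T) {t : ℝ}
    (ht : t ∈ Icc (0 : ℝ) 1) : x + (t : ℂ) * (y - x) ∈ punctured T := by
  rw [mem_punctured_iff] at *
  intro j
  rw [bary_segment]
  obtain ⟨a, b⟩ := hx j
  obtain ⟨c, d⟩ := hy j
  obtain ⟨e, f⟩ := ht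
  constructor
  · have := mul_nonneg (sub_nonneg.2 f) a
    have := mul_nonneg e c
    linarith
  · rcases e.eq_or_lt with rfl | e
    · linarith
    · have := mul_le_mul_of_nonneg_left b.le (sub_nonneg.2 f)
      have := mul_lt_mul_of_pos_left d e
      linarith

theorem edist_pt_le (g : reflGroup T) (hx : x ∈ punctured T) (hy : y ∈ punctured T) :
    edist (α := FlatMetric (Surface T)) (pt T g x) (pt T g y) ≤ ENNReal.ofReal ‖y - x‖ := by
  have := edist_le_of_isGeodesicOn (isGeodesicOn_pt g (I := Icc 0 1)
    fun t ht => segment_mem_punctured hx hy ht)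
  rw [LinearIsometryEquiv.norm_map] at this
  simpa using this

/-! ## The surface as an open subset of its completion -/

variable (T) in
/-- The extension of the folding map to the metric completion. -/
def foldBar : FlatCompletion (Surface T) → ℂ :=
  UniformSpace.Completion.extension (α := FlatMetric (Surface T)) (foldMap T)

theorem foldBar_toCompletion (s : Surface T) : foldBar T (toCompletion s) = foldMap T s :=
  extension_toCompletion (uniformContinuous_of_polygonalPath fun _ _ _ => norm_foldMap_sub_le) s

theorem continuous_foldBar : Continuous (foldBar T) :=
  UniformSpace.Completion.continuous_extension

theorem bary_foldBar_nonneg (p : FlatCompletion (Surface T)) (j : Fin 3) :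
    0 ≤ bary T j (foldBar T p) := by
  have hcl : IsClosed {p : FlatCompletion (Surface T) | 0 ≤ bary T j (foldBar T p)} :=
    isClosed_le continuous_const ((bary_continuous T j).comp continuous_foldBar)
  refine denseRange_toCompletion.induction_on (p := fun p => 0 ≤ bary T j (foldBar T p)) p hcl ?_
  intro s
  rw [foldBar_toCompletion]
  exact bary_nonneg_of_mem_punctured (foldMap_mem s) j

theorem foldBar_mem_punctured_iff (p : FlatCompletion (Surface T)) :
    foldBar T p ∈ punctured T ↔ ∀ j, bary T j (foldBar T p) < 1 := by
  rw [mem_punctured_iff]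
  exact forall_congr' fun j => and_iff_right (bary_foldBar_nonneg p j)

/-- Nonnegativity of the coordinates passes to the completion by density. Only the strict
inequalities remain as conditions, and these are open although `punctured T` is not open in the
plane. -/
theorem isOpen_foldBar_preimage : IsOpen (foldBar T ⁻¹' punctured T) := by
  have : foldBar T ⁻¹' punctured T = ⋂ j, {p | bary T j (foldBar T p) < 1} := by
    ext p
    rw [mem_preimage, foldBar_mem_punctured_iff]
    simp
  rw [this]
  exact isOpen_iInter_of_finite fun j =>
    isOpen_lt ((bary_continuous T j).comp continuous_foldBar) continuous_const

/-- Around a point of the triangle other than a vertex, there is at most one side. -/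
theorem exists_ball_side (hx : x ∈ punctured T) : ∃ i, ∃ ε > 0, ∀ y ∈ punctured T,
    ‖y - x‖ < ε → y ∈ inner T ∪ side T i := by
  obtain ⟨i, hi⟩ := exists_mem_inner_union_side hx
  obtain ⟨ε, hε, hb⟩ := Metric.isOpen_iff.1 (kite_isOpen T i) x (mem_kite_of_mem hi)
  exact ⟨i, ε, hε, fun y hy hyx =>
    mem_of_mem_punctured_kite hy (hb (by rwa [mem_ball_iff_norm]))⟩

theorem pt_mem_source (hx : x ∈ inner T ∪ side T i) : pt T g x ∈ (echart T g i).source := by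
  rw [← param_eq_pt_of_mem _ hx]
  exact param_mem_source (mem_kite_of_mem hx)

theorem mem_kite_of_fold_mem (h : fold T i z ∈ inner T ∪ side T i) : z ∈ kite T i := by
  rw [kite_iff]
  have hb : bary T i (fold T i z) = |bary T i z| := by
    unfold fold
    split_ifs with h0
    · rw [abs_of_nonneg h0]
    · rw [bary_sideRefl, abs_of_neg (not_le.1 h0)]
  rcases h with h | h
  · refine .inl ⟨h, fun h0 => ?_⟩
    have := h i
    rw [hb, h0, abs_zero] at this
    exact lt_irrefl _ this
  · right
    have := h.1
    rw [hb, abs_eq_zero] at this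
    rwa [fold, if_pos this.ge] at h

/-- The completion adds only points lying over the vertices. -/
theorem mem_range_of_foldBar_mem {p : FlatCompletion (Surface T)} (hp : foldBar T p ∈ punctured T) :
    p ∈ range (toCompletion (S := Surface T)) := by
  obtain ⟨i, ε, hε, hball⟩ := exists_ball_side hp
  -- The trace on the surface of the neighbourhoods of `p` is a Cauchy filter for lengths. It is
  -- eventually in one chart, which contracts short paths, so its image in the plane is Cauchy and
  -- converges.
  set l : Filter (Surface T) := comap toCompletion (𝓝 p) with hl
  have hne : l.NeBot := 
    (UniformSpace.Completion.isDenseInducing_coe (α := FlatMetric (Surface T))).comap_nhds_neBot p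
  have htl : Tendsto (toCompletion (S := Surface T)) l (𝓝 p) := tendsto_comap
  have hcau : Cauchy (α := FlatMetric (Surface T)) l :=
    @Cauchy.comap _ _ _ _ _ _ (cauchy_nhds (a := p))
      (UniformSpace.Completion.isUniformInducing_coe (FlatMetric (Surface T))).comap_uniformity.le hne
  have hF : Tendsto (foldMap T) l (𝓝 (foldBar T p)) :=
    ((continuous_foldBar.tendsto p).comp htl).congr fun s => foldBar_toCompletion s
  have hF' : ∀ᶠ s in l, ‖foldMap T s - foldBar T p‖ < ε / 2 := by
    have := hF (Metric.ball_mem_nhds _ (half_pos hε))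
    filter_upwards [this] with s hs
    rwa [mem_preimage, mem_ball_iff_norm] at hs
  -- a set of small diameter consists of points of a single chart
  have small : ∀ δ > 0, δ ≤ ε / 2 → ∃ A ∈ l, ∀ s ∈ A, ∀ s' ∈ A,
      ‖foldMap T s - foldBar T p‖ < ε / 2 ∧ ∃ L < δ, PolygonalPath (Surface T) s s' L := by
    intro δ hδ hδε
    obtain ⟨A, hA, hAd⟩ := (uniformity_basis_edist (α := FlatMetric (Surface T))).cauchy_iff.1
      hcau |>.2 (ENNReal.ofReal δ) (by simpa using hδ)
    refine ⟨A ∩ {s | ‖foldMap T s - foldBar T p‖ < ε / 2}, inter_mem hA hF', ?_⟩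
    rintro s ⟨hs, hs1⟩ s' ⟨hs', -⟩
    exact ⟨hs1, exists_polygonalPath_of_edist_lt (S := Surface T) (hAd s hs s' hs')⟩
  have hreg : ∀ s : Surface T, ‖foldMap T s - foldBar T p‖ < ε / 2 → ∀ L ≤ ε / 2,
      ∀ y ∈ punctured T, ‖y - foldMap T s‖ ≤ L → y ∈ inner T ∪ side T i := by
    intro s hs L hL y hy hyL
    refine hball y hy ?_
    calc _ = ‖(y - foldMap T s) + (foldMap T s - foldBar T p)‖ := by congr 1; abel
      _ ≤ _ := norm_add_le _ _
      _ < ε := by linarith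
  obtain ⟨A, hA, hAs⟩ := small (ε / 2) (half_pos hε) le_rfl
  obtain ⟨c, hc⟩ := hne.nonempty_of_mem hA
  obtain ⟨g, x, hx, rfl⟩ := exists_pt c
  have hxi : x ∈ inner T ∪ side T i := by
    refine hball x hx ?_
    have := (hAs _ hc _ hc).1
    rw [foldMap_pt g hx] at this
    linarith
  have hsource : ∀ s ∈ A, s ∈ (echart T g i).source := by
    intro s hs
    obtain ⟨h1, L, hL, hpath⟩ := hAs _ hc s hs
    exact (PolygonalPath.norm_echart_sub_le hpath (pt_mem_source hxi) (hreg _ h1 L hL.le)).1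
  have hcau' : Cauchy (map (echart T g i) l) := by
    rw [Metric.cauchy_iff]
    refine ⟨inferInstance, fun δ hδ => ?_⟩
    obtain ⟨B, hB, hBs⟩ := small (min δ (ε / 2)) (lt_min hδ (half_pos hε)) (min_le_right _ _)
    refine ⟨_, image_mem_map (inter_mem hA hB), ?_⟩
    rintro _ ⟨s, hs, rfl⟩ _ ⟨s', hs', rfl⟩
    obtain ⟨h1, L, hL, hpath⟩ := hBs s hs.2 s' hs'.2
    have := (PolygonalPath.norm_echart_sub_le hpath (hsource s hs.1)
      (hreg _ h1 L (hL.le.trans (min_le_right _ _)))).2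
    rw [dist_comm, dist_eq_norm]
    exact this.trans_lt (hL.trans_le (min_le_left _ _))
  obtain ⟨w, hw⟩ := CompleteSpace.complete hcau'
  have hw : Tendsto (echart T g i) l (𝓝 w) := hw
  have hsrc : ∀ᶠ s in l, s ∈ (echart T g i).source := mem_of_superset hA hsource
  have hsymm : Tendsto (fun s => (g : ℂ ≃ₗᵢ[ℝ] ℂ).symm (echart T g i s)) l
      (𝓝 ((g : ℂ ≃ₗᵢ[ℝ] ℂ).symm w)) := ((g : ℂ ≃ₗᵢ[ℝ] ℂ).symm.continuous.tendsto w).comp hw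
  -- A limit could leave the open chart target; that its folding is a point of the triangle other
  -- than a vertex rules this out.
  have hfold : fold T i ((g : ℂ ≃ₗᵢ[ℝ] ℂ).symm w) = foldBar T p := by
    refine tendsto_nhds_unique (((fold_continuous i).tendsto _).comp hsymm) (hF.congr' ?_)
    filter_upwards [hsrc] with s hs
    obtain ⟨z, hz, rfl⟩ := exists_param_of_mem_source hs
    rw [foldMap_param g hz, Function.comp_apply, echart_param hz,
      LinearIsometryEquiv.symm_apply_apply]
  have htarget : w ∈ (echart T g i).target := by
    rw [mem_echart_target]
    refine mem_kite_of_fold_mem ?_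
    rw [hfold]
    exact hball _ hp (by simpa using hε)
  refine ⟨(echart T g i).symm w, ?_⟩
  refine tendsto_nhds_unique ?_ htl
  refine (continuous_toCompletion.tendsto _).comp ?_
  have := ((echart T g i).continuousAt_symm htarget).tendsto.comp hw
  refine this.congr' ?_
  filter_upwards [hsrc] with s hs
  exact (echart T g i).left_inv hs

theorem range_toCompletion : range (toCompletion (S := Surface T)) = foldBar T ⁻¹' punctured T := by
  refine Subset.antisymm ?_ fun p hp => mem_range_of_foldBar_mem hp
  rintro _ ⟨s, rfl⟩
  rw [mem_preimage, foldBar_toCompletion]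
  exact foldMap_mem s

/-- Converse to `edist_symm_le`: small length balls lie in one chart, where chart distance is
bounded by length distance. It yields both that the length topology is the manifold topology and
that lengths separate points. -/
theorem exists_edist_lt_chart (s : Surface T) : ∃ (g : reflGroup T) (i : Fin 3), ∃ ε > 0,
    s ∈ (echart T g i).source ∧ ∀ δ ≤ ε, ∀ s' : Surface T,
      edist (α := FlatMetric (Surface T)) s s' < ENNReal.ofReal δ →
        s' ∈ (echart T g i).source ∧ ‖echart T g i s' - echart T g i s‖ < δ := by
  obtain ⟨g, x, hx, rfl⟩ := exists_pt s
  obtain ⟨i, ε, hε, hball⟩ := exists_ball_side hx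
  have hs := pt_mem_source (g := g) (hball x hx (by simpa using hε))
  refine ⟨g, i, ε, hε, hs, fun δ hδ s' h => ?_⟩
  obtain ⟨L, hL, hp⟩ := exists_polygonalPath_of_edist_lt (S := Surface T) h
  have := PolygonalPath.norm_echart_sub_le hp hs fun y hy h => hball y hy ?_
  · exact ⟨this.1, this.2.trans_lt hL⟩
  · rw [foldMap_pt g hx] at h
    linarith

theorem isInducing_toCompletion : IsInducing (toCompletion (S := Surface T)) := by
  rw [isInducing_iff_nhds]
  intro s
  refine le_antisymm (continuous_toCompletion.tendsto s).le_comap ?_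
  obtain ⟨g, i, ε, hε, hs, h⟩ := exists_edist_lt_chart s
  have hbasis : ∀ δ > 0, {s' : Surface T | edist (α := FlatMetric (Surface T)) s s' <
      ENNReal.ofReal δ} ∈ comap (toCompletion (S := Surface T)) (𝓝 (toCompletion s)) := by
    intro δ hδ
    have h1 : comap (UniformSpace.Completion.coe' (α := FlatMetric (Surface T)))
        (𝓝 (toCompletion s)) = @nhds (FlatMetric (Surface T)) _ s :=
      (UniformSpace.Completion.isUniformInducing_coe _).isInducing.nhds_eq_comap _ |>.symm
    change _ ∈ comap (UniformSpace.Completion.coe' (α := FlatMetric (Surface T))) _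
    rw [h1]
    refine (Metric.nhds_basis_eball (α := FlatMetric (Surface T))).mem_iff.2
      ⟨ENNReal.ofReal δ, by simpa using hδ, fun s' hs' => ?_⟩
    exact (edist_comm (α := FlatMetric (Surface T)) _ _).trans_lt hs'
  intro N hN
  have hN' : (echart T g i).target ∩ (echart T g i).symm ⁻¹' N ∈ 𝓝 (echart T g i s) := by
    refine inter_mem ((echart T g i).open_target.mem_nhds ((echart T g i).map_source hs)) ?_
    refine (echart T g i).continuousAt_symm ((echart T g i).map_source hs) ?_
    rwa [(echart T g i).left_inv hs]
  obtain ⟨δ, hδ, hb⟩ := Metric.mem_nhds_iff.1 hN'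
  refine mem_of_superset (hbasis (min δ ε) (lt_min hδ hε)) fun s' hs' => ?_
  obtain ⟨h1, h2⟩ := h _ (min_le_right _ _) s' hs'
  have := (hb (mem_ball_iff_norm.2 (h2.trans_le (min_le_left _ _)))).2
  rwa [mem_preimage, (echart T g i).left_inv h1] at this

/-- Points identified in the completion are at length distance 0; they then share a chart and have
the same coordinate in it. -/
theorem toCompletion_injective : Function.Injective (toCompletion (S := Surface T)) := by
  intro s s' hss
  obtain ⟨g, i, ε, hε, hs, h⟩ := exists_edist_lt_chart s
  have h0 : edist (α := FlatMetric (Surface T)) s s' = 0 := by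
    have := (UniformSpace.Completion.isUniformInducing_coe
      (FlatMetric (Surface T))).isInducing.inseparable_iff.1 (.of_eq hss)
    exact EMetric.inseparable_iff.1 this
  have h1 : ∀ δ > 0, δ ≤ ε → s' ∈ (echart T g i).source ∧
      ‖echart T g i s' - echart T g i s‖ < δ := by
    intro δ hδ hδε
    refine h δ hδε s' ?_
    rw [h0]
    simpa using hδ
  refine (echart T g i).injOn hs (h1 ε hε le_rfl).1 ?_
  rw [eq_comm, ← sub_eq_zero, ← norm_le_zero_iff]
  refine le_of_forall_gt_imp_ge_of_dense fun δ hδ => ?_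
  exact (h1 _ (lt_min hδ hε) (min_le_right _ _)).2.le.trans (min_le_left _ _)

theorem isOpenEmbedding_toCompletion : IsOpenEmbedding (toCompletion (S := Surface T)) where
  toIsInducing := isInducing_toCompletion
  injective := toCompletion_injective
  isOpen_range := by
    rw [range_toCompletion]
    exact isOpen_foldBar_preimage

end KZ

namespace KZ

/-! ## Reflections of the plane -/

theorem map_reflection_span (g : ℂ ≃ₗᵢ[ℝ] ℂ) (u z : ℂ) :
    g ((Submodule.span ℝ {u}).reflection z) = (Submodule.span ℝ {g u}).reflection (g z) := by
  rw [Submodule.reflection_singleton_apply, Submodule.reflection_singleton_apply, map_sub,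
    map_nsmul, map_smul, g.inner_map_map, g.norm_map]

theorem reflection_span_apply {r : ℝ} (hr : r ≠ 0) (α : ℝ) (z : ℂ) :
    (Submodule.span ℝ {(r : ℂ) * Complex.exp (α * Complex.I)}).reflection z =
      Complex.exp ((2 * α : ℝ) * Complex.I) * (starRingEnd ℂ) z := by
  set e := Complex.exp (α * Complex.I) with he
  have hn : ‖e‖ = 1 := Complex.norm_exp_ofReal_mul_I α
  have he2 : Complex.exp ((2 * α : ℝ) * Complex.I) = e * e := by
    rw [he, ← Complex.exp_add]
    congr 1
    push_cast
    ring
  have hspan : Submodule.span ℝ {(r : ℂ) * e} = Submodule.span ℝ {e} := by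
    rw [← Complex.real_smul]
    exact Submodule.span_singleton_smul_eq (IsUnit.mk0 r hr) e
  have hin : ((Inner.inner ℝ e z : ℝ) : ℂ) = (e * (starRingEnd ℂ) z + (starRingEnd ℂ) e * z) / 2 := by
    rw [Complex.inner, Complex.re_eq_add_conj]
    simp only [map_mul, Complex.conj_conj]
    ring
  have hee : e * (starRingEnd ℂ) e = 1 := by
    rw [Complex.mul_conj, Complex.normSq_eq_norm_sq, hn]
    simp
  simp only [hspan, Submodule.reflection_singleton_apply, he2, hn, Complex.real_smul]
  simp only [one_pow, RCLike.ofReal_real_eq_id, id, nsmul_eq_mul, div_one]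
  rw [hin]
  push_cast
  linear_combination (z) * hee

variable {T : Affine.Triangle ℝ ℂ} {g h : reflGroup T} {i j a b : Fin 3} {x y z : ℂ}

/-- The side opposite the `a`-th vertex joins the `i`-th and `b`-th ones; describing it from the
central vertex `i` avoids cyclic indices. -/
theorem linRefl_eq (hab : a ≠ b) (ha : a ≠ i) (hb : b ≠ i) :
    linRefl T a = (Submodule.span ℝ {T.points b - T.points i}).reflection := by
  have hcase : (b = a + 2 ∧ i = a + 1) ∨ (b = a + 1 ∧ i = a + 2) := by
    revert a b i; decide
  unfold linRefl
  rcases hcase with ⟨rfl, rfl⟩ | ⟨rfl, rfl⟩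
  · rfl
  · have : Submodule.span ℝ {T.points (a + 2) - T.points (a + 1)} =
        Submodule.span ℝ {T.points (a + 1) - T.points (a + 2)} := by
      rw [← neg_sub, ← Set.neg_singleton, Submodule.span_neg]
    simp only [this]

theorem points_sub_ne_zero (ha : a ≠ i) : T.points a - T.points i ≠ 0 :=
  sub_ne_zero.2 fun h => ha (T.independent.injective h)

/-! ## Sectors around a vertex -/

variable (T) in
/-- In the copy `g` of the triangle, the rays from the `i`-th vertex to the `a`-th and to the `b`-th
one have the directions `β` and `β + θ`. -/
structure IsSector (i : Fin 3) (c : reflGroup T × Fin 3 × Fin 3) (β θ : ℝ) : Prop where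
  ne : c.2.1 ≠ c.2.2
  ne_left : c.2.1 ≠ i
  ne_right : c.2.2 ≠ i
  left : (c.1 : ℂ ≃ₗᵢ[ℝ] ℂ) (T.points c.2.1 - T.points i) =
    ‖T.points c.2.1 - T.points i‖ * Complex.exp (β * Complex.I)
  right : (c.1 : ℂ ≃ₗᵢ[ℝ] ℂ) (T.points c.2.2 - T.points i) =
    ‖T.points c.2.2 - T.points i‖ * Complex.exp ((β + θ : ℝ) * Complex.I)

variable (T) in
/-- Crossing the second side of a sector. -/
def turn : Equiv.Perm (reflGroup T × Fin 3 × Fin 3) where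
  toFun c := (c.1 * gen T c.2.1, c.2.2, c.2.1)
  invFun c := (c.1 * gen T c.2.2, c.2.2, c.2.1)
  left_inv c := by simp [mul_assoc, gen_mul_gen]
  right_inv c := by simp [mul_assoc, gen_mul_gen]

variable {c : reflGroup T × Fin 3 × Fin 3} {β θ : ℝ}

theorem coe_mul_gen_apply (g : reflGroup T) (a : Fin 3) (z : ℂ) :
    ((g * gen T a : reflGroup T) : ℂ ≃ₗᵢ[ℝ] ℂ) z = (g : ℂ ≃ₗᵢ[ℝ] ℂ) (linRefl T a z) := rfl

theorem conj_exp_mul_I (α : ℝ) :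
    (starRingEnd ℂ) (Complex.exp (α * Complex.I)) = Complex.exp (-α * Complex.I) := by
  rw [← Complex.exp_conj]
  simp

theorem reflect_ray {r s : ℝ} (hr : r ≠ 0) (α β : ℝ) :
    (Submodule.span ℝ {(r : ℂ) * Complex.exp (α * Complex.I)}).reflection
      (s * Complex.exp (β * Complex.I)) = s * Complex.exp ((2 * α - β : ℝ) * Complex.I) := by
  rw [reflection_span_apply hr, map_mul, Complex.conj_ofReal, conj_exp_mul_I, mul_left_comm,
    ← Complex.exp_add]
  congr 2
  push_cast
  ring

/-- Reflecting in the second side fixes its ray, at β + θ, and sends the ray at β to 2(β + θ) − β =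
β + 2θ. Adjacent copies have opposite orientations, hence the exchange of the two labels. -/
theorem IsSector.next (hc : IsSector T i c β θ) : IsSector T i (turn T c) (β + θ) θ := by
  obtain ⟨g, a, b⟩ := c
  obtain ⟨hab, ha, hb, hl, hr⟩ := hc
  dsimp only at hab ha hb hl hr
  have hb0 : ‖T.points b - T.points i‖ ≠ 0 := norm_ne_zero_iff.2 (points_sub_ne_zero hb)
  refine ⟨hab.symm, hb, ha, ?_, ?_⟩
  · change ((g * gen T a : reflGroup T) : ℂ ≃ₗᵢ[ℝ] ℂ) (T.points b - T.points i) = _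
    rw [coe_mul_gen_apply, linRefl_eq hab ha hb,
      Submodule.reflection_mem_subspace_eq_self (Submodule.mem_span_singleton_self _)]
    exact hr
  · change ((g * gen T a : reflGroup T) : ℂ ≃ₗᵢ[ℝ] ℂ) (T.points a - T.points i) = _
    rw [coe_mul_gen_apply, linRefl_eq hab ha hb, map_reflection_span, hr, hl, reflect_ray hb0]
    change _ = (‖T.points a - T.points i‖ : ℂ) * _
    congr 4
    ring

theorem IsSector.prev (hc : IsSector T i c β θ) : IsSector T i ((turn T).symm c) (β - θ) θ := by
  obtain ⟨g, a, b⟩ := c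
  obtain ⟨hab, ha, hb, hl, hr⟩ := hc
  dsimp only at hab ha hb hl hr
  have ha0 : ‖T.points a - T.points i‖ ≠ 0 := norm_ne_zero_iff.2 (points_sub_ne_zero ha)
  refine ⟨hab.symm, hb, ha, ?_, ?_⟩
  · change ((g * gen T b : reflGroup T) : ℂ ≃ₗᵢ[ℝ] ℂ) (T.points b - T.points i) = _
    rw [coe_mul_gen_apply, linRefl_eq hab.symm hb ha, map_reflection_span, hr, hl, reflect_ray ha0]
    change _ = (‖T.points b - T.points i‖ : ℂ) * _
    congr 4
    ring
  · change ((g * gen T b : reflGroup T) : ℂ ≃ₗᵢ[ℝ] ℂ) (T.points a - T.points i) = _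
    rw [coe_mul_gen_apply, linRefl_eq hab.symm hb ha,
      Submodule.reflection_mem_subspace_eq_self (Submodule.mem_span_singleton_self _), sub_add_cancel]
    exact hl

theorem IsSector.iterate (hc : IsSector T i c β θ) (n : ℤ) :
    IsSector T i ((turn T ^ n) c) (β + n * θ) θ := by
  induction n using Int.induction_on with
  | zero => simpa using hc
  | succ n ih =>
    have := ih.next
    rw [← Equiv.Perm.mul_apply, ← zpow_one_add, add_comm] at this
    convert this using 1
    push_cast
    ring
  | pred n ih =>
    have := ih.prev
    rw [← Equiv.Perm.inv_def, ← Equiv.Perm.mul_apply, ← zpow_neg_one, ← zpow_add,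
      neg_add_eq_sub] at this
    convert this using 1
    push_cast
    ring

/-! ### Barycentric coordinates of the points of a sector. -/

variable (T) in
/-- The point at position `w` relative to the `i`-th vertex, in the copy `g` of the plane. -/
def conePt (i : Fin 3) (g : reflGroup T) (w : ℂ) : ℂ := T.points i + (g : ℂ ≃ₗᵢ[ℝ] ℂ).symm w

theorem apply_conePt (i : Fin 3) (g : reflGroup T) (w : ℂ) :
    (g : ℂ ≃ₗᵢ[ℝ] ℂ) (conePt T i g w) = (g : ℂ ≃ₗᵢ[ℝ] ℂ) (T.points i) + w := by
  simp [conePt]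

theorem conePt_apply_sub (i : Fin 3) (g : reflGroup T) (x : ℂ) :
    conePt T i g ((g : ℂ ≃ₗᵢ[ℝ] ℂ) (x - T.points i)) = x := by
  simp [conePt]

theorem sideRefl_point (hb : b ≠ i) : sideRefl T b (T.points i) = T.points i :=
  sideRefl_eq_self T b (by rw [bary_points, if_neg hb])

/-- The displacement `w` is measured in the developed plane; crossing a side through the vertex
leaves it unchanged and mirrors the corresponding point of the triangle's plane. -/
theorem conePt_mul_gen (hb : b ≠ i) (w : ℂ) :
    conePt T i (g * gen T b) w = sideRefl T b (conePt T i g w) := by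
  have h1 := sideRefl_sub T b (conePt T i g w) (T.points i)
  rw [sideRefl_point hb, sub_eq_iff_eq_add'] at h1
  rw [h1]
  unfold conePt
  congr 1
  rw [LinearIsometryEquiv.symm_apply_eq, coe_mul_gen_apply, add_sub_cancel_left]
  simp [linRefl]

theorem bary_conePt_eq (i j : Fin 3) (s t : ℝ) (a b : Fin 3)
    (hx : x = T.points i + (s • (T.points a - T.points i) + t • (T.points b - T.points i))) :
    bary T j x = (if j = i then 1 else 0) + (s * ((if j = a then 1 else 0) - if j = i then 1 else 0)
      + t * ((if j = b then 1 else 0) - if j = i then 1 else 0)) := by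
  have hL : ∀ k, ((basis T).coord j).linear (T.points k - T.points i) =
      (if j = k then 1 else 0) - if j = i then 1 else 0 := by
    intro k
    have := bary_vadd T j (T.points i) (T.points k - T.points i)
    rw [add_sub_cancel, bary_points, bary_points] at this
    linarith
  rw [hx, bary_vadd, map_add, map_smul, map_smul, hL, hL, bary_points, smul_eq_mul, smul_eq_mul]

/-- Decomposition of a direction along the two rays bounding a sector, with the denominator sin θ
cleared. -/
theorem exp_combination (β θ φ : ℝ) :
    (Real.sin θ : ℂ) * Complex.exp (φ * Complex.I) =
      Real.sin (β + θ - φ) * Complex.exp (β * Complex.I) +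
        Real.sin (φ - β) * Complex.exp ((β + θ : ℝ) * Complex.I) := by
  obtain ⟨ψ, rfl⟩ : ∃ ψ, φ = β + ψ := ⟨φ - β, by ring⟩
  have h1 : β + θ - (β + ψ) = θ - ψ := by ring
  have h2 : β + ψ - β = ψ := by ring
  rw [h1, h2]
  push_cast
  rw [add_mul, add_mul, Complex.exp_add, Complex.exp_add, Complex.exp_mul_I ψ, Complex.exp_mul_I θ,
    Complex.sin_sub]
  ring

theorem IsSector.forall_index (hc : IsSector T i c β θ) {P : Fin 3 → Prop} (h1 : P i) (h2 : P c.2.1) (h3 : P c.2.2) (j) :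
    P j := by
  have : j = i ∨ j = c.2.1 ∨ j = c.2.2 := by
    have a := hc.ne
    have b := hc.ne_left
    have d := hc.ne_right
    omega
  rcases this with rfl | rfl | rfl
  exacts [h1, h2, h3]

section sector

variable (hc : IsSector T i c β θ) (h0 : 0 < θ) (hπ : θ < Real.pi)
include hc h0 hπ

/-- Polar coordinates in a sector, in terms of barycentric coordinates. -/
theorem IsSector.conePt_eq (ρ φ : ℝ) :
    conePt T i c.1 (ρ * Complex.exp (φ * Complex.I)) = T.points i +
      ((ρ * Real.sin (β + θ - φ) / (Real.sin θ * ‖T.points c.2.1 - T.points i‖)) •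
        (T.points c.2.1 - T.points i) +
      (ρ * Real.sin (φ - β) / (Real.sin θ * ‖T.points c.2.2 - T.points i‖)) •
        (T.points c.2.2 - T.points i)) := by
  have hs : (Real.sin θ : ℂ) ≠ 0 :=
    Complex.ofReal_ne_zero.2 (Real.sin_pos_of_pos_of_lt_pi h0 hπ).ne'
  have ha : (‖T.points c.2.1 - T.points i‖ : ℂ) ≠ 0 :=
    Complex.ofReal_ne_zero.2 (norm_ne_zero_iff.2 (points_sub_ne_zero hc.ne_left))
  have hb : (‖T.points c.2.2 - T.points i‖ : ℂ) ≠ 0 :=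
    Complex.ofReal_ne_zero.2 (norm_ne_zero_iff.2 (points_sub_ne_zero hc.ne_right))
  unfold conePt
  congr 1
  rw [LinearIsometryEquiv.symm_apply_eq, map_add, map_smul, map_smul, hc.left, hc.right,
    Complex.real_smul, Complex.real_smul]
  have := exp_combination β θ φ
  push_cast at this ha hb hs ⊢
  generalize Complex.exp (φ * Complex.I) = e₁ at *
  generalize Complex.exp (β * Complex.I) = e₂ at *
  generalize Complex.exp ((β + θ) * Complex.I) = e₃ at *
  field_simp
  linear_combination ρ * this

theorem IsSector.bary_left (ρ φ : ℝ) :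
    bary T c.2.1 (conePt T i c.1 (ρ * Complex.exp (φ * Complex.I))) =
      ρ * Real.sin (β + θ - φ) / (Real.sin θ * ‖T.points c.2.1 - T.points i‖) := by
  rw [bary_conePt_eq i _ _ _ _ _ (hc.conePt_eq h0 hπ ρ φ), if_neg hc.ne_left, if_neg hc.ne,
    if_pos rfl]
  ring

theorem IsSector.bary_right (ρ φ : ℝ) :
    bary T c.2.2 (conePt T i c.1 (ρ * Complex.exp (φ * Complex.I))) =
      ρ * Real.sin (φ - β) / (Real.sin θ * ‖T.points c.2.2 - T.points i‖) := by
  rw [bary_conePt_eq i _ _ _ _ _ (hc.conePt_eq h0 hπ ρ φ), if_neg hc.ne_right,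
    if_neg hc.ne.symm, if_pos rfl]
  ring

variable {r ρ φ : ℝ} (hr : ∀ j, j ≠ i → 2 * r ≤ Real.sin θ * ‖T.points j - T.points i‖)
  (hρ : ρ ∈ Ioo 0 r)
include hr hρ

/-- The factor 2 in the bound on `r` keeps each of the other two coordinates below 1/2, so the
vertex coordinate stays positive and the opposite side is not reached. -/
theorem IsSector.bary_vertex_pos (φ : ℝ) :
    0 < bary T i (conePt T i c.1 (ρ * Complex.exp (φ * Complex.I))) := by
  have key : ∀ j, j ≠ i → ∀ u : ℝ,
      ρ * Real.sin u / (Real.sin θ * ‖T.points j - T.points i‖) < 1 / 2 := by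
    intro j hj u
    have hpos : 0 < Real.sin θ * ‖T.points j - T.points i‖ :=
      mul_pos (Real.sin_pos_of_pos_of_lt_pi h0 hπ) (norm_pos_iff.2 (points_sub_ne_zero hj))
    rw [div_lt_iff₀ hpos]
    have := hr j hj
    have := mul_le_mul_of_nonneg_left (Real.sin_le_one u) hρ.1.le
    have := hρ.2
    linarith
  have h1 := key _ hc.ne_left (β + θ - φ)
  have h2 := key _ hc.ne_right (φ - β)
  rw [bary_conePt_eq i _ _ _ _ _ (hc.conePt_eq h0 hπ ρ φ), if_pos rfl,
    if_neg hc.ne_left.symm, if_neg hc.ne_right.symm]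
  linarith

theorem IsSector.conePt_mem_inner (hφ : φ ∈ Ioo β (β + θ)) :
    conePt T i c.1 (ρ * Complex.exp (φ * Complex.I)) ∈ inner T := by
  have hs := Real.sin_pos_of_pos_of_lt_pi h0 hπ
  have ha := norm_pos_iff.2 (points_sub_ne_zero (T := T) hc.ne_left)
  have hb := norm_pos_iff.2 (points_sub_ne_zero (T := T) hc.ne_right)
  have hρ0 := hρ.1
  intro j
  refine hc.forall_index (P := fun j => 0 < bary T j _)
    (hc.bary_vertex_pos h0 hπ hr hρ φ) ?_ ?_ j
  · rw [hc.bary_left h0 hπ]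
    have := Real.sin_pos_of_pos_of_lt_pi (x := β + θ - φ) (by linarith [hφ.2]) (by linarith [hφ.1])
    positivity
  · rw [hc.bary_right h0 hπ]
    have := Real.sin_pos_of_pos_of_lt_pi (x := φ - β) (by linarith [hφ.1]) (by linarith [hφ.2])
    positivity

theorem IsSector.conePt_mem_side_right :
    conePt T i c.1 (ρ * Complex.exp (β * Complex.I)) ∈ side T c.2.2 := by
  have hs := Real.sin_pos_of_pos_of_lt_pi h0 hπ
  have ha := norm_pos_iff.2 (points_sub_ne_zero (T := T) hc.ne_left)
  have hρ0 := hρ.1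
  refine ⟨?_, ?_⟩
  · rw [hc.bary_right h0 hπ]
    simp
  · refine hc.forall_index (fun _ => hc.bary_vertex_pos h0 hπ hr hρ β) (fun _ => ?_)
      (fun h => absurd rfl h)
    rw [hc.bary_left h0 hπ, add_sub_cancel_left]
    positivity

theorem IsSector.conePt_mem_side_left :
    conePt T i c.1 (ρ * Complex.exp ((β + θ : ℝ) * Complex.I)) ∈ side T c.2.1 := by
  have hs := Real.sin_pos_of_pos_of_lt_pi h0 hπ
  have hb := norm_pos_iff.2 (points_sub_ne_zero (T := T) hc.ne_right)
  have hρ0 := hρ.1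
  refine ⟨?_, ?_⟩
  · rw [hc.bary_left h0 hπ]
    simp
  · refine hc.forall_index (fun _ => hc.bary_vertex_pos h0 hπ hr hρ _)
      (fun h => absurd rfl h) (fun _ => ?_)
    rw [hc.bary_right h0 hπ, add_sub_cancel_left]
    positivity

theorem IsSector.conePt_mem_region (hφ : φ ∈ Icc β (β + θ)) :
    conePt T i c.1 (ρ * Complex.exp (φ * Complex.I)) ∈ region T {i}ᶜ := by
  rcases hφ.1.eq_or_lt with rfl | h1
  · exact .inr ⟨_, hc.ne_right, hc.conePt_mem_side_right h0 hπ hr hρ⟩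
  · rcases hφ.2.eq_or_lt with rfl | h2
    · exact .inr ⟨_, hc.ne_left, hc.conePt_mem_side_left h0 hπ hr hρ⟩
    · exact .inl (hc.conePt_mem_inner h0 hπ hr hρ ⟨h1, h2⟩)

/-- The union of a sector with the previous one lies in a kite. -/
theorem IsSector.conePt_mem_kite (hφ : φ ∈ Ioo (β - θ) (β + θ)) :
    conePt T i c.1 (ρ * Complex.exp (φ * Complex.I)) ∈ kite T c.2.2 := by
  rcases lt_trichotomy φ β with h | rfl | h
  · refine .inr (.inr ?_)
    rw [← conePt_mul_gen hc.ne_right]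
    exact hc.prev.conePt_mem_inner h0 hπ hr hρ ⟨hφ.1, by linarith⟩
  · exact .inr (.inl (hc.conePt_mem_side_right h0 hπ hr hρ))
  · exact .inl (hc.conePt_mem_inner h0 hπ hr hρ ⟨h, hφ.2⟩)

theorem IsSector.param_conePt_of_le (hφ : φ ∈ Ico β (β + θ)) :
    param T c.1 c.2.2 (conePt T i c.1 (ρ * Complex.exp (φ * Complex.I))) =
      pt T c.1 (conePt T i c.1 (ρ * Complex.exp (φ * Complex.I))) := by
  rcases hφ.1.eq_or_lt with rfl | h
  · exact param_eq_pt_of_mem _ (.inr (hc.conePt_mem_side_right h0 hπ hr hρ))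
  · exact param_eq_pt_of_mem _ (.inl (hc.conePt_mem_inner h0 hπ hr hρ ⟨h, hφ.2⟩))

theorem IsSector.param_conePt_of_lt (hφ : φ ∈ Ioo (β - θ) β) :
    param T c.1 c.2.2 (conePt T i c.1 (ρ * Complex.exp (φ * Complex.I))) =
      pt T ((turn T).symm c).1
        (conePt T i ((turn T).symm c).1 (ρ * Complex.exp (φ * Complex.I))) := by
  have hk := hc.conePt_mem_kite h0 hπ hr hρ (φ := φ) ⟨hφ.1, by linarith [hφ.2]⟩
  have hin := hc.prev.conePt_mem_inner h0 hπ hr hρ (φ := φ) ⟨hφ.1, by linarith [hφ.2]⟩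
  change conePt T i (c.1 * gen T c.2.2) _ ∈ _ at hin
  change _ = pt T (c.1 * gen T c.2.2) (conePt T i (c.1 * gen T c.2.2) _)
  rw [conePt_mul_gen hc.ne_right] at hin ⊢
  have hneg := hin c.2.2
  rw [bary_sideRefl] at hneg
  rw [param_eq_pt _ hk, sheet, fold, if_neg (by linarith), if_neg (by linarith)]

end sector

end KZ

namespace KZ

variable {T : Affine.Triangle ℝ ℂ} {g h : reflGroup T} {i j a b : Fin 3} {x y z : ℂ}
  {c : reflGroup T × Fin 3 × Fin 3} {β θ r ρ φ ρ' φ' : ℝ}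

/-! ## Polar coordinates in the triangle -/

theorem eq_combination (hab : a ≠ b) (ha : a ≠ i) (hb : b ≠ i) (x : ℂ) :
    x = T.points i + (bary T a x • (T.points a - T.points i) +
      bary T b x • (T.points b - T.points i)) := by
  have hs := (basis T).linear_combination_coord_eq_self x
  have h1 : ((bary T 0 x + bary T 1 x + bary T 2 x : ℝ) : ℂ) = 1 := by
    rw [bary_sum, Complex.ofReal_one]
  have hp : ∀ j, (basis T) j = T.points j := fun _ => rfl
  rw [Fin.sum_univ_three] at hs
  simp only [hp, Complex.real_smul] at hs ⊢
  change (bary T 0 x : ℂ) * _ + (bary T 1 x : ℂ) * _ + (bary T 2 x : ℂ) * _ = x at hs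
  push_cast at h1
  have h2 : T.points i * (bary T 0 x + bary T 1 x + bary T 2 x) = T.points i := by rw [h1, mul_one]
  have hfin : ∀ k : Fin 3, k = 0 ∨ k = 1 ∨ k = 2 := by decide
  rcases hfin i with rfl | rfl | rfl <;> rcases hfin a with rfl | rfl | rfl <;>
    rcases hfin b with rfl | rfl | rfl <;> first | contradiction | linear_combination -hs + h2

theorem points_notMem_punctured (i : Fin 3) : T.points i ∉ punctured T := by
  intro h
  have := (mem_punctured_iff.1 h i).2
  rw [bary_points, if_pos rfl] at this
  exact lt_irrefl _ this

theorem exists_eq_points (h : ∀ j, 0 ≤ bary T j x) (hx : x ∉ punctured T) :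
    ∃ j, x = T.points j := by
  have : ∃ j, 1 ≤ bary T j x := by
    by_contra! hcon
    exact hx (mem_punctured_iff.2 fun j => ⟨h j, hcon j⟩)
  obtain ⟨j, hj⟩ := this
  have hsum := bary_sum (T := T) x
  obtain ⟨a, b, hab, ha, hb⟩ : ∃ a b, a ≠ b ∧ a ≠ j ∧ b ≠ j := by
    clear hj; revert j; decide
  have h0 := h 0
  have h1 := h 1
  have h2 := h 2
  have hz : ∀ k, k ≠ j → bary T k x = 0 := by
    intro k hk
    fin_cases j <;> fin_cases k <;> simp at hj hk ⊢ <;> linarith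
  refine ⟨j, ?_⟩
  have := eq_combination (T := T) hab ha hb x
  rw [hz a ha, hz b hb] at this
  simpa using this

/-- For a nonzero sum w the principal argument serves as φ. It is nonnegative because w has
nonnegative imaginary part, and at most θ because ‖w‖ sin(θ − arg w) = s sin θ ≥ 0. -/
theorem exists_polar {s t θ : ℝ} (hs : 0 ≤ s) (ht : 0 ≤ t) (h0 : 0 < θ) (hπ : θ < Real.pi) :
    ∃ φ ∈ Icc 0 θ, ∃ ρ : ℝ, 0 ≤ ρ ∧
      (s : ℂ) + t * Complex.exp (θ * Complex.I) = ρ * Complex.exp (φ * Complex.I) := by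
  set w := (s : ℂ) + t * Complex.exp (θ * Complex.I) with hw
  have hsin := Real.sin_pos_of_pos_of_lt_pi h0 hπ
  by_cases hw0 : w = 0
  · exact ⟨0, ⟨le_rfl, h0.le⟩, 0, le_rfl, by simp [hw0]⟩
  have hpos : 0 < ‖w‖ := norm_pos_iff.2 hw0
  have hre : w.re = s + t * Real.cos θ := by
    rw [hw, Complex.add_re, Complex.ofReal_re, Complex.re_ofReal_mul, Complex.exp_ofReal_mul_I_re]
  have him : w.im = t * Real.sin θ := by
    rw [hw, Complex.add_im, Complex.ofReal_im, Complex.im_ofReal_mul, Complex.exp_ofReal_mul_I_im,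
      zero_add]
  have h1 : 0 ≤ w.arg := Complex.arg_nonneg_iff.2 (by rw [him]; positivity)
  refine ⟨w.arg, ⟨h1, ?_⟩, ‖w‖, hpos.le, (Complex.norm_mul_exp_arg_mul_I w).symm⟩
  by_contra! hcon
  have h2 : Real.sin (θ - w.arg) < 0 := Real.sin_neg_of_neg_of_neg_pi_lt (by linarith)
    (by linarith [Complex.arg_le_pi w])
  have h3 : ‖w‖ * Real.sin (θ - w.arg) = s * Real.sin θ := by
    rw [Real.sin_sub, mul_sub, mul_left_comm, mul_left_comm ‖w‖ (Real.cos θ),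
      Complex.norm_mul_cos_arg, Complex.norm_mul_sin_arg, hre, him]
    ring
  have h4 := mul_neg_of_pos_of_neg hpos h2
  rw [h3] at h4
  exact absurd h4 (not_lt.2 (by positivity))

theorem norm_conePt_sub (g : reflGroup T) (w : ℂ) : ‖conePt T i g w - T.points i‖ = ‖w‖ := by
  rw [conePt, add_sub_cancel_left, LinearIsometryEquiv.norm_map]

theorem IsSector.exists_conePt (hc : IsSector T i c β θ) (h0 : 0 < θ) (hπ : θ < Real.pi)
    (hx : x ∈ punctured T) : ∃ φ ∈ Icc β (β + θ),
      x = conePt T i c.1 ((‖x - T.points i‖ : ℝ) * Complex.exp (φ * Complex.I)) := by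
  obtain ⟨φ, hφ, ρ, hρ, h⟩ := exists_polar
    (mul_nonneg (bary_nonneg_of_mem_punctured hx c.2.1) (norm_nonneg (T.points c.2.1 - T.points i)))
    (mul_nonneg (bary_nonneg_of_mem_punctured hx c.2.2) (norm_nonneg (T.points c.2.2 - T.points i)))
    h0 hπ
  have hxe : x = conePt T i c.1 (ρ * Complex.exp ((β + φ : ℝ) * Complex.I)) := by
    have e1 := eq_combination (T := T) hc.ne hc.ne_left hc.ne_right x
    have e2 : (c.1 : ℂ ≃ₗᵢ[ℝ] ℂ) (x - T.points i) = ρ * Complex.exp ((β + φ : ℝ) * Complex.I) := by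
      rw [← sub_eq_iff_eq_add'] at e1
      rw [e1, map_add, map_smul, map_smul, hc.left, hc.right, Complex.real_smul, Complex.real_smul]
      push_cast at h ⊢
      rw [add_mul, add_mul, Complex.exp_add, Complex.exp_add]
      linear_combination Complex.exp (β * Complex.I) * h
    rw [← e2, conePt_apply_sub]
  have hn : ‖x - T.points i‖ = |ρ| := by
    conv_lhs => rw [hxe]
    rw [norm_conePt_sub, norm_mul, Complex.norm_exp_ofReal_mul_I, mul_one, Complex.norm_real,
      Real.norm_eq_abs]
  refine ⟨β + φ, ⟨by linarith [hφ.1], by linarith [hφ.2]⟩, ?_⟩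
  rwa [hn, abs_of_nonneg hρ]

end KZ

namespace KZ

variable {T : Affine.Triangle ℝ ℂ} {g h : reflGroup T} {i j a b : Fin 3} {x y z : ℂ}
  {c : reflGroup T × Fin 3 × Fin 3} {β θ r ρ φ ρ' φ' : ℝ}

/-! ## Polar coordinates around a vertex of the surface -/

variable (T) in
/-- A sector of angle in `(0, π)` and a radius which is small compared to the sides. -/
structure IsCone (i : Fin 3) (c : reflGroup T × Fin 3 × Fin 3) (β θ r : ℝ) : Prop
    extends IsSector T i c β θ where
  pos : 0 < θ
  lt_pi : θ < Real.pi
  radius_pos : 0 < r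
  radius_le : ∀ j, j ≠ i → 2 * r ≤ Real.sin θ * ‖T.points j - T.points i‖

/-- The `n`-th copy of the triangle around the vertex. -/
def copy (c : reflGroup T × Fin 3 × Fin 3) (n : ℤ) : reflGroup T := ((turn T ^ n) c).1

/-- The point with polar coordinates `(ρ, φ)` around a vertex of the surface. -/
def coneMap (i : Fin 3) (c : reflGroup T × Fin 3 × Fin 3) (β θ : ℝ) (q : ℝ × ℝ) : Surface T :=
  pt T (copy c ⌊(q.2 - β) / θ⌋)
    (conePt T i (copy c ⌊(q.2 - β) / θ⌋) (q.1 * Complex.exp (q.2 * Complex.I)))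

theorem turn_zpow_add_one (c : reflGroup T × Fin 3 × Fin 3) (n : ℤ) :
    (turn T ^ (n + 1)) c = turn T ((turn T ^ n) c) := by
  rw [← Equiv.Perm.mul_apply, ← zpow_one_add, add_comm]

theorem turn_zpow_sub_one (c : reflGroup T × Fin 3 × Fin 3) (n : ℤ) :
    (turn T ^ (n - 1)) c = (turn T).symm ((turn T ^ n) c) := by
  rw [Equiv.eq_symm_apply, ← turn_zpow_add_one, sub_add_cancel]

theorem copy_add_one (c : reflGroup T × Fin 3 × Fin 3) (n : ℤ) :
    copy c (n + 1) = copy c n * gen T ((turn T ^ n) c).2.1 := by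
  rw [copy, turn_zpow_add_one]
  rfl

theorem copy_sub_one (c : reflGroup T × Fin 3 × Fin 3) (n : ℤ) :
    copy c (n - 1) = copy c n * gen T ((turn T ^ n) c).2.2 := by
  rw [copy, turn_zpow_sub_one]
  rfl

theorem coneMap_of_mem_Ico (h0 : 0 < θ) {n : ℤ} (hφ : φ ∈ Ico (β + n * θ) (β + n * θ + θ)) :
    coneMap i c β θ (ρ, φ) =
      pt T (copy c n) (conePt T i (copy c n) (ρ * Complex.exp (φ * Complex.I))) := by
  have : ⌊(φ - β) / θ⌋ = n := by
    rw [Int.floor_eq_iff, le_div_iff₀ h0, div_lt_iff₀ h0]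
    constructor <;> linarith [hφ.1, hφ.2]
  rw [coneMap, this]

theorem exists_mem_Ico (h0 : 0 < θ) (β φ : ℝ) : ∃ n : ℤ, φ ∈ Ico (β + n * θ) (β + n * θ + θ) := by
  have h1 := Int.floor_le ((φ - β) / θ)
  have h2 := Int.lt_floor_add_one ((φ - β) / θ)
  rw [le_div_iff₀ h0] at h1
  rw [div_lt_iff₀ h0] at h2
  exact ⟨⌊(φ - β) / θ⌋, by linarith, by linarith⟩

theorem norm_sub_points_pos (hx : x ∈ punctured T) : 0 < ‖x - T.points i‖ :=
  norm_pos_iff.2 (sub_ne_zero.2 fun h => points_notMem_punctured i (h ▸ hx))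

namespace IsCone

variable (hc : IsCone T i c β θ r)
include hc

theorem iterate (n : ℤ) : IsCone T i ((turn T ^ n) c) (β + n * θ) θ r :=
  ⟨hc.toIsSector.iterate n, hc.pos, hc.lt_pi, hc.radius_pos, hc.radius_le⟩

/-- The kite across the initial ray of the `n`-th sector covers this sector and the preceding one at
once. These open double sectors cover all angles, so continuity and flatness can be checked in
single charts. -/
theorem coneMap_eq_param {n : ℤ} (hρ : ρ ∈ Ioo 0 r)
    (hφ : φ ∈ Ioo (β + n * θ - θ) (β + n * θ + θ)) :
    coneMap i c β θ (ρ, φ) = param T (copy c n) ((turn T ^ n) c).2.2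
      (conePt T i (copy c n) (ρ * Complex.exp (φ * Complex.I))) := by
  have hn := hc.iterate n
  rcases le_or_gt (β + n * θ) φ with h | h
  · rw [coneMap_of_mem_Ico hc.pos ⟨h, hφ.2⟩]
    exact (hn.param_conePt_of_le hn.pos hn.lt_pi hn.radius_le hρ ⟨h, hφ.2⟩).symm
  · rw [coneMap_of_mem_Ico (n := n - 1) hc.pos (by
      push_cast
      constructor <;> linarith [hφ.1])]
    have := hn.param_conePt_of_lt hn.pos hn.lt_pi hn.radius_le hρ ⟨hφ.1, h⟩
    rw [← turn_zpow_sub_one] at this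
    exact this.symm

/-- The floor assigns the final ray of a sector to the next copy; the gluing along that ray makes
the two descriptions agree. -/
theorem coneMap_of_mem_Icc {n : ℤ} (hρ : ρ ∈ Ioo 0 r)
    (hφ : φ ∈ Icc (β + n * θ) (β + n * θ + θ)) :
    coneMap i c β θ (ρ, φ) =
      pt T (copy c n) (conePt T i (copy c n) (ρ * Complex.exp (φ * Complex.I))) := by
  rcases hφ.2.eq_or_lt with rfl | h
  · have hn := hc.iterate n
    rw [coneMap_of_mem_Ico (n := n + 1) hc.pos (by
      push_cast
      constructor <;> linarith [hc.pos])]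
    have hside := hn.conePt_mem_side_left hn.pos hn.lt_pi hn.radius_le hρ
    rw [copy_add_one, conePt_mul_gen hn.ne_left]
    change conePt T i (copy c n) _ ∈ _ at hside
    rw [sideRefl_eq_self T _ hside.1, pt_mul_gen _ hside]
  · exact coneMap_of_mem_Ico hc.pos ⟨hφ.1, h⟩

theorem conePt_mem_region (hρ : ρ ∈ Ioo 0 r) {n : ℤ}
    (hφ : φ ∈ Icc (β + n * θ) (β + n * θ + θ)) :
    conePt T i (copy c n) (ρ * Complex.exp (φ * Complex.I)) ∈ region T {i}ᶜ :=
  (hc.iterate n).toIsSector.conePt_mem_region hc.pos hc.lt_pi hc.radius_le hρ hφ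

theorem continuousAt_and_flat {q : ℝ × ℝ} (hq : q ∈ Ioo 0 r ×ˢ (univ : Set ℝ)) :
    ContinuousAt (coneMap i c β θ) q ∧
    ∃ e ∈ atlas ℂ (Surface T), coneMap i c β θ q ∈ e.source ∧
      ∀ᶠ b in 𝓝 q, e (coneMap i c β θ b) - b.1 * Complex.exp (b.2 * Complex.I) =
        e (coneMap i c β θ q) - q.1 * Complex.exp (q.2 * Complex.I) := by
  obtain ⟨n, hn⟩ := exists_mem_Ico hc.pos β q.2
  have hθ := hc.pos
  have hopen : Ioo 0 r ×ˢ Ioo (β + n * θ - θ) (β + n * θ + θ) ∈ 𝓝 q :=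
    (isOpen_Ioo.prod isOpen_Ioo).mem_nhds ⟨hq.1, by linarith [hn.1], hn.2⟩
  set e := echart T (copy c n) ((turn T ^ n) c).2.2
  have hk : ∀ b ∈ Ioo 0 r ×ˢ Ioo (β + n * θ - θ) (β + n * θ + θ),
      conePt T i (copy c n) (b.1 * Complex.exp (b.2 * Complex.I)) ∈
        kite T ((turn T ^ n) c).2.2 := fun b hb =>
    (hc.iterate n).toIsSector.conePt_mem_kite hc.pos hc.lt_pi hc.radius_le hb.1 hb.2
  have hval : ∀ b ∈ Ioo 0 r ×ˢ Ioo (β + n * θ - θ) (β + n * θ + θ),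
      coneMap i c β θ b = e.symm (((copy c n : reflGroup T) : ℂ ≃ₗᵢ[ℝ] ℂ) (T.points i) +
        b.1 * Complex.exp (b.2 * Complex.I)) := by
    intro b hb
    rw [← apply_conePt, echart_symm_apply']
    exact hc.coneMap_eq_param hb.1 hb.2
  have htar : ∀ b ∈ Ioo 0 r ×ˢ Ioo (β + n * θ - θ) (β + n * θ + θ),
      ((copy c n : reflGroup T) : ℂ ≃ₗᵢ[ℝ] ℂ) (T.points i) +
        b.1 * Complex.exp (b.2 * Complex.I) ∈ e.target := by
    intro b hb
    rw [← apply_conePt]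
    exact apply_mem_echart_target (hk b hb)
  have hcont : Continuous fun b : ℝ × ℝ => ((copy c n : reflGroup T) : ℂ ≃ₗᵢ[ℝ] ℂ) (T.points i) +
      b.1 * Complex.exp (b.2 * Complex.I) := by fun_prop
  constructor
  · refine ContinuousAt.congr ?_ ((eventually_of_mem hopen hval).mono fun _ h => h.symm)
    exact (e.continuousAt_symm (htar q (mem_of_mem_nhds hopen))).comp_of_eq
      hcont.continuousAt rfl
  · refine ⟨e, echart_mem_atlas T _ _, ?_, ?_⟩
    · rw [hval q (mem_of_mem_nhds hopen)]
      exact e.map_target (htar q (mem_of_mem_nhds hopen))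
    · filter_upwards [hopen] with b hb
      rw [hval b hb, hval q (mem_of_mem_nhds hopen), e.right_inv (htar b hb),
        e.right_inv (htar q (mem_of_mem_nhds hopen))]
      ring

theorem norm_foldMap_coneMap_sub (hρ : ρ ∈ Ioo 0 r) (φ : ℝ) :
    ‖foldMap T (coneMap i c β θ (ρ, φ)) - T.points i‖ = ρ := by
  obtain ⟨n, hn⟩ := exists_mem_Ico hc.pos β φ
  rw [coneMap_of_mem_Ico hc.pos hn, foldMap_pt _
    (region_subset_punctured (hc.conePt_mem_region hρ ⟨hn.1, hn.2.le⟩)), norm_conePt_sub, norm_mul,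
    Complex.norm_exp_ofReal_mul_I, mul_one, Complex.norm_real, Real.norm_eq_abs, abs_of_pos hρ.1]

/-! ### Injectivity -/

/-- A linear part determines the directions of the two edges modulo 2π. With equal labels,
incommensurability gives m = n. With exchanged labels it would give both m = n + 1 and m = n − 1. -/
theorem eq_of_copy_eq (hirr : ∀ m n : ℤ, m * θ = n * Real.pi → m = 0) {m n : ℤ}
    (h : copy c m = copy c n) : m = n := by
  have hm := (hc.iterate m).toIsSector
  have hn := (hc.iterate n).toIsSector
  have hcopy : ((turn T ^ m) c).1 = ((turn T ^ n) c).1 := h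
  have key : ∀ {j : Fin 3}, j ≠ i → ∀ {α α' : ℝ},
      (‖T.points j - T.points i‖ : ℂ) * Complex.exp (α * Complex.I) =
        ‖T.points j - T.points i‖ * Complex.exp (α' * Complex.I) →
      ∃ k : ℤ, α = α' + k * (2 * Real.pi) := by
    intro j hj α α' h
    have h1 := mul_left_cancel₀ (Complex.ofReal_ne_zero.2
      (norm_ne_zero_iff.2 (points_sub_ne_zero hj))) h
    obtain ⟨k, hk⟩ := Complex.exp_eq_exp_iff_exists_int.1 h1
    refine ⟨k, ?_⟩
    have hI := Complex.I_ne_zero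
    have h2 : (α : ℂ) = α' + k * (2 * Real.pi) := by
      apply mul_right_cancel₀ hI
      rw [hk]
      ring
    exact_mod_cast h2
  by_cases hab : ((turn T ^ m) c).2.1 = ((turn T ^ n) c).2.1
  · have h1 := hm.left
    rw [hcopy, hab, hn.left] at h1
    obtain ⟨k, hk⟩ := key hn.ne_left h1
    have := hirr (n - m) (k * 2) (by push_cast; linarith)
    omega
  · have e1 : ((turn T ^ m) c).2.1 = ((turn T ^ n) c).2.2 := by
      have := hm.ne_left
      have := hn.ne_left
      have := hn.ne_right
      have := hn.ne
      omega
    have e2 : ((turn T ^ m) c).2.2 = ((turn T ^ n) c).2.1 := by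
      have := hm.ne_right
      have := hn.ne_left
      have := hn.ne_right
      have := hm.ne
      omega
    have h1 := hm.left
    rw [hcopy, e1, hn.right] at h1
    obtain ⟨k, hk⟩ := key hn.ne_right h1
    have h2 := hm.right
    rw [hcopy, e2, hn.left] at h2
    obtain ⟨l, hl⟩ := key hn.ne_left h2
    have h3 := hirr (n + 1 - m) (k * 2) (by push_cast; linarith)
    have h4 := hirr (n - m - 1) (l * 2) (by push_cast; linarith)
    omega

theorem eq_right_of_mem_side (hρ : ρ ∈ Ioo 0 r) {n : ℤ}
    (hφ : φ ∈ Ico (β + n * θ) (β + n * θ + θ))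
    (h : conePt T i (copy c n) (ρ * Complex.exp (φ * Complex.I)) ∈ side T j) :
    j = ((turn T ^ n) c).2.2 := by
  have hn := hc.iterate n
  rcases hφ.1.eq_or_lt with rfl | h1
  · exact side_inj T h (hn.conePt_mem_side_right hn.pos hn.lt_pi hn.radius_le hρ)
  · exact absurd h (inner_not_side T
      (hn.conePt_mem_inner hn.pos hn.lt_pi hn.radius_le hρ ⟨h1, hφ.2⟩) j)

theorem coneMap_injOn (hirr : ∀ m n : ℤ, m * θ = n * Real.pi → m = 0) (hρ : ρ ∈ Ioo 0 r)
    (hρ' : ρ' ∈ Ioo 0 r) (h : coneMap i c β θ (ρ, φ) = coneMap i c β θ (ρ', φ')) :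
    ρ = ρ' ∧ φ = φ' := by
  have hρρ : ρ = ρ' := by
    rw [← hc.norm_foldMap_coneMap_sub hρ φ, h, hc.norm_foldMap_coneMap_sub hρ' φ']
  subst hρρ
  refine ⟨rfl, ?_⟩
  obtain ⟨n, hn⟩ := exists_mem_Ico hc.pos β φ
  obtain ⟨m, hm⟩ := exists_mem_Ico hc.pos β φ'
  have hrn := hc.conePt_mem_region hρ ⟨hn.1, hn.2.le⟩
  have hrm := hc.conePt_mem_region hρ ⟨hm.1, hm.2.le⟩
  rw [coneMap_of_mem_Ico hc.pos hn, coneMap_of_mem_Ico hc.pos hm,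
    pt_eq_pt_iff (region_subset_punctured hrn) (region_subset_punctured hrm)] at h
  obtain ⟨hx, hg | ⟨j, hj, hg⟩⟩ := h
  -- In the same copy the angles agree modulo 2π and lie in an interval of length θ < π, so they
  -- coincide.
  · have hnm := hc.eq_of_copy_eq hirr hg
    subst hnm
    have h1 := ((copy c n : reflGroup T) : ℂ ≃ₗᵢ[ℝ] ℂ).symm.injective (add_left_cancel hx)
    have h2 := mul_left_cancel₀ (Complex.ofReal_ne_zero.2 hρ.1.ne') h1
    obtain ⟨k, hk⟩ := Complex.exp_eq_exp_iff_exists_int.1 h2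
    have h3 : φ = φ' + k * (2 * Real.pi) := by
      have : (φ : ℂ) = φ' + k * (2 * Real.pi) := by
        apply mul_right_cancel₀ Complex.I_ne_zero
        rw [hk]
        ring
      exact_mod_cast this
    have hθ := hc.lt_pi
    have hp := Real.pi_pos
    have h4 : k = 0 := by
      have h5 : (k : ℝ) < 1 := by
        by_contra! hcon
        have := mul_le_mul_of_nonneg_right hcon (by positivity : (0 : ℝ) ≤ 2 * Real.pi)
        linarith [hn.1, hn.2, hm.1, hm.2]
      have h6 : (-1 : ℝ) < k := by
        by_contra! hcon
        have := mul_le_mul_of_nonneg_right hcon (by positivity : (0 : ℝ) ≤ 2 * Real.pi)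
        linarith [hn.1, hn.2, hm.1, hm.2]
      have h5' : k < 1 := by exact_mod_cast h5
      have h6' : -1 < k := by exact_mod_cast h6
      omega
    rw [h3, h4]
    simp
  -- Within a half-open sector only the initial ray lies on a side. Both points are thus on initial
  -- rays, and the second copy is the one before the first, whose initial side carries the other
  -- label.
  · exfalso
    have e1 := hc.eq_right_of_mem_side hρ hn hj
    rw [hx] at hj
    have e2 := hc.eq_right_of_mem_side hρ hm hj
    rw [e1, ← copy_sub_one] at hg
    obtain rfl := hc.eq_of_copy_eq hirr hg
    rw [turn_zpow_sub_one, e1] at e2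
    exact (hc.iterate n).ne e2.symm

/-! ### The union of the copies around the vertex -/

/-- The two sides through the vertex lead from the `n`-th copy to its neighbours `n + 1` and `n -
1`. -/
theorem stable_range_copy : Stable {i}ᶜ (range (copy c)) := by
  rintro _ ⟨n, rfl⟩ j hj
  have hn := (hc.iterate n).toIsSector
  refine hn.forall_index (P := fun j => j ≠ i → copy c n * gen T j ∈ range (copy c))
    (fun h => absurd rfl h) (fun _ => ⟨n + 1, ?_⟩) (fun _ => ⟨n - 1, ?_⟩) j hj
  · exact copy_add_one c n
  · exact copy_sub_one c n

theorem coneMap_mem_patch (hρ : ρ ∈ Ioo 0 r) (φ : ℝ) :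
    coneMap i c β θ (ρ, φ) ∈ patch {i}ᶜ (range (copy c)) := by
  obtain ⟨n, hn⟩ := exists_mem_Ico hc.pos β φ
  exact ⟨_, ⟨n, rfl⟩, _, hc.conePt_mem_region hρ ⟨hn.1, hn.2.le⟩, coneMap_of_mem_Ico hc.pos hn⟩

theorem mem_region_of_norm_lt (hx : x ∈ punctured T) (hr : ‖x - T.points i‖ < r) :
    x ∈ region T {i}ᶜ := by
  obtain ⟨φ, hφ, h⟩ := hc.exists_conePt hc.pos hc.lt_pi hx
  rw [h]
  exact hc.toIsSector.conePt_mem_region hc.pos hc.lt_pi hc.radius_le ⟨norm_sub_points_pos hx, hr⟩ hφ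

theorem exists_coneMap_eq {s : Surface T} (hs : s ∈ patch {i}ᶜ (range (copy c)))
    (hr : ‖foldMap T s - T.points i‖ < r) :
    ‖foldMap T s - T.points i‖ ∈ Ioo 0 r ∧
      ∃ φ, s = coneMap i c β θ (‖foldMap T s - T.points i‖, φ) := by
  obtain ⟨_, ⟨n, rfl⟩, x, hx, rfl⟩ := hs
  have hxp := region_subset_punctured hx
  rw [foldMap_pt _ hxp] at hr ⊢
  have hρ : ‖x - T.points i‖ ∈ Ioo 0 r := ⟨norm_sub_points_pos hxp, hr⟩
  obtain ⟨φ, hφ, h⟩ := (hc.iterate n).exists_conePt hc.pos hc.lt_pi hxp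
  refine ⟨hρ, φ, ?_⟩
  rw [hc.coneMap_of_mem_Icc hρ hφ]
  change x = conePt T i (copy c n) _ at h
  rw [← h]

end IsCone

end KZ

namespace KZ

variable {T : Affine.Triangle ℝ ℂ} {g h : reflGroup T} {i j a b : Fin 3} {x y z : ℂ}
  {c : reflGroup T × Fin 3 × Fin 3} {β θ r ρ φ ρ' φ' : ℝ}

namespace IsCone

variable (hc : IsCone T i c β θ r)
include hc

/-! ### Distances around the vertex -/

theorem edist_sector_le {n : ℤ} (hρ : ρ ∈ Ioo 0 r) (hρ' : ρ' ∈ Ioo 0 r)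
    (hφ : φ ∈ Icc (β + n * θ) (β + n * θ + θ)) (hφ' : φ' ∈ Icc (β + n * θ) (β + n * θ + θ)) :
    edist (α := FlatMetric (Surface T)) (coneMap i c β θ (ρ, φ)) (coneMap i c β θ (ρ', φ')) ≤
      ENNReal.ofReal ‖(ρ' * Complex.exp (φ' * Complex.I) - ρ * Complex.exp (φ * Complex.I) : ℂ)‖ := by
  rw [hc.coneMap_of_mem_Icc hρ hφ, hc.coneMap_of_mem_Icc hρ' hφ']
  refine (edist_pt_le _ (region_subset_punctured (hc.conePt_mem_region hρ hφ))
    (region_subset_punctured (hc.conePt_mem_region hρ' hφ'))).trans (le_of_eq ?_)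
  unfold conePt
  rw [add_sub_add_left_eq_sub, ← map_sub, LinearIsometryEquiv.norm_map]

theorem edist_same_radius_le {n : ℤ} (hρ : ρ ∈ Ioo 0 r)
    (hφ : φ ∈ Icc (β + n * θ) (β + n * θ + θ)) (hφ' : φ' ∈ Icc (β + n * θ) (β + n * θ + θ)) :
    edist (α := FlatMetric (Surface T)) (coneMap i c β θ (ρ, φ)) (coneMap i c β θ (ρ, φ')) ≤
      ENNReal.ofReal (2 * ρ) := by
  refine (hc.edist_sector_le hρ hρ hφ hφ').trans (ENNReal.ofReal_le_ofReal ?_)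
  refine (norm_sub_le _ _).trans (le_of_eq ?_)
  rw [norm_mul, norm_mul, Complex.norm_exp_ofReal_mul_I, Complex.norm_exp_ofReal_mul_I,
    Complex.norm_real, Real.norm_eq_abs, abs_of_pos hρ.1]
  ring

theorem edist_same_angle_le (hρ : ρ ∈ Ioo 0 r) (hρ' : ρ' ∈ Ioo 0 r) (φ : ℝ) :
    edist (α := FlatMetric (Surface T)) (coneMap i c β θ (ρ, φ)) (coneMap i c β θ (ρ', φ)) ≤
      ENNReal.ofReal |ρ' - ρ| := by
  obtain ⟨n, hn⟩ := exists_mem_Ico hc.pos β φ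
  refine (hc.edist_sector_le hρ hρ' ⟨hn.1, hn.2.le⟩ ⟨hn.1, hn.2.le⟩).trans (le_of_eq ?_)
  rw [← sub_mul, norm_mul, Complex.norm_exp_ofReal_mul_I, mul_one, ← Complex.ofReal_sub,
    Complex.norm_real, Real.norm_eq_abs]

/-- Turning sector by sector costs at most 2ρ each time, and the number of sectors depends on φ but
not on ρ. -/
theorem exists_edist_base_le (φ : ℝ) : ∃ K : ℝ, 0 ≤ K ∧ ∀ ρ ∈ Ioo 0 r,
    edist (α := FlatMetric (Surface T)) (coneMap i c β θ (ρ, φ)) (coneMap i c β θ (ρ, β)) ≤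
      ENNReal.ofReal (K * ρ) := by
  have hθ := hc.pos
  have step : ∀ {φ φ' : ℝ} {n : ℤ}, φ ∈ Icc (β + n * θ) (β + n * θ + θ) →
      φ' ∈ Icc (β + n * θ) (β + n * θ + θ) →
      (∃ K : ℝ, 0 ≤ K ∧ ∀ ρ ∈ Ioo 0 r, edist (α := FlatMetric (Surface T))
        (coneMap i c β θ (ρ, φ)) (coneMap i c β θ (ρ, β)) ≤ ENNReal.ofReal (K * ρ)) →
      ∃ K : ℝ, 0 ≤ K ∧ ∀ ρ ∈ Ioo 0 r, edist (α := FlatMetric (Surface T))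
        (coneMap i c β θ (ρ, φ')) (coneMap i c β θ (ρ, β)) ≤ ENNReal.ofReal (K * ρ) := by
    rintro φ φ' n hφ hφ' ⟨K, hK, h⟩
    refine ⟨2 + K, by positivity, fun ρ hρ => ?_⟩
    refine (edist_triangle (α := FlatMetric (Surface T)) _ (coneMap i c β θ (ρ, φ)) _).trans ?_
    rw [add_mul, ENNReal.ofReal_add (by linarith [hρ.1]) (mul_nonneg hK hρ.1.le)]
    exact add_le_add (hc.edist_same_radius_le hρ hφ' hφ) (h ρ hρ)
  obtain ⟨n, hn⟩ := exists_mem_Ico hc.pos β φ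
  refine step (n := n) (φ := β + n * θ) ⟨le_rfl, by linarith⟩ ⟨hn.1, hn.2.le⟩ ?_
  clear hn
  induction n using Int.induction_on with
  | zero => exact ⟨0, le_rfl, fun ρ _ => by
      simpa only [Int.cast_zero, zero_mul, add_zero, ENNReal.ofReal_zero] using
        (edist_self (α := FlatMetric (Surface T)) _).le⟩
  | succ n ih =>
    refine step (n := n) (φ := β + (n : ℤ) * θ) ⟨le_rfl, by linarith⟩ ?_ ih
    push_cast
    constructor <;> linarith
  | pred n ih =>
    refine step (n := -n - 1) (φ := β + (-n : ℤ) * θ) ?_ ⟨le_rfl, by linarith⟩ ih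
    push_cast
    constructor <;> linarith

/-- Go in along one ray to radius ε, turn there at cost O(ε), come out along the other ray, and let
ε tend to 0. The bound does not depend on the angles, which is what makes an infinite cone close up
at one point. -/
theorem edist_coneMap_le (hρ : ρ ∈ Ioo 0 r) (hρ' : ρ' ∈ Ioo 0 r) (φ φ' : ℝ) :
    edist (α := FlatMetric (Surface T)) (coneMap i c β θ (ρ, φ)) (coneMap i c β θ (ρ', φ')) ≤
      ENNReal.ofReal (ρ + ρ') := by
  obtain ⟨K, hK, h⟩ := hc.exists_edist_base_le φ
  obtain ⟨K', hK', h'⟩ := hc.exists_edist_base_le φ'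
  have key : ∀ ε ∈ Ioo 0 (min ρ ρ'), edist (α := FlatMetric (Surface T))
      (coneMap i c β θ (ρ, φ)) (coneMap i c β θ (ρ', φ')) ≤
      ENNReal.ofReal ((ρ - ε) + K * ε + K' * ε + (ρ' - ε)) := by
    intro ε hε
    have h1 := lt_min_iff.1 hε.2
    have hεr : ε ∈ Ioo 0 r := ⟨hε.1, h1.1.trans hρ.2⟩
    have hε0 := hε.1
    have e1 := hc.edist_same_angle_le hρ hεr φ
    have e2 := hc.edist_same_angle_le hεr hρ' φ'
    rw [abs_sub_comm, abs_of_nonneg (by linarith)] at e1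
    rw [abs_of_nonneg (by linarith)] at e2
    have e3 := (edist_comm (α := FlatMetric (Surface T)) _ _).trans_le (h' ε hεr)
    rw [ENNReal.ofReal_add _ (by linarith), ENNReal.ofReal_add _ (by positivity),
      ENNReal.ofReal_add (by linarith) (by positivity)]
    · refine (edist_triangle4 (α := FlatMetric (Surface T)) _ (coneMap i c β θ (ε, φ))
        (coneMap i c β θ (ε, φ')) _).trans (add_le_add ?_ e2)
      rw [add_assoc]
      refine add_le_add e1 ?_
      exact (edist_triangle (α := FlatMetric (Surface T)) _ (coneMap i c β θ (ε, β)) _).trans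
        (add_le_add (h ε hεr) e3)
    · have : 0 ≤ K * ε := by positivity
      linarith
    · have : 0 ≤ K * ε := by positivity
      have : 0 ≤ K' * ε := by positivity
      linarith
  have hlim : Tendsto (fun ε : ℝ => ENNReal.ofReal ((ρ - ε) + K * ε + K' * ε + (ρ' - ε))) (𝓝[>] 0)
      (𝓝 (ENNReal.ofReal (ρ + ρ'))) := by
    refine ENNReal.tendsto_ofReal ?_
    have : Continuous fun ε : ℝ => (ρ - ε) + K * ε + K' * ε + (ρ' - ε) := by fun_prop
    have := (this.tendsto 0).mono_left (nhdsWithin_le_nhds (s := Ioi 0))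
    simpa using this
  refine ge_of_tendsto hlim ?_
  filter_upwards [Ioo_mem_nhdsGT (lt_min hρ.1 hρ'.1)] with ε hε using key ε hε

/-! ### The vertex as a point of the completion -/

omit hc in
/-- The filter of neighbourhoods of the vertex. -/
def _root_.KZ.vertexFilter (i : Fin 3) (c : reflGroup T × Fin 3 × Fin 3) : Filter (Surface T) :=
  comap (foldMap T) (𝓝 (T.points i)) ⊓ 𝓟 (patch {i}ᶜ (range (copy c)))

theorem tendsto_coneMap_vertexFilter (φ : ℝ) :
    Tendsto (fun ρ => coneMap i c β θ (ρ, φ)) (𝓝[>] 0) (vertexFilter i c) := by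
  have hev : ∀ᶠ ρ in 𝓝[>] (0 : ℝ), ρ ∈ Ioo 0 r := Ioo_mem_nhdsGT hc.radius_pos
  refine tendsto_inf.2 ⟨tendsto_comap_iff.2 ?_, tendsto_principal.2 ?_⟩
  · rw [tendsto_iff_norm_sub_tendsto_zero]
    have : Tendsto (fun ρ : ℝ => ρ) (𝓝[>] 0) (𝓝 0) := nhdsWithin_le_nhds
    refine this.congr' ?_
    filter_upwards [hev] with ρ hρ
    exact (hc.norm_foldMap_coneMap_sub hρ φ).symm
  · filter_upwards [hev] with ρ hρ using hc.coneMap_mem_patch hρ φ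

omit hc in
theorem eventually_vertexFilter {δ : ℝ} (hδ : 0 < δ) : ∀ᶠ s in vertexFilter i c,
    s ∈ patch {i}ᶜ (range (copy c)) ∧ ‖foldMap T s - T.points i‖ < δ := by
  have h1 : ∀ᶠ s in comap (foldMap T) (𝓝 (T.points i)), ‖foldMap T s - T.points i‖ < δ := by
    have := preimage_mem_comap (m := foldMap T) (Metric.ball_mem_nhds (T.points i) hδ)
    filter_upwards [this] with s hs
    rwa [mem_preimage, mem_ball_iff_norm] at hs
  exact (eventually_inf_principal.2 (.of_forall fun s hs => hs)).and (h1.filter_mono inf_le_left)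

theorem cauchy_vertexFilter : Cauchy (α := FlatMetric (Surface T)) (vertexFilter i c) := by
  refine ((uniformity_basis_edist (α := FlatMetric (Surface T))).cauchy_iff).2 ⟨?_, fun ε hε => ?_⟩
  · exact (hc.tendsto_coneMap_vertexFilter 0).neBot
  · obtain ⟨δ, hδ, hδε⟩ : ∃ δ : ℝ, 0 < δ ∧ ENNReal.ofReal δ < ε := by
      obtain ⟨δ, h1, h2⟩ := ENNReal.lt_iff_exists_nnreal_btwn.1 hε
      exact ⟨δ, by exact_mod_cast h1, by rwa [ENNReal.ofReal_coe_nnreal]⟩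
    refine ⟨_, eventually_vertexFilter (lt_min (half_pos hδ) hc.radius_pos), ?_⟩
    rintro s ⟨hs, hs1⟩ s' ⟨hs', hs1'⟩
    rw [lt_min_iff] at hs1 hs1'
    obtain ⟨hρ, φ, e⟩ := hc.exists_coneMap_eq hs hs1.2
    obtain ⟨hρ', φ', e'⟩ := hc.exists_coneMap_eq hs' hs1'.2
    have := hc.edist_coneMap_le hρ hρ' φ φ'
    rw [← e, ← e'] at this
    refine (this.trans (ENNReal.ofReal_le_ofReal ?_)).trans_lt hδε
    linarith

theorem exists_vertex : ∃ p : FlatCompletion (Surface T),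
    Tendsto toCompletion (vertexFilter i c) (𝓝 p) :=
  CompleteSpace.complete (hc.cauchy_vertexFilter.map
    (UniformSpace.Completion.uniformContinuous_coe (FlatMetric (Surface T))))

omit hc in
open Classical in
/-- The distance to the boundary of the cone. -/
def _root_.KZ.depth (i : Fin 3) (c : reflGroup T × Fin 3 × Fin 3) (r : ℝ) (s : Surface T) : ℝ :=
  if s ∈ patch {i}ᶜ (range (copy c)) then max 0 (r - ‖foldMap T s - T.points i‖) else 0

omit hc in
theorem depth_nonneg (s : Surface T) : 0 ≤ depth i c r s := by
  unfold depth
  split_ifs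
  exacts [le_max_left _ _, le_rfl]

omit hc in
theorem depth_pos_iff {s : Surface T} : 0 < depth i c r s ↔
    s ∈ patch {i}ᶜ (range (copy c)) ∧ ‖foldMap T s - T.points i‖ < r := by
  unfold depth
  split_ifs with h <;> simp [h]

omit hc in
theorem depth_eq {s : Surface T} (h : 0 < depth i c r s) :
    depth i c r s = r - ‖foldMap T s - T.points i‖ := by
  obtain ⟨h1, h2⟩ := depth_pos_iff.1 h
  rw [depth, if_pos h1, max_eq_right (by linarith)]

/-- A path shorter than the depth of its start crosses only sides through the vertex, so it stays in
the patch and folding bounds the change. Depth therefore extends to the completion, where its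
positivity isolates the cone. -/
theorem depth_sub_le {p q : Surface T} {L : ℝ} (h : PolygonalPath (Surface T) p q L) :
    depth i c r p - depth i c r q ≤ L := by
  have hL := h.nonneg
  have hq0 := depth_nonneg (i := i) (c := c) (r := r) q
  by_cases hlt : L < depth i c r p
  · have hpos := hL.trans_lt hlt
    have hp := depth_eq hpos
    have hq : q ∈ patch {i}ᶜ (range (copy c)) := by
      refine PolygonalPath.mem_patch hc.stable_range_copy h (fun y hy hyL => ?_)
        (depth_pos_iff.1 hpos).1
      refine hc.mem_region_of_norm_lt hy ?_
      calc _ = ‖(y - foldMap T p) + (foldMap T p - T.points i)‖ := by congr 1; abel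
        _ ≤ _ := norm_add_le _ _
        _ < r := by linarith
    have h1 : r - ‖foldMap T q - T.points i‖ ≤ depth i c r q := by
      rw [depth, if_pos hq]
      exact le_max_right _ _
    have h2 := norm_foldMap_sub_le h
    have h3 : ‖foldMap T q - T.points i‖ ≤
        ‖foldMap T q - foldMap T p‖ + ‖foldMap T p - T.points i‖ := by
      rw [← sub_add_sub_cancel (foldMap T q) (foldMap T p)]
      exact norm_add_le _ _
    linarith
  · linarith

theorem uniformContinuous_depth :
    UniformContinuous (α := FlatMetric (Surface T)) (depth i c r) := by
  refine uniformContinuous_of_polygonalPath fun p q L h => ?_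
  rw [Real.norm_eq_abs, abs_le]
  constructor
  · linarith [hc.depth_sub_le h]
  · exact hc.depth_sub_le h.reverse

section vertex

variable {p : FlatCompletion (Surface T)} (hp : Tendsto toCompletion (vertexFilter i c) (𝓝 p))
include hp

theorem foldBar_vertex : foldBar T p = T.points i := by
  have := (hc.tendsto_coneMap_vertexFilter 0).neBot
  refine tendsto_nhds_unique ((continuous_foldBar.tendsto p).comp hp) ?_
  exact (tendsto_comap.mono_left inf_le_left).congr fun s => (foldBar_toCompletion s).symm

/-- The extended depth equals `r` at the vertex, so its positivity set is a neighbourhood. Each of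
its points is either the vertex or a point of the surface lying in the cone. -/
theorem mem_nhds_vertex :
    insert p ((fun a => toCompletion (coneMap i c β θ a)) '' (Ioo 0 r ×ˢ univ)) ∈ 𝓝 p := by
  have hne := (hc.tendsto_coneMap_vertexFilter 0).neBot
  set f := UniformSpace.Completion.extension (α := FlatMetric (Surface T)) (depth i c r) with hf
  have hfc : Continuous f := UniformSpace.Completion.continuous_extension
  have hfs : ∀ s : Surface T, f (toCompletion s) = depth i c r s :=
    extension_toCompletion hc.uniformContinuous_depth
  have hfp : f p = r := by
    refine tendsto_nhds_unique ((hfc.tendsto p).comp hp) ?_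
    have h1 : Tendsto (foldMap T) (vertexFilter i c) (𝓝 (T.points i)) :=
      tendsto_comap.mono_left inf_le_left
    have h2 := (h1.sub_const (T.points i)).norm.const_sub r
    rw [sub_self, norm_zero, sub_zero] at h2
    refine h2.congr' ?_
    filter_upwards [eventually_vertexFilter hc.radius_pos] with s hs
    rw [Function.comp_apply, hfs, depth_eq (depth_pos_iff.2 hs)]
  have hV : {y | 0 < f y} ∈ 𝓝 p :=
    (isOpen_lt continuous_const hfc).mem_nhds (by rw [mem_ofPred_eq, hfp]; exact hc.radius_pos)
  refine mem_of_superset hV fun y hy => ?_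
  have hy : 0 < f y := hy
  set l : Filter (Surface T) := comap toCompletion (𝓝 y)
  have hl : l.NeBot :=
    (UniformSpace.Completion.isDenseInducing_coe (α := FlatMetric (Surface T))).comap_nhds_neBot y
  have htl : Tendsto (toCompletion (S := Surface T)) l (𝓝 y) := tendsto_comap
  have hpos : ∀ᶠ s in l, 0 < depth i c r s := by
    filter_upwards [((hfc.tendsto y).comp htl).eventually (lt_mem_nhds hy)] with s hs
    rwa [Function.comp_apply, hfs] at hs
  have hF : Tendsto (foldMap T) l (𝓝 (foldBar T y)) :=
    ((continuous_foldBar.tendsto y).comp htl).congr fun s => foldBar_toCompletion s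
  have hfy : f y = r - ‖foldBar T y - T.points i‖ := by
    refine tendsto_nhds_unique ((hfc.tendsto y).comp htl) ?_
    refine ((hF.sub_const (T.points i)).norm.const_sub r).congr' ?_
    filter_upwards [hpos] with s hs
    rw [Function.comp_apply, hfs, depth_eq hs]
  -- Over the vertex, the filter approaching `y` refines `vertexFilter`, and uniqueness of limits
  -- gives `y = p`.
  by_cases hyi : foldBar T y = T.points i
  · left
    refine tendsto_nhds_unique htl (hp.mono_left ?_)
    rw [hyi] at hF
    refine le_inf (tendsto_iff_comap.1 hF) (le_principal_iff.2 ?_)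
    filter_upwards [hpos] with s hs using (depth_pos_iff.1 hs).1
  · right
    -- Another vertex is at distance at least 2r from the `i`-th one, which contradicts positive
    -- depth.
    have hmem : foldBar T y ∈ punctured T := by
      by_contra hcon
      obtain ⟨j, hj⟩ := exists_eq_points (bary_foldBar_nonneg y) hcon
      have hji : j ≠ i := fun h => hyi (h ▸ hj)
      have h1 := hc.radius_le j hji
      have h2 := mul_le_mul_of_nonneg_right (Real.sin_le_one θ) (norm_nonneg (T.points j - T.points i))
      have h3 := hc.radius_pos
      rw [hfy, hj] at hy
      linarith
    obtain ⟨s, rfl⟩ := mem_range_of_foldBar_mem hmem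
    rw [hfs, depth_pos_iff] at hy
    obtain ⟨hρ, φ, e⟩ := hc.exists_coneMap_eq hy.1 hy.2
    exact ⟨_, ⟨hρ, mem_univ φ⟩, congrArg _ e.symm⟩

/-- Degree 0 encodes infinite angle: the period 2π·0 vanishes, so only equal angles are identified.
-/
theorem isConeParam (hirr : ∀ m n : ℤ, m * θ = n * Real.pi → m = 0) :
    IsConeParam (Surface T) p 0 r (coneMap i c β θ) where
  radius_pos := hc.radius_pos
  continuousOn q hq := (hc.continuousAt_and_flat hq).1.continuousWithinAt
  flat q hq := (hc.continuousAt_and_flat hq).2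
  eq_iff q hq q' hq' := by
    constructor
    · intro h
      have := hc.coneMap_injOn hirr hq.1 hq'.1 h
      exact ⟨this.1, 0, by rw [this.2]; simp⟩
    · rintro ⟨h1, n, h2⟩
      rw [Nat.cast_zero, mul_zero, mul_zero, sub_eq_zero] at h2
      rw [Prod.ext h1 h2]
  tendsto φ := hp.comp (hc.tendsto_coneMap_vertexFilter φ)
  mem_nhds := hc.mem_nhds_vertex hp

theorem vertex_mem_coneSingularities (hirr : ∀ m n : ℤ, m * θ = n * Real.pi → m = 0) :
    p ∈ coneSingularities (Surface T) := by
  refine ⟨fun h => ?_, 0, r, _, hc.isConeParam hp hirr⟩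
  rw [range_toCompletion, mem_preimage, hc.foldBar_vertex hp] at h
  exact points_notMem_punctured i h

end vertex

end IsCone

end KZ

namespace KZ

variable {T : Affine.Triangle ℝ ℂ} {g h : reflGroup T} {i j k a b : Fin 3} {x y z : ℂ}
  {c : reflGroup T × Fin 3 × Fin 3} {β θ r ρ φ ρ' φ' : ℝ}

/-! ## Saddle connections along the sides -/

/-- An unoriented angle does not tell which vector comes first counterclockwise, hence the two
alternatives. -/
theorem exists_ray_of_angle {x y : ℂ} (hx : x ≠ 0) (hy : y ≠ 0)
    (h : InnerProductGeometry.angle x y = θ) : ∃ β : ℝ,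
      (x = ‖x‖ * Complex.exp (β * Complex.I) ∧ y = ‖y‖ * Complex.exp ((β + θ : ℝ) * Complex.I)) ∨
      (y = ‖y‖ * Complex.exp (β * Complex.I) ∧ x = ‖x‖ * Complex.exp ((β + θ : ℝ) * Complex.I)) := by
  have key : ∀ u w : ℂ, u ≠ 0 → w ≠ 0 → (w / u).arg = θ →
      u = ‖u‖ * Complex.exp (u.arg * Complex.I) ∧
        w = ‖w‖ * Complex.exp ((u.arg + θ : ℝ) * Complex.I) := by
    intro u w hu hw h
    have h1 := Complex.norm_mul_exp_arg_mul_I u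
    have h2 := Complex.norm_mul_exp_arg_mul_I (w / u)
    refine ⟨h1.symm, ?_⟩
    rw [h, norm_div, Complex.ofReal_div] at h2
    have hn : (‖u‖ : ℂ) ≠ 0 := Complex.ofReal_ne_zero.2 (norm_ne_zero_iff.2 hu)
    push_cast
    rw [add_mul, Complex.exp_add]
    have h3 : (‖w‖ : ℂ) * Complex.exp (θ * Complex.I) = w / u * ‖u‖ := by
      rw [← h2]
      field_simp
    calc w = (w / u) * u := (div_mul_cancel₀ w hu).symm
      _ = (w / u) * (‖u‖ * Complex.exp (u.arg * Complex.I)) := by rw [h1]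
      _ = _ := by linear_combination -Complex.exp (u.arg * Complex.I) * h3
  rw [Complex.angle_eq_abs_arg hx hy] at h
  rcases le_or_gt 0 (x / y).arg with h0 | h0
  · rw [abs_of_nonneg h0] at h
    exact ⟨y.arg, .inr (key y x hy hx h)⟩
  · rw [abs_of_neg h0] at h
    refine ⟨x.arg, .inl (key x y hx hy ?_)⟩
    rw [← h, ← inv_div, Complex.arg_inv, if_neg]
    intro hpi
    linarith [Real.pi_pos]

theorem exists_isCone (g : reflGroup T) (hab : a ≠ b) (ha : a ≠ i) (hb : b ≠ i)
    (h : EuclideanGeometry.angle (T.points a) (T.points i) (T.points b) = θ) (h0 : 0 < θ)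
    (hπ : θ < Real.pi) : ∃ c β r, c.1 = g ∧ IsCone T i c β θ r := by
  have hsec : ∃ c β, c.1 = g ∧ IsSector T i c β θ := by
    have h1 : InnerProductGeometry.angle ((g : ℂ ≃ₗᵢ[ℝ] ℂ) (T.points a - T.points i))
        ((g : ℂ ≃ₗᵢ[ℝ] ℂ) (T.points b - T.points i)) = θ := by
      rw [← h, EuclideanGeometry.angle, vsub_eq_sub, vsub_eq_sub]
      exact LinearIsometry.angle_map (g : ℂ ≃ₗᵢ[ℝ] ℂ).toLinearIsometry _ _
    have hg : ∀ j, j ≠ i → (g : ℂ ≃ₗᵢ[ℝ] ℂ) (T.points j - T.points i) ≠ 0 := fun j hj =>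
      (map_ne_zero_iff _ (g : ℂ ≃ₗᵢ[ℝ] ℂ).injective).2 (points_sub_ne_zero hj)
    obtain ⟨β, ⟨h2, h3⟩ | ⟨h2, h3⟩⟩ := exists_ray_of_angle (hg a ha) (hg b hb) h1
    · rw [LinearIsometryEquiv.norm_map] at h2 h3
      exact ⟨(g, a, b), β, rfl, hab, ha, hb, h2, h3⟩
    · rw [LinearIsometryEquiv.norm_map] at h2 h3
      exact ⟨(g, b, a), β, rfl, hab.symm, hb, ha, h2, h3⟩
  obtain ⟨c, β, hcg, hc⟩ := hsec
  have hs := Real.sin_pos_of_pos_of_lt_pi h0 hπ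
  have hpos : ∀ j, j ≠ i → 0 < Real.sin θ * ‖T.points j - T.points i‖ := fun j hj =>
    mul_pos hs (norm_pos_iff.2 (points_sub_ne_zero hj))
  -- Half the smaller of the two bounds on 2r.
  refine ⟨c, β, min (Real.sin θ * ‖T.points a - T.points i‖)
    (Real.sin θ * ‖T.points b - T.points i‖) / 2, hcg, hc, h0, hπ, ?_, ?_⟩
  · exact half_pos (lt_min (hpos a ha) (hpos b hb))
  · intro j hj
    have : j = a ∨ j = b := by omega
    rw [mul_div_cancel₀ _ (two_ne_zero)]
    rcases this with rfl | rfl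
    exacts [min_le_left _ _, min_le_right _ _]

theorem side_point_mem (hji : j ≠ i) {t : ℝ} (ht : t ∈ Ioo (0 : ℝ) 1) :
    ∃ k, k ≠ i ∧ k ≠ j ∧ T.points i + (t : ℂ) * (T.points j - T.points i) ∈ side T k := by
  obtain ⟨k, hki, hkj⟩ : ∃ k, k ≠ i ∧ k ≠ j := by
    clear ht; revert i j; decide
  refine ⟨k, hki, hkj, ?_, fun l hl => ?_⟩
  · rw [bary_segment, bary_points, bary_points, if_neg hki, if_neg hkj]
    ring
  · rw [bary_segment, bary_points, bary_points]
    have : l = i ∨ l = j := by omega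
    rcases this with rfl | rfl
    · rw [if_pos rfl, if_neg hji.symm]
      linarith [ht.2]
    · rw [if_pos rfl, if_neg hji]
      linarith [ht.1]

theorem side_point_mem_punctured (hji : j ≠ i) {t : ℝ} (ht : t ∈ Ioo (0 : ℝ) 1) :
    T.points i + (t : ℂ) * (T.points j - T.points i) ∈ punctured T := by
  obtain ⟨k, _, _, hk⟩ := side_point_mem (T := T) hji ht
  exact mem_punctured_of_mem (.inr hk)

theorem side_point_mem_region (hji : j ≠ i) {t : ℝ} (ht : t ∈ Ioo (0 : ℝ) 1) :
    T.points i + (t : ℂ) * (T.points j - T.points i) ∈ region T {i}ᶜ := by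
  obtain ⟨k, hk, _, h⟩ := side_point_mem (T := T) hji ht
  exact .inr ⟨k, hk, h⟩

variable (T) in
/-- The open `i`-`j` side of the copy `g`, parametrized at constant speed. -/
def sidePath (g : reflGroup T) (i j : Fin 3) (t : ℝ) : Surface T :=
  pt T g (T.points i + (t : ℂ) * (T.points j - T.points i))

theorem isGeodesicOn_sidePath (g : reflGroup T) (hji : j ≠ i) :
    IsGeodesicOn (Surface T) (sidePath T g i j)
      ((g : ℂ ≃ₗᵢ[ℝ] ℂ) (T.points j - T.points i)) (Ioo 0 1) :=
  isGeodesicOn_pt g fun _ ht => side_point_mem_punctured hji ht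

theorem sidePath_symm (g : reflGroup T) (i j : Fin 3) (t : ℝ) :
    sidePath T g i j t = sidePath T g j i (1 - t) := by
  unfold sidePath
  congr 1
  push_cast
  ring

theorem tendsto_sidePath_vertexFilter (hji : j ≠ i) :
    Tendsto (sidePath T c.1 i j) (𝓝[>] 0) (vertexFilter i c) := by
  have hev : ∀ᶠ t in 𝓝[>] (0 : ℝ), t ∈ Ioo (0 : ℝ) 1 := Ioo_mem_nhdsGT one_pos
  refine tendsto_inf.2 ⟨tendsto_comap_iff.2 ?_, tendsto_principal.2 ?_⟩
  · have h1 : Continuous fun t : ℝ => T.points i + (t : ℂ) * (T.points j - T.points i) := by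
      fun_prop
    have h2 := (h1.tendsto 0).mono_left (nhdsWithin_le_nhds (s := Ioi 0))
    rw [Complex.ofReal_zero, zero_mul, add_zero] at h2
    refine h2.congr' ?_
    filter_upwards [hev] with t ht
    exact (foldMap_pt _ (side_point_mem_punctured hji ht)).symm
  · filter_upwards [hev] with t ht
    exact ⟨c.1, ⟨0, rfl⟩, _, side_point_mem_region hji ht, rfl⟩

theorem tendsto_one_sub : Tendsto (fun t : ℝ => 1 - t) (𝓝[<] 1) (𝓝[>] 0) := by
  refine tendsto_nhdsWithin_iff.2 ⟨?_, ?_⟩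
  · have : Continuous fun t : ℝ => 1 - t := by fun_prop
    simpa using (this.tendsto 1).mono_left (nhdsWithin_le_nhds (s := Iio 1))
  · filter_upwards [self_mem_nhdsWithin] with t ht
    exact mem_Ioi.2 (sub_pos.2 (mem_Iio.1 ht))

/-! ## Developing around a vertex -/

variable (T) in
/-- The developing map which sends the `i`-th vertex to the origin. -/
def coneDev (i : Fin 3) (s : Surface T) : ℂ :=
  ((exists_pt s).choose : ℂ ≃ₗᵢ[ℝ] ℂ) (foldMap T s - T.points i)

theorem linRefl_sub_point (hk : k ≠ i) (x : ℂ) :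
    linRefl T k (x - T.points i) = sideRefl T k x - T.points i := by
  rw [← sideRefl_sub, sideRefl_point hk]

/-- The arbitrary choice of copy does not matter on this region: another copy containing `x` is
reached through a side containing both `x` and the vertex, and that reflection fixes both. -/
theorem coneDev_pt (g : reflGroup T) (hx : x ∈ region T {i}ᶜ) :
    coneDev T i (pt T g x) = (g : ℂ ≃ₗᵢ[ℝ] ℂ) (x - T.points i) := by
  have hxp := region_subset_punctured hx
  unfold coneDev
  rw [foldMap_pt g hxp]
  obtain ⟨y, hy, e⟩ := (exists_pt (pt T g x)).choose_spec
  generalize (exists_pt (pt T g x)).choose = h at e ⊢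
  obtain ⟨rfl, rfl | ⟨k, hk, rfl⟩⟩ := (pt_eq_pt_iff hy hxp).1 e
  · rfl
  · have hki : k ≠ i := by
      rcases hx with hx | ⟨l, hl, hx⟩
      · exact absurd hk (inner_not_side T hx k)
      · rw [side_inj T hk hx]
        exact hl
    rw [coe_mul_gen_apply, linRefl_sub_point hki, sideRefl_eq_self T k hk.1]

theorem coneDev_param (g : reflGroup T) (hk : k ≠ i) (hz : z ∈ kite T k) :
    coneDev T i (param T g k z) = (g : ℂ ≃ₗᵢ[ℝ] ℂ) (z - T.points i) := by
  have hreg : fold T k z ∈ region T {i}ᶜ := (fold_mem_inner_union_side hz).imp id fun h => ⟨k, hk, h⟩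
  rw [param_eq_pt g hz, coneDev_pt _ hreg, sheet, fold]
  split_ifs
  · rfl
  · rw [coe_mul_gen_apply, linRefl_sub_point hk, sideRefl_sideRefl]

theorem exists_param_of_mem_region (g : reflGroup T) (hx : x ∈ region T {i}ᶜ) :
    ∃ k, k ≠ i ∧ x ∈ kite T k ∧ pt T g x = param T g k x := by
  rcases hx with hx | ⟨k, hk, hx⟩
  · obtain ⟨k, hk⟩ : ∃ k, k ≠ i := exists_ne i
    exact ⟨k, hk, .inl hx, (param_eq_pt_of_mem g (.inl hx)).symm⟩
  · exact ⟨k, hk, .inr (.inl hx), (param_eq_pt_of_mem g (.inr hx)).symm⟩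

theorem coneDev_local (g : reflGroup T) (hx : x ∈ region T {i}ᶜ) :
    ∃ e ∈ atlas ℂ (Surface T), pt T g x ∈ e.source ∧
      ∀ᶠ s in 𝓝 (pt T g x), e s - coneDev T i s = e (pt T g x) - coneDev T i (pt T g x) := by
  obtain ⟨k, hk, hxk, e⟩ := exists_param_of_mem_region g hx
  rw [e]
  refine ⟨echart T g k, echart_mem_atlas T g k, param_mem_source hxk, eventually_param hxk ?_⟩
  filter_upwards [(kite_isOpen T k).mem_nhds hxk] with w hw
  rw [echart_param hw, echart_param hxk, coneDev_param g hk hw, coneDev_param g hk hxk, map_sub,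
    map_sub]
  ring

theorem continuousAt_coneDev (g : reflGroup T) (hx : x ∈ region T {i}ᶜ) :
    ContinuousAt (coneDev T i) (pt T g x) := by
  obtain ⟨e, _, hs, hev⟩ := coneDev_local g hx
  have h1 : ContinuousAt (fun s => e s - (e (pt T g x) - coneDev T i (pt T g x))) (pt T g x) :=
    (e.continuousAt hs).sub continuousAt_const
  refine h1.congr ?_
  filter_upwards [hev] with s hs
  rw [← hs]
  ring

/-- There is a local developing map on the union of a vertex and of the copies of the triangle
around it, without the opposite sides. -/
theorem IsCone.exists_isLocalDev (hc : IsCone T i c β θ r) {p : FlatCompletion (Surface T)}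
    (hp : Tendsto toCompletion (vertexFilter i c) (𝓝 p)) : ∃ U z, IsLocalDev (Surface T) U z ∧
      p ∈ U ∧ z p = 0 ∧ ∀ x ∈ region T {i}ᶜ, toCompletion (pt T c.1 x) ∈ U ∧
        z (toCompletion (pt T c.1 x)) = (c.1 : ℂ ≃ₗᵢ[ℝ] ℂ) (x - T.points i) := by
  set P : Set (Surface T) := patch {i}ᶜ (range (copy c)) with hP
  have hPo : IsOpen (toCompletion '' P) :=
    isOpenEmbedding_toCompletion.isOpenMap _ (isOpen_patch hc.stable_range_copy)
  set U : Set (FlatCompletion (Surface T)) := insert p (toCompletion '' P) with hU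
  -- The default value 0 is used: the apex is not in the surface and must develop to the origin.
  set z : FlatCompletion (Surface T) → ℂ := Function.extend toCompletion (coneDev T i) 0 with hz
  have hzs : ∀ s, z (toCompletion s) = coneDev T i s :=
    fun s => toCompletion_injective.extend_apply _ _ s
  have hpr : p ∉ range (toCompletion (S := Surface T)) := fun h => by
    rw [range_toCompletion, mem_preimage, hc.foldBar_vertex hp] at h
    exact points_notMem_punctured i h
  have hzp : z p = 0 := Function.extend_apply' _ _ _ hpr
  have hUp : U ∈ 𝓝 p := by
    refine mem_of_superset (hc.mem_nhds_vertex hp) (insert_subset_insert ?_)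
    rintro _ ⟨q, hq, rfl⟩
    exact ⟨_, hc.coneMap_mem_patch hq.1 q.2, rfl⟩
  have hUo : IsOpen U := by
    rw [isOpen_iff_mem_nhds]
    rintro y (rfl | hy)
    · exact hUp
    · exact mem_of_superset (hPo.mem_nhds hy) (subset_insert _ _)
  -- The developing map has the same modulus as the continuous folding map centred at the vertex,
  -- which gives continuity at the apex.
  have hzn : ∀ y ∈ U, ‖z y‖ = ‖foldBar T y - T.points i‖ := by
    rintro y (rfl | ⟨_, ⟨g, _, x, hx, rfl⟩, rfl⟩)
    · rw [hzp, hc.foldBar_vertex hp]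
      simp
    · rw [hzs, foldBar_toCompletion, coneDev_pt g hx, foldMap_pt g (region_subset_punctured hx),
        LinearIsometryEquiv.norm_map]
  have hmemP : ∀ s, toCompletion s ∈ U → s ∈ P := by
    rintro s (hs | ⟨s', hs', e⟩)
    · exact absurd ⟨s, hs⟩ hpr
    · rwa [← toCompletion_injective e]
  refine ⟨U, z, ⟨hUo, ?_, ?_⟩, mem_insert _ _, hzp, fun x hx => ⟨?_, ?_⟩⟩
  · intro y hy
    refine ContinuousAt.continuousWithinAt ?_
    rcases hy with rfl | ⟨_, ⟨g, _, x, hx, rfl⟩, rfl⟩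
    · rw [ContinuousAt, hzp, tendsto_zero_iff_norm_tendsto_zero]
      have h1 : Continuous fun y => ‖foldBar T y - T.points i‖ :=
        (continuous_foldBar.sub continuous_const).norm
      have h2 := h1.tendsto y
      rw [hc.foldBar_vertex hp, sub_self, norm_zero] at h2
      refine h2.congr' ?_
      filter_upwards [hUp] with w hw using (hzn w hw).symm
    · rw [← isOpenEmbedding_toCompletion.continuousAt_iff]
      have : z ∘ toCompletion = coneDev T i := funext hzs
      rw [this]
      exact continuousAt_coneDev g hx
  · intro s hs
    obtain ⟨g, _, x, hx, rfl⟩ := hmemP s hs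
    simp only [hzs]
    exact coneDev_local g hx
  · exact .inr ⟨_, ⟨c.1, ⟨0, rfl⟩, x, hx, rfl⟩, rfl⟩
  · rw [hzs, coneDev_pt _ hx]

/-! ## Holonomy vectors of the sides -/

theorem exists_path_extending {X : Type} [TopologicalSpace X] [T3Space X] {f : ℝ → X} {p q : X}
    (hf : ContinuousOn f (Ioo 0 1)) (h0 : Tendsto f (𝓝[>] 0) (𝓝 p))
    (h1 : Tendsto f (𝓝[<] 1) (𝓝 q)) : ∃ σ : C(unitInterval, X), σ 0 = p ∧ σ 1 = q ∧
      ∀ t : unitInterval, (t : ℝ) ∈ Ioo (0 : ℝ) 1 → σ t = f t :=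
  ⟨⟨fun t => extendFrom (Ioo (0 : ℝ) 1) f t,
    (continuousOn_Icc_extendFrom_Ioo hf h0 h1).comp_continuous continuous_subtype_val
      fun t => t.2⟩, eq_lim_at_left_extendFrom_Ioo one_pos h0,
    eq_lim_at_right_extendFrom_Ioo one_pos h1,
    fun t ht => extendFrom_eq (subset_closure ht) (hf t ht)⟩

section side

variable {β' θ' r' : ℝ} {c' : reflGroup T × Fin 3 × Fin 3}

theorem tendsto_sidePath_right {q : FlatCompletion (Surface T)} (hji : j ≠ i) (hcc : c.1 = c'.1)
    (hq : Tendsto toCompletion (vertexFilter j c') (𝓝 q)) :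
    Tendsto (fun t => toCompletion (sidePath T c.1 i j t)) (𝓝[<] 1) (𝓝 q) := by
  refine ((hq.comp (tendsto_sidePath_vertexFilter hji.symm)).comp tendsto_one_sub).congr fun t => ?_
  simp only [Function.comp_apply]
  rw [sidePath_symm c.1 i j, hcc]

variable (hc : IsCone T i c β θ r) (hc' : IsCone T j c' β' θ' r') (hji : j ≠ i) (hcc : c.1 = c'.1)
include hc hc' hji hcc

/-- The curve is δ(t) = tv. The developing map at the initial vertex reads tv for t < 1, the one at
the final vertex reads (t − 1)v for t > 0, and both differ from δ by a constant. -/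
theorem hasHolonomy_side {p q : FlatCompletion (Surface T)}
    (hp : Tendsto toCompletion (vertexFilter i c) (𝓝 p))
    (hq : Tendsto toCompletion (vertexFilter j c') (𝓝 q))
    {σ : C(unitInterval, FlatCompletion (Surface T))} (h0 : σ 0 = p) (h1 : σ 1 = q)
    (hσ : ∀ t : unitInterval, (t : ℝ) ∈ Ioo (0 : ℝ) 1 → σ t = toCompletion (sidePath T c.1 i j t)) :
    HasHolonomy (Surface T) σ ((c.1 : ℂ ≃ₗᵢ[ℝ] ℂ) (T.points j - T.points i)) := by
  obtain ⟨U, z, hUz, hpU, hzp, hzx⟩ := hc.exists_isLocalDev hp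
  obtain ⟨U', z', hUz', hqU, hzq, hzx'⟩ := hc'.exists_isLocalDev hq
  have hz : ∀ t : unitInterval, (t : ℝ) < 1 → σ t ∈ U ∧
      z (σ t) = (t : ℝ) * (c.1 : ℂ ≃ₗᵢ[ℝ] ℂ) (T.points j - T.points i) := by
    intro t ht
    rcases t.2.1.eq_or_lt with ht0 | ht0
    · obtain rfl : t = 0 := Subtype.ext ht0.symm
      rw [h0]
      exact ⟨hpU, by simp [hzp]⟩
    · rw [hσ t ⟨ht0, ht⟩]
      have := hzx _ (side_point_mem_region hji ⟨ht0, ht⟩)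
      refine ⟨this.1, this.2.trans ?_⟩
      rw [add_sub_cancel_left, ← Complex.real_smul, map_smul, Complex.real_smul]
  have hz' : ∀ t : unitInterval, 0 < (t : ℝ) → σ t ∈ U' ∧
      z' (σ t) = ((t : ℝ) - 1) * (c.1 : ℂ ≃ₗᵢ[ℝ] ℂ) (T.points j - T.points i) := by
    intro t ht
    rcases t.2.2.eq_or_lt with ht1 | ht1
    · obtain rfl : t = 1 := Subtype.ext ht1
      rw [h1]
      exact ⟨hqU, by simp [hzq]⟩
    · rw [hσ t ⟨ht, ht1⟩, sidePath_symm, hcc]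
      have := hzx' _ (side_point_mem_region (T := T) hji.symm (t := 1 - t)
        ⟨by linarith, by linarith⟩)
      refine ⟨this.1, this.2.trans ?_⟩
      rw [add_sub_cancel_left, ← Complex.real_smul, map_smul, Complex.real_smul,
        ← neg_sub (T.points j), map_neg]
      push_cast
      ring
  refine ⟨fun t => (t : ℝ) * (c.1 : ℂ ≃ₗᵢ[ℝ] ℂ) (T.points j - T.points i), by simp, fun t => ?_⟩
  rcases t.2.2.eq_or_lt with ht1 | ht1
  · have ht0 : 0 < (t : ℝ) := by rw [ht1]; exact one_pos
    refine ⟨U', z', hUz', (hz' t ht0).1, ?_⟩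
    have hev : ∀ᶠ s : unitInterval in 𝓝 t, 0 < (s : ℝ) :=
      continuous_subtype_val.continuousAt.eventually (lt_mem_nhds ht0)
    filter_upwards [hev] with s hs
    rw [(hz' s hs).2, (hz' t ht0).2]
    ring
  · refine ⟨U, z, hUz, (hz t ht1).1, ?_⟩
    have hev : ∀ᶠ s : unitInterval in 𝓝 t, (s : ℝ) < 1 :=
      continuous_subtype_val.continuousAt.eventually (gt_mem_nhds ht1)
    filter_upwards [hev] with s hs
    rw [(hz s hs).2, (hz t ht1).2]
    ring

variable (hirr : ∀ m n : ℤ, m * θ = n * Real.pi → m = 0)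
  (hirr' : ∀ m n : ℤ, m * θ' = n * Real.pi → m = 0)
include hirr hirr'

theorem side_mem_saddleVectors :
    (c.1 : ℂ ≃ₗᵢ[ℝ] ℂ) (T.points j - T.points i) ∈ saddleVectors (Surface T) := by
  obtain ⟨p, hp⟩ := hc.exists_vertex
  obtain ⟨q, hq⟩ := hc'.exists_vertex
  exact ⟨(map_ne_zero_iff _ (c.1 : ℂ ≃ₗᵢ[ℝ] ℂ).injective).2 (points_sub_ne_zero hji),
    sidePath T c.1 i j, isGeodesicOn_sidePath _ hji, p, hc.vertex_mem_coneSingularities hp hirr, q,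
    hc'.vertex_mem_coneSingularities hq hirr', hp.comp (tendsto_sidePath_vertexFilter hji),
    tendsto_sidePath_right hji hcc hq⟩

theorem side_mem_relativeHolonomy :
    (c.1 : ℂ ≃ₗᵢ[ℝ] ℂ) (T.points j - T.points i) ∈ relativeHolonomy (Surface T) := by
  classical
  obtain ⟨p, hp⟩ := hc.exists_vertex
  obtain ⟨q, hq⟩ := hc'.exists_vertex
  obtain ⟨σ, h0, h1, hσ⟩ := exists_path_extending
    (continuous_toCompletion.comp_continuousOn (isGeodesicOn_sidePath c.1 hji).1)
    (hp.comp (tendsto_sidePath_vertexFilter hji)) (tendsto_sidePath_right hji hcc hq)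
  refine ⟨Finsupp.single σ 1, fun _ => (c.1 : ℂ ≃ₗᵢ[ℝ] ℂ) (T.points j - T.points i),
    fun x hx => ?_, fun σ' hσ' => ?_, by simp⟩
  · have hb : chainBoundary (Finsupp.single σ 1) = Finsupp.single q 1 - Finsupp.single p 1 := by
      rw [chainBoundary, Finsupp.sum_single_index (by simp), h0, h1]
    rw [hb] at hx
    rcases Finset.mem_union.1 (Finsupp.support_sub hx) with h | h
    · rw [Finset.mem_singleton.1 (Finsupp.support_single_subset h)]
      exact hc'.vertex_mem_coneSingularities hq hirr'
    · rw [Finset.mem_singleton.1 (Finsupp.support_single_subset h)]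
      exact hc.vertex_mem_coneSingularities hp hirr
  · rw [Finset.mem_singleton.1 (Finsupp.support_single_subset hσ')]
    exact hasHolonomy_side hc hc' hji hcc hp hq h0 h1 hσ

end side

end KZ

namespace KZ

variable {T : Affine.Triangle ℝ ℂ} {g h : reflGroup T} {i j k a b : Fin 3} {x y z : ℂ}
  {c : reflGroup T × Fin 3 × Fin 3} {β θ r ρ φ ρ' φ' : ℝ}

/-! ## The action of the group on the surface -/

variable (T) in
/-- Left multiplication on the set of copies. -/
def leftMul (h : reflGroup T) : Surface T → Surface T :=
  Quotient.map (fun a : reflGroup T × punctured T => (h * a.1, a.2)) <| by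
    -- The gluing multiplies by generators on the right, so it commutes with left multiplication.
    rintro ⟨g, x⟩ ⟨g', x'⟩ ⟨hx, hg⟩
    refine ⟨hx, hg.imp (congrArg (h * ·)) ?_⟩
    rintro ⟨i, hi, e⟩
    exact ⟨i, hi, by dsimp only at e ⊢; rw [e, mul_assoc]⟩

theorem leftMul_pt (h g : reflGroup T) (hx : x ∈ punctured T) :
    leftMul T h (pt T g x) = pt T (h * g) x := by
  rw [pt_eq _ hx, pt_eq _ hx]
  rfl

theorem leftMul_param (h g : reflGroup T) (hz : z ∈ kite T i) :
    leftMul T h (param T g i z) = param T (h * g) i z := by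
  rw [param_eq_pt g hz, param_eq_pt _ hz, leftMul_pt _ _ (fold_mem T hz)]
  unfold sheet
  split_ifs <;> simp [mul_assoc]

theorem leftMul_leftMul (h g : reflGroup T) (s : Surface T) :
    leftMul T h (leftMul T g s) = leftMul T (h * g) s := by
  obtain ⟨k, x, hx, rfl⟩ := exists_pt s
  rw [leftMul_pt _ _ hx, leftMul_pt _ _ hx, leftMul_pt _ _ hx, mul_assoc]

theorem leftMul_one (s : Surface T) : leftMul T 1 s = s := by
  obtain ⟨k, x, hx, rfl⟩ := exists_pt s
  rw [leftMul_pt _ _ hx, one_mul]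

theorem continuousAt_param (g : reflGroup T) (hz : z ∈ kite T i) :
    ContinuousAt (param T g i) z := by
  have h1 := (echart T g i).continuousAt_symm (apply_mem_echart_target (g := g) hz)
  have h2 := h1.comp_of_eq (g : ℂ ≃ₗᵢ[ℝ] ℂ).continuous.continuousAt rfl
  exact h2.congr (.of_forall fun w => echart_symm_apply' g i w)

theorem continuous_leftMul (h : reflGroup T) : Continuous (leftMul T h) := by
  rw [continuous_iff_continuousAt]
  intro s
  obtain ⟨g, i, z, hz, rfl⟩ := param_surj T s
  intro U hU
  rw [leftMul_param h g hz] at hU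
  refine eventually_param hz (P := fun s => leftMul T h s ∈ U) ?_
  filter_upwards [continuousAt_param (h * g) hz hU, (kite_isOpen T i).mem_nhds hz] with w hw hk
  rwa [leftMul_param h g hk]

variable (T) in
/-- Left multiplication as a homeomorphism. -/
def leftMulHomeo (h : reflGroup T) : Surface T ≃ₜ Surface T where
  toFun := leftMul T h
  invFun := leftMul T h⁻¹
  left_inv s := by rw [leftMul_leftMul, inv_mul_cancel, leftMul_one]
  right_inv s := by rw [leftMul_leftMul, mul_inv_cancel, leftMul_one]
  continuous_toFun := continuous_leftMul h
  continuous_invFun := continuous_leftMul h⁻¹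

/-- Between the charts of `g` and of `h * g` with the same kite, the map reads as the linear
isometry `h`. -/
theorem isAffineWith_leftMul (h : reflGroup T) :
    IsAffineWith (Surface T) (leftMulHomeo T h)
      (LinearMap.toMatrix Complex.basisOneI Complex.basisOneI
        ((h : ℂ ≃ₗᵢ[ℝ] ℂ).toLinearEquiv : ℂ →ₗ[ℝ] ℂ)) := by
  intro s
  obtain ⟨g, i, z, hz, rfl⟩ := param_surj T s
  have happ : ∀ s, leftMulHomeo T h s = leftMul T h s := fun _ => rfl
  refine ⟨echart T g i, echart_mem_atlas T g i, echart T (h * g) i, echart_mem_atlas T _ i,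
    param_mem_source hz, ?_, eventually_param hz ?_⟩
  · rw [happ, leftMul_param h g hz]
    exact param_mem_source hz
  · filter_upwards [(kite_isOpen T i).mem_nhds hz] with w hw
    rw [happ, happ, leftMul_param h g hz, leftMul_param h g hw, echart_param hz, echart_param hw,
      echart_param hz, echart_param hw, LinearMap.toMatrix_mulVec_repr]
    congr 2
    change _ = (h : ℂ ≃ₗᵢ[ℝ] ℂ) _
    rw [map_sub]
    rfl

theorem two_mul_cos_mem_Ktr {α : ℝ}
    (hα : ∀ z, (h : ℂ ≃ₗᵢ[ℝ] ℂ) z = Complex.exp (α * Complex.I) * z) :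
    2 * Real.cos α ∈ Ktr (Surface T) := by
  set A := LinearMap.toMatrix Complex.basisOneI Complex.basisOneI
        ((h : ℂ ≃ₗᵢ[ℝ] ℂ).toLinearEquiv : ℂ →ₗ[ℝ] ℂ) with hA
  have hent : A = !![Real.cos α, -Real.sin α; Real.sin α, Real.cos α] := by
    have h1 : ∀ z, ((h : ℂ ≃ₗᵢ[ℝ] ℂ).toLinearEquiv : ℂ →ₗ[ℝ] ℂ) z =
      Complex.exp (α * Complex.I) * z := hα
    ext m n
    rw [hA, LinearMap.toMatrix_apply, h1]
    fin_cases m <;> fin_cases n <;>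
      simp [Complex.exp_ofReal_mul_I_re, Complex.exp_ofReal_mul_I_im]
  refine Subfield.subset_closure ⟨A, ⟨?_, _, isAffineWith_leftMul h⟩, ?_⟩
  · rw [hent, Matrix.det_fin_two_of]
    have := Real.sin_sq_add_cos_sq α
    nlinarith
  · rw [hent, Matrix.trace_fin_two_of]
    ring

/-- The group contains the rotation by twice each angle of the triangle. -/
theorem IsSector.exists_rotation (hc : IsSector T i c β θ) (hc1 : c.1 = 1) :
    ∃ R : reflGroup T, ∀ z, (R : ℂ ≃ₗᵢ[ℝ] ℂ) z = Complex.exp ((2 * θ : ℝ) * Complex.I) * z := by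
  -- Turning twice restores the labels and advances both rays by 2θ. Starting from copy 1, the
  -- resulting linear part rotates both edge vectors at the vertex, which form a basis.
  have h2 := hc.next.next
  have hcc : turn T (turn T c) = ((turn T (turn T c)).1, c.2.1, c.2.2) := rfl
  rw [hcc] at h2
  refine ⟨(turn T (turn T c)).1, fun z => ?_⟩
  have hl := h2.left
  have hr := h2.right
  have hl0 := hc.left
  have hr0 := hc.right
  rw [hc1] at hl0 hr0
  change T.points c.2.1 - T.points i = _ at hl0
  change T.points c.2.2 - T.points i = _ at hr0
  dsimp only at hl hr
  have e1 : Complex.exp ((β + θ + θ : ℝ) * Complex.I) =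
      Complex.exp ((2 * θ : ℝ) * Complex.I) * Complex.exp (β * Complex.I) := by
    rw [← Complex.exp_add]
    congr 1
    push_cast
    ring
  have e2 : Complex.exp ((β + θ + θ + θ : ℝ) * Complex.I) =
      Complex.exp ((2 * θ : ℝ) * Complex.I) * Complex.exp ((β + θ : ℝ) * Complex.I) := by
    rw [← Complex.exp_add]
    congr 1
    push_cast
    ring
  rw [e1, mul_left_comm, ← hl0] at hl
  rw [e2, mul_left_comm, ← hr0] at hr
  have hz := eq_combination (T := T) hc.ne hc.ne_left hc.ne_right (T.points i + z)
  rw [add_right_inj] at hz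
  rw [hz, map_add, map_smul, map_smul, hl, hr, Complex.real_smul, Complex.real_smul,
    Complex.real_smul, Complex.real_smul]
  ring

theorem rotation_pow_apply {R : reflGroup T} {α : ℝ}
    (hR : ∀ z, (R : ℂ ≃ₗᵢ[ℝ] ℂ) z = Complex.exp (α * Complex.I) * z) (n : ℕ) (z : ℂ) :
    ((R ^ n : reflGroup T) : ℂ ≃ₗᵢ[ℝ] ℂ) z = Complex.exp ((n * α : ℝ) * Complex.I) * z := by
  induction n generalizing z with
  | zero => simp
  | succ n ih =>
    have : ((R ^ (n + 1) : reflGroup T) : ℂ ≃ₗᵢ[ℝ] ℂ) z =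
        ((R ^ n : reflGroup T) : ℂ ≃ₗᵢ[ℝ] ℂ) ((R : ℂ ≃ₗᵢ[ℝ] ℂ) z) := by
      rw [pow_succ]
      rfl
    rw [this, ih, hR, ← mul_assoc, ← Complex.exp_add]
    congr 2
    push_cast
    ring

end KZ

/-! ## Fields containing a transcendental number -/

theorem planeDet_rotate (v : ℂ) (α β : ℝ) :
    planeDet (Complex.exp (α * Complex.I) * v) (Complex.exp (β * Complex.I) * v) =
      Complex.normSq v * Real.sin (β - α) := by
  unfold planeDet
  simp only [Complex.mul_re, Complex.mul_im, Complex.exp_ofReal_mul_I_re,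
    Complex.exp_ofReal_mul_I_im, Complex.normSq_apply, Real.sin_sub]
  ring

theorem not_numberField_of_mem {K : Subfield ℝ} {x : ℝ} (hx : x ∈ K) (h : Transcendental ℚ x) :
    ¬ NumberField K := by
  intro hK
  have h1 : IsAlgebraic ℚ (⟨x, hx⟩ : K) := Algebra.IsAlgebraic.isAlgebraic _
  exact h (IsAlgebraic.algHom K.subtype.toRatAlgHom h1)

/-- For n = 0, 1, 2, 3 the determinants are |v|² times sines of differences of angles: 2α for the
pairs 02 and 13, α for 12, 3α for 03. -/
theorem crossRatio_mem_Kcr {S : Type} [TopologicalSpace S] [ChartedSpace ℂ S] {v : ℂ} {α : ℝ}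
    (hv : v ≠ 0) (hα : ∀ n : ℕ, 0 < n → Real.sin (n * α) ≠ 0)
    (h : ∀ n : ℕ, Complex.exp ((n * α : ℝ) * Complex.I) * v ∈ saddleVectors S) :
    Real.sin (2 * α) ^ 2 / (Real.sin α * Real.sin (3 * α)) ∈ Kcr S := by
  have hn : Complex.normSq v ≠ 0 := (map_ne_zero _).2 hv
  have hdet : ∀ m n : ℕ, planeDet (Complex.exp ((m * α : ℝ) * Complex.I) * v)
      (Complex.exp ((n * α : ℝ) * Complex.I) * v) = Complex.normSq v * Real.sin ((n - m) * α) := by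
    intro m n
    rw [planeDet_rotate, sub_mul]
  refine Subfield.subset_closure
    ⟨fun m => Complex.exp (((m : ℕ) * α : ℝ) * Complex.I) * v, fun m => h m, fun m n hmn => ?_, ?_⟩
  · dsimp only
    rw [hdet]
    refine mul_ne_zero hn ?_
    rcases lt_or_gt_of_ne (Fin.val_ne_of_ne hmn) with hlt | hlt
    · have := hα (n - m) (by omega)
      rwa [Nat.cast_sub hlt.le] at this
    · have := hα (m - n) (by omega)
      rw [Nat.cast_sub hlt.le] at this
      rwa [← neg_sub, neg_mul, Real.sin_neg, neg_ne_zero]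
  · unfold vectorCrossRatio
    rw [hdet, hdet, hdet, hdet]
    have h1 := hα 1 one_pos
    have h3 := hα 3 (by norm_num)
    simp only [Fin.val_zero, Fin.val_one, Fin.val_two, Nat.cast_zero, Nat.cast_one, Nat.cast_ofNat,
      show ((3 : Fin 4) : ℕ) = 3 from rfl] at h1 h3 ⊢
    norm_num at h1 h3 ⊢
    field_simp

/-- For every admissible `k` the `k`-rank equals a real dimension, at most 2, so the three vectors
with n = 0, 1, 2 satisfy a `k`-linear relation. By e^{2iα} = 2 cos α e^{iα} − 1, its imaginary part
expresses 2 cos α as a quotient in `k`. -/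
theorem two_mul_cos_mem_Ksc {S : Type} [TopologicalSpace S] [ChartedSpace ℂ S] {v : ℂ} {α : ℝ}
    (hv : v ≠ 0) (hα : Real.sin α ≠ 0)
    (h : ∀ n : ℕ, Complex.exp ((n * α : ℝ) * Complex.I) * v ∈ relativeHolonomy S) :
    2 * Real.cos α ∈ Ksc S := by
  rw [Ksc, Subfield.mem_sInf]
  intro k hk
  have hrank : Module.rank k (Submodule.span k (relativeHolonomy S)) ≤ 2 := by
    rw [hk]
    refine (Submodule.rank_le _).trans ?_
    rw [Complex.rank_real_complex]
  set w : Fin 3 → Submodule.span k (relativeHolonomy S) := fun n =>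
    ⟨Complex.exp (((n : ℕ) * α : ℝ) * Complex.I) * v, Submodule.subset_span (h n)⟩ with hw
  have hdep : ¬ LinearIndependent k w := by
    intro hli
    have := hli.cardinal_le_rank.trans hrank
    simp at this
    norm_num at this
  obtain ⟨t, ht, m, hm⟩ := Fintype.not_linearIndependent_iff.1 hdep
  rw [Fin.sum_univ_three] at ht
  have ht' := congrArg (Subtype.val : Submodule.span k (relativeHolonomy S) → ℂ) ht
  set e := Complex.exp (α * Complex.I) with he
  have e2 : Complex.exp ((2 * α : ℝ) * Complex.I) = 2 * Real.cos α * e - 1 := by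
    apply Complex.ext
    · simp only [Complex.sub_re, Complex.exp_ofReal_mul_I_re, Complex.one_re, he]
      rw [← Complex.ofReal_ofNat, ← Complex.ofReal_mul, Complex.re_ofReal_mul,
        Complex.exp_ofReal_mul_I_re, Real.cos_two_mul]
      ring
    · simp only [Complex.sub_im, Complex.exp_ofReal_mul_I_im, Complex.one_im, he]
      rw [← Complex.ofReal_ofNat, ← Complex.ofReal_mul, Complex.im_ofReal_mul,
        Complex.exp_ofReal_mul_I_im, Real.sin_two_mul]
      ring
  have ht2 : ((t 0 : ℝ) + (t 1 : ℝ) * e + (t 2 : ℝ) * (2 * Real.cos α * e - 1) : ℂ) = 0 := by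
    apply mul_right_cancel₀ hv
    rw [← e2, zero_mul]
    have h3 : (t 0 : ℝ) • (Complex.exp (((0 : ℕ) * α : ℝ) * Complex.I) * v) +
      (t 1 : ℝ) • (Complex.exp (((1 : ℕ) * α : ℝ) * Complex.I) * v) +
      (t 2 : ℝ) • (Complex.exp (((2 : ℕ) * α : ℝ) * Complex.I) * v) = 0 := ht'
    simp only [Complex.real_smul, Nat.cast_zero, zero_mul, Nat.cast_one, one_mul, Nat.cast_ofNat,
      Complex.ofReal_zero, Complex.exp_zero, ← he] at h3
    linear_combination h3
  have him := congrArg Complex.im ht2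
  have hre := congrArg Complex.re ht2
  simp [he, Complex.exp_ofReal_mul_I_im, Complex.exp_ofReal_mul_I_re, -Complex.ofReal_cos] at him hre
  have h1 : ((t 1 : ℝ) + t 2 * (2 * Real.cos α)) = 0 := by
    apply mul_right_cancel₀ hα
    linarith
  have h2 : (t 2 : ℝ) ≠ 0 := by
    intro h0
    have h1' : (t 1 : ℝ) = 0 := by rw [h0] at h1; linarith
    have h0' : (t 0 : ℝ) = 0 := by rw [h0, h1'] at hre; linarith
    apply hm
    fin_cases m
    exacts [Subtype.ext h0', Subtype.ext h1', Subtype.ext h0]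
  have h3 : 2 * Real.cos α = -(t 1 : ℝ) / t 2 := by
    field_simp
    linarith
  rw [h3]
  exact k.div_mem (k.neg_mem (t 1).2) (t 2).2

theorem transcendental_two_mul {x : ℝ} (h : Transcendental ℚ x) : Transcendental ℚ (2 * x) := by
  intro h2
  apply h
  have := (isAlgebraic_algebraMap (R := ℚ) (A := ℝ) (1 / 2)).mul h2
  simpa using this

theorem transcendental_crossRatio {α : ℝ} (h : Transcendental ℚ (Real.cos α))
    (h1 : Real.sin α ≠ 0) (h3 : Real.sin (3 * α) ≠ 0) :
    Transcendental ℚ (Real.sin (2 * α) ^ 2 / (Real.sin α * Real.sin (3 * α))) := by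
  have e3 : Real.sin (3 * α) = Real.sin α * (4 * Real.cos α ^ 2 - 1) := by
    rw [Real.sin_three_mul]
    linear_combination -4 * Real.sin α * Real.sin_sq_add_cos_sq α
  have hne : 4 * Real.cos α ^ 2 - 1 ≠ 0 := fun h0 => h3 (by rw [e3, h0, mul_zero])
  set y := Real.sin (2 * α) ^ 2 / (Real.sin α * Real.sin (3 * α)) with hy
  have hy1 : y - 1 = (4 * Real.cos α ^ 2 - 1)⁻¹ := by
    have hy2 : y = 4 * Real.cos α ^ 2 / (4 * Real.cos α ^ 2 - 1) := by
      rw [hy, e3, Real.sin_two_mul, div_eq_div_iff (mul_ne_zero h1 (mul_ne_zero h1 hne)) hne]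
      ring
    rw [hy2, div_sub_one hne, sub_sub_cancel, one_div]
  intro halg
  apply h
  have h4 : IsAlgebraic ℚ (4 * Real.cos α ^ 2 - 1) := by
    have := (halg.sub isAlgebraic_one).inv
    rwa [hy1, inv_inv] at this
  have h5 := (isAlgebraic_algebraMap (R := ℚ) (A := ℝ) (1 / 4)).mul (h4.add isAlgebraic_one)
  have h6 : (algebraMap ℚ ℝ) (1 / 4) * (4 * Real.cos α ^ 2 - 1 + 1) = Real.cos α ^ 2 := by
    rw [eq_ratCast]
    push_cast
    ring
  rw [h6] at h5
  exact IsAlgebraic.of_pow two_pos h5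

/-! ## Generic angles -/

/-- Angles which are commensurable to `π` or such that the cosine of their double is algebraic. -/
def exceptionalAngles : Set ℝ :=
  {x | IsAlgebraic ℚ (Real.cos (2 * x))} ∪ {x | ∃ m n : ℤ, m ≠ 0 ∧ m * x = n * Real.pi}

theorem countable_exceptionalAngles : exceptionalAngles.Countable := by
  refine Countable.union ?_ ?_
  · have hsub : {x : ℝ | IsAlgebraic ℚ (Real.cos (2 * x))} ⊆
        ⋃ y ∈ {y : ℝ | IsAlgebraic ℚ y}, {x : ℝ | Real.cos (2 * x) = y} := by
      intro x hx
      simp only [mem_iUnion]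
      exact ⟨_, hx, rfl⟩
    refine Countable.mono hsub ((Algebraic.countable ℚ ℝ).biUnion fun y _ => ?_)
    rcases eq_empty_or_nonempty {x : ℝ | Real.cos (2 * x) = y} with h | ⟨x₀, h₀⟩
    · rw [h]
      exact countable_empty
    · refine Countable.mono (s₂ := range (fun k : ℤ => k * Real.pi + x₀) ∪
        range (fun k : ℤ => k * Real.pi - x₀)) ?_
        ((countable_range _).union (countable_range _))
      intro x hx
      have hx' : Real.cos (2 * x₀) = Real.cos (2 * x) := by
        rw [show Real.cos (2 * x₀) = y from h₀, show Real.cos (2 * x) = y from hx]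
      obtain ⟨k, hk | hk⟩ := Real.cos_eq_cos_iff.1 hx'
      · exact .inl ⟨k, by dsimp only; linarith⟩
      · exact .inr ⟨k, by dsimp only; linarith⟩
  · have hsub : {x : ℝ | ∃ m n : ℤ, m ≠ 0 ∧ m * x = n * Real.pi} ⊆
        ⋃ (m : ℤ) (n : ℤ), {x : ℝ | m ≠ 0 ∧ m * x = n * Real.pi} := by
      rintro x ⟨m, n, h⟩
      simp only [mem_iUnion]
      exact ⟨m, n, h⟩
    refine Countable.mono hsub (countable_iUnion fun m => countable_iUnion fun n => ?_)
    refine Set.Subsingleton.countable ?_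
    rintro x ⟨hm, hx⟩ y ⟨_, hy⟩
    exact mul_left_cancel₀ (Int.cast_ne_zero.2 hm) (hx.trans hy.symm)

theorem fields_not_numberField {θ : ℝ × ℝ} (hθ : θ ∈ triangleSpace)
    (h1 : θ.1 ∉ exceptionalAngles) (h2 : θ.2 ∉ exceptionalAngles) (T : Affine.Triangle ℝ ℂ)
    (hT : HasAngles T θ) : ¬ NumberField (Ksc (KZ.Surface T)) ∧ ¬ NumberField (Kcr (KZ.Surface T)) ∧
      ¬ NumberField (Ktr (KZ.Surface T)) := by
  obtain ⟨hθ1, hθ2, hθπ⟩ := hθ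
  have hirr : ∀ x ∉ exceptionalAngles, ∀ m n : ℤ, m * x = n * Real.pi → m = 0 := by
    intro x hx m n hmn
    by_contra hm
    exact hx (.inr ⟨m, n, hm, hmn⟩)
  have hcone0 : ∀ g : KZ.reflGroup T, ∃ c β r, c.1 = g ∧ KZ.IsCone T 0 c β θ.1 r := fun g =>
    KZ.exists_isCone (a := 1) (b := 2) g (by decide) (by decide) (by decide) hT.1 hθ1 (by linarith)
  have hcone1 : ∀ g : KZ.reflGroup T, ∃ c β r, c.1 = g ∧ KZ.IsCone T 1 c β θ.2 r := fun g =>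
    KZ.exists_isCone (a := 0) (b := 2) g (by decide) (by decide) (by decide) hT.2 hθ2 (by linarith)
  obtain ⟨R, hR⟩ : ∃ R : KZ.reflGroup T, ∀ z, (R : ℂ ≃ₗᵢ[ℝ] ℂ) z =
      Complex.exp ((2 * θ.1 : ℝ) * Complex.I) * z := by
    obtain ⟨c, β, r, hc1, hc⟩ := hcone0 1
    exact hc.exists_rotation hc1
  have hv : T.points 1 - T.points 0 ≠ 0 := KZ.points_sub_ne_zero (by decide)
  have hsad : ∀ n : ℕ, Complex.exp ((n * (2 * θ.1) : ℝ) * Complex.I) *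
      (T.points 1 - T.points 0) ∈ saddleVectors (KZ.Surface T) := by
    intro n
    obtain ⟨c, β, r, hc1, hc⟩ := hcone0 (R ^ n)
    obtain ⟨c', β', r', hc1', hc'⟩ := hcone1 (R ^ n)
    have := KZ.side_mem_saddleVectors hc hc' (by decide) (hc1.trans hc1'.symm) (hirr _ h1)
      (hirr _ h2)
    rwa [hc1, KZ.rotation_pow_apply hR] at this
  have hhol : ∀ n : ℕ, Complex.exp ((n * (2 * θ.1) : ℝ) * Complex.I) *
      (T.points 1 - T.points 0) ∈ relativeHolonomy (KZ.Surface T) := by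
    intro n
    obtain ⟨c, β, r, hc1, hc⟩ := hcone0 (R ^ n)
    obtain ⟨c', β', r', hc1', hc'⟩ := hcone1 (R ^ n)
    have := KZ.side_mem_relativeHolonomy hc hc' (by decide) (hc1.trans hc1'.symm) (hirr _ h1)
      (hirr _ h2)
    rwa [hc1, KZ.rotation_pow_apply hR] at this
  have hsin : ∀ n : ℕ, 0 < n → Real.sin (n * (2 * θ.1)) ≠ 0 := by
    intro n hn h
    obtain ⟨k, hk⟩ := Real.sin_eq_zero_iff.1 h
    have := hirr _ h1 (n * 2) k (by push_cast; linarith)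
    omega
  have htr : Transcendental ℚ (Real.cos (2 * θ.1)) := fun h => h1 (.inl h)
  have hs1 := hsin 1 one_pos
  rw [Nat.cast_one, one_mul] at hs1
  have hs3 := hsin 3 (by norm_num)
  rw [Nat.cast_ofNat] at hs3
  exact ⟨not_numberField_of_mem (two_mul_cos_mem_Ksc hv hs1 hhol) (transcendental_two_mul htr),
    not_numberField_of_mem (crossRatio_mem_Kcr hv hsin hsad) (transcendental_crossRatio htr hs1 hs3),
    not_numberField_of_mem (KZ.two_mul_cos_mem_Ktr hR) (transcendental_two_mul htr)⟩

end

theorem mainTheorem7 :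
    MeasureTheory.volume (triangleSpace \ {θ | ∀ T : Affine.Triangle ℝ ℂ, HasAngles T θ →
      ¬ NumberField (Ksc (KZ.Surface T)) ∧ ¬ NumberField (Kcr (KZ.Surface T)) ∧
      ¬ NumberField (Ktr (KZ.Surface T))}) = 0 := by
  have hnull : MeasureTheory.volume exceptionalAngles = 0 :=
    countable_exceptionalAngles.measure_zero _
  refine MeasureTheory.measure_mono_null
    (t := exceptionalAngles ×ˢ univ ∪ univ ×ˢ exceptionalAngles) ?_
    (MeasureTheory.measure_union_null ?_ ?_)
  · rintro θ ⟨hθ, hbad⟩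
    by_contra hcon
    have h1 : θ.1 ∉ exceptionalAngles := fun h => hcon (.inl ⟨h, mem_univ _⟩)
    have h2 : θ.2 ∉ exceptionalAngles := fun h => hcon (.inr ⟨mem_univ _, h⟩)
    exact hbad fun T hT => fields_not_numberField hθ h1 h2 T hT
  · rw [MeasureTheory.Measure.volume_eq_prod, MeasureTheory.Measure.prod_prod, hnull, zero_mul]
  · rw [MeasureTheory.Measure.volume_eq_prod, MeasureTheory.Measure.prod_prod, hnull, mul_zero]
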